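/- Let $k$ be a field and let $(C,\Delta,\epsilon)$ be a coalgebra over $k$, with Sweedler notation $\Delta(c)=c_{(1)}\otimes c_{(2)}$ and, for the iterated coproduct, $c_{(1)}\otimes\cdots\otimes c_{(m)}\in C^{\otimes m}$. An *oriented quantum coalgebra* $(C,b,T_d,T_u)$ consists of a bilinear form $b:C\times C\to k$ which has an inverse $b^{-1}$, that is $$b^{-1}(c_{(1)},d_{(1)})\,b(c_{(2)},d_{(2)})=\epsilon(c)\epsilon(d)=b(c_{(1)},d_{(1)})\,b^{-1}(c_{(2)},d_{(2)}),$$ and of two commuting linear automorphisms $T_d,T_u$ of $C$, such that for $T=T_d$ and for $T=T_u$ we have $\epsilon\circ T=\epsilon$ and $$\beta(T(c_{(1)}),d)\,\beta'(T(c_{(2)}),e)=\beta(T(c)_{(1)},d)\,\beta'(T(c)_{(2)},e),\qquad \beta(d,T(c_{(1)}))\,\beta'(e,T(c_{(2)}))=\beta(d,T(c)_{(1)})\,\beta'(e,T(c)_{(2)})$$ for all $\beta,\beta'\in\{b,b^{-1}\}$, and such that 1. $b(c_{(1)},T_u(d_{(2)}))\,b^{-1}(T_d(c_{(2)}),d_{(1)})=\epsilon(c)\epsilon(d)$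 and $b^{-1}(T_d(c_{(1)}),d_{(2)})\,b(c_{(2)},T_u(d_{(1)}))=\epsilon(c)\epsilon(d)$; 2. $b(c,d)=b(T_d(c),T_d(d))=b(T_u(c),T_u(d))$; 3. $b(c_{(1)},d_{(1)})\,b(c_{(2)},e_{(1)})\,b(d_{(2)},e_{(2)})=b(c_{(2)},d_{(2)})\,b(c_{(1)},e_{(2)})\,b(d_{(1)},e_{(1)})$ for all $c,d,e\in C$. An *oriented 1–1 tangle diagram* (with respect to the vertical direction) is a planar diagram in general position, built from crossings, local maxima, local minima and vertical strands. It has exactly one end at the bottom and one at the top, and it consists of a single oriented arc that joins these two ends, in either direction. Diagrams are considered up to planar isotopies that do not change the order of the heights of the crossings and extrema. A crossing has type $U$ if the strand from the lower left to the upper right is the over strand, and type $O$ if that strand is the under strand. Let $\mathbf T$ be such a diagram with $n$ crossings. Traverse $\mathbf T$ in the direction of its orientation and label the crossing lines $1,\dots,2n$ in the order in which they are encountered. On the portion of the traversal from line $\ell$ to the end, let $u_d(\ell)$ be the number of maxima traversed from right to left minus the number of minima traversed from right to left, and let $u_u(\ell)$ be the number of minima traversed from left to right minus the number of maxima traversed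 from left to right. For integers $p,q$ write $c^{p,q}_{\ell}=T_d^{u_d(\ell)+p}T_u^{u_u(\ell)+q}(c_{(\ell)})$. Define $\mathbf{Inv}_C(\mathbf T)\in C^*$ by letting $\mathbf{Inv}_C(\mathbf T)(c)$ be the (summed) product over all crossings of the following factors, where $i$ is the label of the over crossing line and $j$ the label of the under crossing line (for $n=0$, $\mathbf{Inv}_C(\mathbf T)=\epsilon$): * type $U$: $\;b(c^{0,0}_i,c^{0,0}_j)$ if both lines are directed upwards or both downwards; $\;b^{-1}(c^{0,1}_i,c^{0,0}_j)$ if the over line is directed upwards and the under line downwards; $\;b^{-1}(c^{1,0}_i,c^{0,0}_j)$ if the over line is directed downwards and the under line upwards; * type $O$: $\;b^{-1}(c^{0,0}_i,c^{0,0}_j)$ if both lines are directed upwards or both downwards; $\;b(c^{0,0}_i,c^{0,1}_j)$ if the over line is directed downwards and the under line upwards; $\;b(c^{0,0}_i,c^{1,0}_j)$ if the over line is directed upwards and the under line downwards. *Regular isotopy* of diagrams is the equivalence relation generated by the following local replacements, for all orientations. Figures are read from bottom to top. $U_r,O_r$ denote a crossing between the strands in positions $r,r+1$ (counted from the left); $\cap_r$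 denotes a maximum joining the strands in positions $r,r+1$; $\cup_r$ denotes a minimum whose two new strands are in positions $r,r+1$; $\emptyset$ denotes vertical strands. * (M.1) $\cup_{r+1}\cap_r\approx\emptyset$ and $\cup_r\cap_{r+1}\approx\emptyset$; * (M.2) $U_rO_r\approx\emptyset$ and $O_rU_r\approx\emptyset$; * (M.3) $O_rO_{r+1}O_r\approx O_{r+1}O_rO_{r+1}$ and $U_rU_{r+1}U_r\approx U_{r+1}U_rU_{r+1}$; * (M.4) $U_r\cap_{r+1}\approx O_{r+1}\cap_r$, $\;O_r\cap_{r+1}\approx U_{r+1}\cap_r$, $\;\cup_{r+1}O_r\approx\cup_rU_{r+1}$ and $\cup_{r+1}U_r\approx\cup_rO_{r+1}$; * exchange of the heights of two crossings or extrema that lie side by side. **Theorem.** Let $(C,b,T_d,T_u)$ be an oriented quantum coalgebra over $k$ and let $\mathbf T,\mathbf T'$ be oriented 1–1 tangle diagrams. If $\mathbf T$ and $\mathbf T'$ are regularly isotopic, then $\mathbf{Inv}_C(\mathbf T)=\mathbf{Inv}_C(\mathbf T')$ in $C^*$. -/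

import Mathlib

open scoped TensorProduct

/-! ### Oriented quantum coalgebras -/

section OrientedQuantumCoalgebras

variable {k : Type*} [Field k] {C : Type*} [AddCommGroup C] [Module k C] [Coalgebra k C]

open Coalgebra (counit Repr)

/-- `b'` is an inverse for the bilinear form `b`:
`b'(c₁, d₁) b(c₂, d₂) = ε(c) ε(d) = b(c₁, d₁) b'(c₂, d₂)` in Sweedler notation.

In this file `Repr k c (C × C)` is the type of the expressions `Δ c = ∑ i, left i ⊗ right i`. The
Sweedler sums below do not depend on the expression, so each identity is stated for all of them. -/
structure IsInverseForm (b b' : C →ₗ[k] C →ₗ[k] k) : Prop where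
  left_inv : ∀ (c d : C) (rc : Repr k c (C × C)) (rd : Repr k d (C × C)),
    ∑ i ∈ rc.index, ∑ j ∈ rd.index,
      b' (rc.left i) (rd.left j) * b (rc.right i) (rd.right j) =
    counit (R := k) c * counit (R := k) d
  right_inv : ∀ (c d : C) (rc : Repr k c (C × C)) (rd : Repr k d (C × C)),
    ∑ i ∈ rc.index, ∑ j ∈ rd.index,
      b (rc.left i) (rd.left j) * b' (rc.right i) (rd.right j) =
    counit (R := k) c * counit (R := k) d

/-- `T` is a coalgebra automorphism of `C` with respect to a set `S` of bilinear forms. -/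
structure IsCoalgebraAutWrt (S : Set (C →ₗ[k] C →ₗ[k] k)) (T : C ≃ₗ[k] C) : Prop where
  counit_apply : ∀ c : C, counit (R := k) (T c) = counit (R := k) c
  apply_left : ∀ b ∈ S, ∀ b' ∈ S, ∀ (c d e : C)
    (rc : Repr k c (C × C)) (rTc : Repr k (T c) (C × C)),
    ∑ i ∈ rc.index, b (T (rc.left i)) d * b' (T (rc.right i)) e =
    ∑ i ∈ rTc.index, b (rTc.left i) d * b' (rTc.right i) e
  apply_right : ∀ b ∈ S, ∀ b' ∈ S, ∀ (c d e : C)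
    (rc : Repr k c (C × C)) (rTc : Repr k (T c) (C × C)),
    ∑ i ∈ rc.index, b d (T (rc.left i)) * b' e (T (rc.right i)) =
    ∑ i ∈ rTc.index, b d (rTc.left i) * b' e (rTc.right i)

variable (k C) in
/-- An oriented quantum coalgebra structure `(b, T_d, T_u)` on the coalgebra `C`. The form `binv` is
`b⁻¹`; it is determined by `b`. -/
structure OrientedQuantumCoalgebra where
  b : C →ₗ[k] C →ₗ[k] k
  binv : C →ₗ[k] C →ₗ[k] k
  Td : C ≃ₗ[k] C
  Tu : C ≃ₗ[k] C
  isInverse : IsInverseForm b binv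
  commute : ∀ c : C, Td (Tu c) = Tu (Td c)
  autTd : IsCoalgebraAutWrt {b, binv} Td
  autTu : IsCoalgebraAutWrt {b, binv} Tu
  /-- `b(c₁, T_u(d₂)) b⁻¹(T_d(c₂), d₁) = ε(c) ε(d)` -/
  qc1_left : ∀ (c d : C) (rc : Repr k c (C × C)) (rd : Repr k d (C × C)),
    ∑ i ∈ rc.index, ∑ j ∈ rd.index,
      b (rc.left i) (Tu (rd.right j)) * binv (Td (rc.right i)) (rd.left j) =
    counit (R := k) c * counit (R := k) d
  /-- `b⁻¹(T_d(c₁), d₂) b(c₂, T_u(d₁)) = ε(c) ε(d)` -/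
  qc1_right : ∀ (c d : C) (rc : Repr k c (C × C)) (rd : Repr k d (C × C)),
    ∑ i ∈ rc.index, ∑ j ∈ rd.index,
      binv (Td (rc.left i)) (rd.right j) * b (rc.right i) (Tu (rd.left j)) =
    counit (R := k) c * counit (R := k) d
  qc2_Td : ∀ c d : C, b (Td c) (Td d) = b c d
  qc2_Tu : ∀ c d : C, b (Tu c) (Tu d) = b c d
  /-- `b(c₁, d₁) b(c₂, e₁) b(d₂, e₂) = b(c₂, d₂) b(c₁, e₂) b(d₁, e₁)` -/
  qc3 : ∀ (c d e : C)
    (rc : Repr k c (C × C)) (rd : Repr k d (C × C)) (re : Repr k e (C × C)),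
    ∑ i ∈ rc.index, ∑ j ∈ rd.index, ∑ l ∈ re.index,
      b (rc.left i) (rd.left j) * b (rc.right i) (re.left l) * b (rd.right j) (re.right l) =
    ∑ i ∈ rc.index, ∑ j ∈ rd.index, ∑ l ∈ re.index,
      b (rc.right i) (rd.right j) * b (rc.left i) (re.right l) * b (rd.left j) (re.left l)

end OrientedQuantumCoalgebras

/-! ### Oriented 1–1 tangle diagrams with respect to a vertical

A diagram in general position has its crossings and local extrema at distinct heights. Cut it by
horizontal lines into layers with one crossing or extremum each: apart from planar isotopies that
do not change the order of the heights, the diagram is the list of these layers, read upwards. -/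

namespace Tangle

/-- The crossings and the local extrema. In an `underCrossing` the line from the lower left to the
upper right lies over the other one; in an `overCrossing` it lies under the other one. -/
inductive Kind
  | underCrossing
  | overCrossing
  | maximum
  | minimum
  deriving DecidableEq

/-- The number of strands that enter a component from below. -/
def Kind.inputs : Kind → ℕ
  | .underCrossing => 2
  | .overCrossing => 2
  | .maximum => 2
  | .minimum => 0

/-- The number of strands that leave a component above. -/
def Kind.outputs : Kind → ℕ
  | .underCrossing => 2
  | .overCrossing => 2
  | .maximum => 0
  | .minimum => 2

def Kind.isCrossing : Kind → Bool
  | .underCrossing => true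
  | .overCrossing => true
  | .maximum => false
  | .minimum => false

/-- A layer: one component with exactly `pos` vertical strands to its left, and vertical strands to
its right. The strands at each height are numbered `0, 1, 2, …` from left to right. -/
structure Layer where
  kind : Kind
  pos : ℕ
  deriving DecidableEq

/-- `Composable n w m`: the layers of `w` fit on top of each other, with `n` strands at the bottom
and `m` strands at the top. -/
inductive Composable : ℕ → List Layer → ℕ → Prop
  | nil (n : ℕ) : Composable n [] n
  | cons {m : ℕ} {w : List Layer} (x : Kind) (left right : ℕ) :
      Composable (left + x.outputs + right) w m →
      Composable (left + x.inputs + right) (⟨x, left⟩ :: w) m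

/-- The types of oriented local extrema: `uPlus` is a minimum traversed from left to right, `uMinus`
a maximum traversed from left to right, `dPlus` a maximum traversed from right to left, `dMinus` a
minimum traversed from right to left. -/
inductive ExtremumType
  | uPlus
  | uMinus
  | dPlus
  | dMinus
  deriving DecidableEq

/-- What a traversal of a diagram meets: in the layer number `n`, the over crossing line
(`isOver = true`) or the under crossing line (`isOver = false`), traversed upwards or downwards, or a
local extremum. -/
inductive Passage
  | line (n : ℕ) (isOver up : Bool)
  | extremum (n : ℕ) (t : ExtremumType)
  deriving DecidableEq

/-- A strand enters the layer number `n` from below at position `p`. The result: the position and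
the direction (`true` = upwards) in which it leaves the layer, and what it has met. -/
def Layer.enterUp (n : ℕ) (x : Layer) (p : ℕ) : ℕ × Bool × List Passage :=
  match x.kind with
  | .underCrossing =>
      if p = x.pos then (x.pos + 1, true, [.line n true true])
      else if p = x.pos + 1 then (x.pos, true, [.line n false true])
      else (p, true, [])
  | .overCrossing =>
      if p = x.pos then (x.pos + 1, true, [.line n false true])
      else if p = x.pos + 1 then (x.pos, true, [.line n true true])
      else (p, true, [])
  | .maximum =>
      if p = x.pos then (x.pos + 1, false, [.extremum n .uMinus])
      else if p = x.pos + 1 then (x.pos, false, [.extremum n .dPlus])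
      else if p < x.pos then (p, true, [])
      else (p - 2, true, [])
  | .minimum => if p < x.pos then (p, true, []) else (p + 2, true, [])

/-- The same for a strand that enters the layer number `n` from above at position `p`. -/
def Layer.enterDown (n : ℕ) (x : Layer) (p : ℕ) : ℕ × Bool × List Passage :=
  match x.kind with
  | .underCrossing =>
      if p = x.pos + 1 then (x.pos, false, [.line n true false])
      else if p = x.pos then (x.pos + 1, false, [.line n false false])
      else (p, false, [])
  | .overCrossing =>
      if p = x.pos + 1 then (x.pos, false, [.line n false false])
      else if p = x.pos then (x.pos + 1, false, [.line n true false])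
      else (p, false, [])
  | .minimum =>
      if p = x.pos then (x.pos + 1, true, [.extremum n .uPlus])
      else if p = x.pos + 1 then (x.pos, true, [.extremum n .dMinus])
      else if p < x.pos then (p, false, [])
      else (p - 2, false, [])
  | .maximum => if p < x.pos then (p, false, []) else (p + 2, false, [])

/-- `Traverses w n p up path`: starting at position `p` on the horizontal line below the layer
number `n` of `w` (the line above the last layer if `n = w.length`), upwards if `up = true` and
downwards otherwise, the traversal of the diagram leaves it at its top or bottom after it has met
what is listed in `path`, in this order. -/
inductive Traverses (w : List Layer) : ℕ → ℕ → Bool → List Passage → Prop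
  | exitTop {n : ℕ} (p : ℕ) : n = w.length → Traverses w n p true []
  | exitBottom (p : ℕ) : Traverses w 0 p false []
  | stepUp {n p q : ℕ} {x : Layer} {up : Bool} {met path : List Passage} :
      w[n]? = some x → x.enterUp n p = (q, up, met) →
      Traverses w (if up then n + 1 else n) q up path →
      Traverses w n p true (met ++ path)
  | stepDown {n p q : ℕ} {x : Layer} {up : Bool} {met path : List Passage} :
      w[n]? = some x → x.enterDown n p = (q, up, met) →
      Traverses w (if up then n + 1 else n) q up path →
      Traverses w (n + 1) p false (met ++ path)

/-- The crossings of `w`. -/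
abbrev Crossing (w : List Layer) : Type := {n : Fin w.length // (w.get n).kind.isCrossing = true}

/-- The crossing lines of `w`: `(χ, true)` is the over crossing line of the crossing `χ`, and
`(χ, false)` is its under crossing line. -/
abbrev Line (w : List Layer) : Type := Crossing w × Bool

/-- The crossing line met in a passage, if any. -/
def Passage.line? (w : List Layer) : Passage → Option (Line w)
  | .line n isOver _ =>
      if h : n < w.length then
        if h' : (w.get ⟨n, h⟩).kind.isCrossing = true then some (⟨⟨n, h⟩, h'⟩, isOver) else none
      else none
  | .extremum _ _ => none

/-- The crossing lines met on a path, in the order in which they are encountered. -/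
def linesOf (w : List Layer) (path : List Passage) : List (Line w) :=
  path.filterMap (Passage.line? w)

/-- An oriented 1–1 tangle diagram. The base point is the bottom end if `up = true`, and the top end
otherwise. The list `path` records the traversal from the base point and is determined by `layers`
and `up`. The last three fields say that the diagram has no component besides the one that joins its
two ends: the traversal meets each crossing line exactly once, and it meets each local extremum. -/
structure Diagram where
  layers : List Layer
  composable : Composable 1 layers 1
  up : Bool
  path : List Passage
  traverses : Traverses layers (if up then 0 else layers.length) 0 up path
  lines_nodup : (linesOf layers path).Nodup
  mem_lines : ∀ l : Line layers, l ∈ linesOf layers path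
  mem_extrema : ∀ (n : ℕ) (x : Layer), layers[n]? = some x → x.kind.isCrossing = false →
    ∃ t : ExtremumType, Passage.extremum n t ∈ path

namespace Diagram

variable (T : Diagram)

/-- The crossing lines in the order of the traversal from the base point to the end point. -/
def lines : List (Line T.layers) := linesOf T.layers T.path

/-- The label of each crossing line (labels start from `0` here). -/
def label : Line T.layers ≃ Fin T.lines.length :=
  (T.lines_nodup.getEquivOfForallMemList T.lines T.mem_lines).symm

/-- Whether the crossing line `l` is oriented upwards. -/
def isUp (l : Line T.layers) : Bool := decide (Passage.line l.1.1 l.2 true ∈ T.path)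

/-- The portion of the traversal from the crossing line `l` to the end. -/
def pathFrom (l : Line T.layers) : List Passage :=
  T.path.dropWhile fun s => decide (s.line? T.layers ≠ some l)

/-- The number of local extrema of type `t` on the portion of the traversal from `l` to the end. -/
def extremaFrom (t : ExtremumType) (l : Line T.layers) : ℕ :=
  (T.pathFrom l).countP fun s =>
    match s with
    | .line _ _ _ => false
    | .extremum _ t' => decide (t' = t)

def ud (l : Line T.layers) : ℤ := (T.extremaFrom .dPlus l : ℤ) - T.extremaFrom .dMinus l

def uu (l : Line T.layers) : ℤ := (T.extremaFrom .uPlus l : ℤ) - T.extremaFrom .uMinus l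

end Diagram

/-! ### Regular isotopy -/

/-- The local moves, as pairs of figures; `i` is the number of strands to the left of a figure. -/
inductive Move : List Layer → List Layer → Prop
  | m1 (i : ℕ) : Move [⟨.minimum, i + 1⟩, ⟨.maximum, i⟩] []
  | m1' (i : ℕ) : Move [⟨.minimum, i⟩, ⟨.maximum, i + 1⟩] []
  | m2 (i : ℕ) : Move [⟨.underCrossing, i⟩, ⟨.overCrossing, i⟩] []
  | m2rev (i : ℕ) : Move [⟨.overCrossing, i⟩, ⟨.underCrossing, i⟩] []
  | m3 (i : ℕ) : Move
      [⟨.overCrossing, i⟩, ⟨.overCrossing, i + 1⟩, ⟨.overCrossing, i⟩]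
      [⟨.overCrossing, i + 1⟩, ⟨.overCrossing, i⟩, ⟨.overCrossing, i + 1⟩]
  | m3rev (i : ℕ) : Move
      [⟨.underCrossing, i⟩, ⟨.underCrossing, i + 1⟩, ⟨.underCrossing, i⟩]
      [⟨.underCrossing, i + 1⟩, ⟨.underCrossing, i⟩, ⟨.underCrossing, i + 1⟩]
  | m4 (i : ℕ) : Move
      [⟨.underCrossing, i⟩, ⟨.maximum, i + 1⟩] [⟨.overCrossing, i + 1⟩, ⟨.maximum, i⟩]
  | m4rev (i : ℕ) : Move
      [⟨.overCrossing, i⟩, ⟨.maximum, i + 1⟩] [⟨.underCrossing, i + 1⟩, ⟨.maximum, i⟩]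
  | m4' (i : ℕ) : Move
      [⟨.minimum, i + 1⟩, ⟨.overCrossing, i⟩] [⟨.minimum, i⟩, ⟨.underCrossing, i + 1⟩]
  | m4'rev (i : ℕ) : Move
      [⟨.minimum, i + 1⟩, ⟨.underCrossing, i⟩] [⟨.minimum, i⟩, ⟨.overCrossing, i + 1⟩]
  /-- Planar isotopy: two components side by side, `x` to the left of `y` with `gap` strands between
  them, exchange their heights. -/
  | exchange (x y : Kind) (i gap : ℕ) : Move
      [⟨x, i⟩, ⟨y, i + x.outputs + gap⟩] [⟨y, i + x.inputs + gap⟩, ⟨x, i⟩]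

/-- `T'` arises from `T` by the replacement of a local figure; the orientation is kept. -/
def Diagram.Step (T T' : Diagram) : Prop :=
  T.up = T'.up ∧ ∃ below fig fig' above : List Layer, Move fig fig' ∧
    T.layers = below ++ fig ++ above ∧ T'.layers = below ++ fig' ++ above

/-- Regular isotopy: the equivalence relation generated by the moves. -/
def Diagram.RegularlyIsotopic : Diagram → Diagram → Prop := Relation.EqvGen Diagram.Step

end Tangle

/-! ### The function `Inv_C` -/

section Invariant

variable {k : Type*} [Field k] {C : Type*} [AddCommGroup C] [Module k C] [Coalgebra k C]

variable (k C) in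
/-- The iterated coproduct `c ↦ c₍₁₎ ⊗ ⋯ ⊗ c₍ₙ₎`, which is `ε` for `n = 0` and the identity for
`n = 1`. -/
noncomputable def iteratedComul : (n : ℕ) → C →ₗ[k] PiTensorProduct k (fun _ : Fin n => C)
  | 0 => (LinearMap.toSpanSingleton k _ (PiTensorProduct.tprod k fun i : Fin 0 => i.elim0)).comp
      Coalgebra.counit
  | n + 1 => (TensorProduct.lift
      ((PiTensorProduct.lift (R := k) (s := fun _ : Fin n => C)).toLinearMap.comp
        (PiTensorProduct.tprod k (s := fun _ : Fin (n + 1) => C)).curryLeft)).comp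
      ((LinearMap.lTensor C (iteratedComul n)).comp Coalgebra.comul)

/-- The multilinear form `v ↦ ∏ χ, B χ (v (χ, true)) (v (χ, false))`. -/
def crossingProduct {X : Type*} [Fintype X] [DecidableEq X] (B : X → C →ₗ[k] C →ₗ[k] k) :
    MultilinearMap k (fun _ : X × Bool => C) k where
  toFun v := ∏ χ, B χ (v (χ, true)) (v (χ, false))
  map_update_add' := by
    intro _ v l x y
    obtain ⟨χ₀, o⟩ := l
    rw [Fintype.prod_eq_mul_prod_compl χ₀ , Fintype.prod_eq_mul_prod_compl χ₀,
      Fintype.prod_eq_mul_prod_compl χ₀]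
    have key : ∀ z, ∏ χ ∈ {χ₀}ᶜ, B χ (Function.update v (χ₀, o) z (χ, true))
        (Function.update v (χ₀, o) z (χ, false)) = ∏ χ ∈ {χ₀}ᶜ, B χ (v (χ, true)) (v (χ, false)) := by
      intro z
      refine Finset.prod_congr rfl fun χ h => ?_
      have h : χ ≠ χ₀ := by simpa using h
      simp [Function.update, h]
    rw [key, key, key, ← add_mul]
    cases o <;> simp [Function.update]
  map_update_smul' := by
    intro _ v l c x
    obtain ⟨χ₀, o⟩ := l
    rw [Fintype.prod_eq_mul_prod_compl χ₀ , Fintype.prod_eq_mul_prod_compl χ₀]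
    have key : ∀ z, ∏ χ ∈ {χ₀}ᶜ, B χ (Function.update v (χ₀, o) z (χ, true))
        (Function.update v (χ₀, o) z (χ, false)) = ∏ χ ∈ {χ₀}ᶜ, B χ (v (χ, true)) (v (χ, false)) := by
      intro z
      refine Finset.prod_congr rfl fun χ h => ?_
      have h : χ ≠ χ₀ := by simpa using h
      simp [Function.update, h]
    rw [key, key]
    cases o <;> simp [Function.update, mul_assoc]

namespace OrientedQuantumCoalgebra

open Tangle

variable (Q : OrientedQuantumCoalgebra k C)

/-- `T_d ^ m ∘ T_u ^ n` -/
noncomputable def twist (m n : ℤ) : C →ₗ[k] C := ((Q.Td ^ m * Q.Tu ^ n : C ≃ₗ[k] C) : C →ₗ[k] C)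

/-- The contribution of the crossing `χ` with over crossing line `i` and under crossing line `j`,
as a bilinear form in `c₍ᵢ₎` and `c₍ⱼ₎`. -/
noncomputable def contribution (T : Diagram) (χ : Crossing T.layers) : C →ₗ[k] C →ₗ[k] k :=
  let i : Line T.layers := (χ, true)
  let j : Line T.layers := (χ, false)
  match (T.layers.get χ.1).kind, T.isUp i, T.isUp j with
  | .underCrossing, true, true =>
      Q.b.compl₁₂ (Q.twist (T.ud i) (T.uu i)) (Q.twist (T.ud j) (T.uu j))
  | .underCrossing, false, false =>
      Q.b.compl₁₂ (Q.twist (T.ud i) (T.uu i)) (Q.twist (T.ud j) (T.uu j))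
  | .underCrossing, true, false =>
      Q.binv.compl₁₂ (Q.twist (T.ud i) (T.uu i + 1)) (Q.twist (T.ud j) (T.uu j))
  | .underCrossing, false, true =>
      Q.binv.compl₁₂ (Q.twist (T.ud i + 1) (T.uu i)) (Q.twist (T.ud j) (T.uu j))
  | .overCrossing, true, true =>
      Q.binv.compl₁₂ (Q.twist (T.ud i) (T.uu i)) (Q.twist (T.ud j) (T.uu j))
  | .overCrossing, false, false =>
      Q.binv.compl₁₂ (Q.twist (T.ud i) (T.uu i)) (Q.twist (T.ud j) (T.uu j))
  | .overCrossing, false, true =>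
      Q.b.compl₁₂ (Q.twist (T.ud i) (T.uu i)) (Q.twist (T.ud j) (T.uu j + 1))
  | .overCrossing, true, false =>
      Q.b.compl₁₂ (Q.twist (T.ud i) (T.uu i)) (Q.twist (T.ud j + 1) (T.uu j))
  -- the remaining kinds are not crossings
  | _, _, _ => 0

/-- `Inv_C(T)`, the functional that sends `c` to the product of the contributions of the crossings,
evaluated on `c₍₁₎ ⊗ ⋯ ⊗ c₍₂ₙ₎` along the labelling. It is `ε` if `T` has no crossings. -/
noncomputable def inv (T : Diagram) : Module.Dual k C :=
  (PiTensorProduct.lift ((crossingProduct (Q.contribution T)).domDomCongr T.label)).comp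
    (iteratedComul k C T.lines.length)

end OrientedQuantumCoalgebra

end Invariant

/-! It is enough to treat one local replacement, but labels, exponents and the iterated coproduct
are global data. The proof therefore has an algebraic half, with identities for the forms, and a
localisation half, which reduces the comparison of two diagrams to such identities.

Algebra. Since `b` and `b⁻¹` are invariant under `T_d` and `T_u`, a crossing contributes one of
these forms with its first argument twisted by a vector in `ℤ × ℤ`, which depends only on the
difference of the exponents of its two lines (`form_tw_tw`, `crossForm`). Sort the Sweedler factors
of each strand by height and not by time of traversal. Then a strand directed downwards merely has
its coalgebra replaced by the co-opposite one. For parallel strands (M.2) is the invertibility of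
`b`; for antiparallel strands it is axiom 1 (`sum_crossForm_mul_crossForm`). For (M.3) with parallel
strands one twists axiom 3. The other orientations follow in the convolution algebra of trilinear
forms: `PQR = RQP` gives `P R⁻¹ Q⁻¹ = Q⁻¹ R⁻¹ P`, which is a Yang–Baxter equation with the third
coalgebra reversed, and likewise for the first. If both are reversed, the second inversion uses
axiom 1, whose shift by `(1, 1)` agrees with the extra exponents of mixed crossings
(`sum_crossForm_yangBaxter`). For (M.4) these extra exponents compensate the exponent of the
extremum (`crossForm_max_over` and its companions).

Localisation. The product of the contributions is a multilinear form, and it factors as a linear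
functional after products in a commutative algebra `R` (`exists_algebra_of_forms`). Hence the
invariant is a functional applied to a convolution product in `Hom(C, R)` with one factor for each
crossing line, in the order of the traversal (`inv_apply`). Associativity of convolution now allows
the passage of a strand through the figure to be treated as a single factor. The traversals of both
diagrams expand one common list of letters (`Diagram.exists_letters`). A strand has the same total
exponent in both figures, so nothing changes outside, and with `R ⊗ R'` as coefficients the outside
and the inside separate (`exists_factorization`). What remains is an identity between the
functionals that the two figures define on their strands, for every choice of directions and final
exponents (`FigureEq`, `inv_eq_of_letters`). -/

set_option linter.unusedSectionVars false

/-! ### The Yang–Baxter equation in the convolution algebra of trilinear forms. -/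

section YangBaxter

open Coalgebra (counit Repr)
open WithConv

variable {k : Type*} [Field k]
  {C₁ : Type*} [AddCommGroup C₁] [Module k C₁] [Coalgebra k C₁]
  {C₂ : Type*} [AddCommGroup C₂] [Module k C₂] [Coalgebra k C₂]
  {C₃ : Type*} [AddCommGroup C₃] [Module k C₃] [Coalgebra k C₃]

/-- `x(c₁, d₁) y(c₂, d₂) = ε(c) ε(d)` for forms on two possibly different coalgebras. -/
def ConvInverse (x y : C₁ →ₗ[k] C₂ →ₗ[k] k) : Prop :=
  ∀ (c : C₁) (d : C₂) (rc : Repr k c (C₁ × C₁)) (rd : Repr k d (C₂ × C₂)),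
    ∑ i ∈ rc.index, ∑ j ∈ rd.index, x (rc.left i) (rd.left j) * y (rc.right i) (rd.right j) =
      counit (R := k) c * counit (R := k) d

/-- The Yang–Baxter equation for forms on three possibly different coalgebras. -/
def YangBaxter (x : C₁ →ₗ[k] C₂ →ₗ[k] k) (y : C₁ →ₗ[k] C₃ →ₗ[k] k) (z : C₂ →ₗ[k] C₃ →ₗ[k] k) :
    Prop :=
  ∀ (c : C₁) (d : C₂) (e : C₃)
    (rc : Repr k c (C₁ × C₁)) (rd : Repr k d (C₂ × C₂)) (re : Repr k e (C₃ × C₃)),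
    ∑ i ∈ rc.index, ∑ j ∈ rd.index, ∑ l ∈ re.index,
      x (rc.left i) (rd.left j) * y (rc.right i) (re.left l) * z (rd.right j) (re.right l) =
    ∑ i ∈ rc.index, ∑ j ∈ rd.index, ∑ l ∈ re.index,
      z (rd.left j) (re.left l) * y (rc.left i) (re.right l) * x (rc.right i) (rd.right j)

theorem sum_counit_mul_apply {D : Type*} [AddCommGroup D] [Module k D] [Coalgebra k D]
    {e : D} {α : Type*} (re : Repr k e α) (f : D →ₗ[k] k) :
    ∑ l ∈ re.index, counit (R := k) (re.left l) * f (re.right l) = f e := by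
  conv_rhs => rw [← Coalgebra.sum_counit_smul re]
  simp

theorem sum_apply_mul_counit {D : Type*} [AddCommGroup D] [Module k D] [Coalgebra k D]
    {e : D} {α : Type*} (re : Repr k e α) (f : D →ₗ[k] k) :
    ∑ l ∈ re.index, f (re.left l) * counit (R := k) (re.right l) = f e := by
  have := congrArg (TensorProduct.lift (LinearMap.mul k k) ∘ TensorProduct.map f LinearMap.id)
    (Coalgebra.sum_tmul_counit_eq re)
  simpa only [Function.comp_apply, map_sum, TensorProduct.map_tmul, TensorProduct.lift.tmul,
    LinearMap.mul_apply', LinearMap.id_apply, mul_one] using this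

variable (k C₁ C₂ C₃) in
/-- The convolution algebra of trilinear forms. -/
abbrev ConvAlg : Type _ := WithConv (C₁ ⊗[k] (C₂ ⊗[k] C₃) →ₗ[k] k)

variable (C₃) in
-- The indices name the tensor legs on which the form acts. On the remaining leg stands the counit,
-- the unit for convolution, so that invertible bilinear forms become units of the trilinear
-- algebra.
noncomputable def emb₁₂ (x : C₁ →ₗ[k] C₂ →ₗ[k] k) : ConvAlg k C₁ C₂ C₃ :=
  toConv (LinearMap.mul' k k ∘ₗ TensorProduct.map (TensorProduct.lift x) counit ∘ₗ
    (TensorProduct.assoc k C₁ C₂ C₃).symm.toLinearMap)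

variable (C₂) in
noncomputable def emb₁₃ (x : C₁ →ₗ[k] C₃ →ₗ[k] k) : ConvAlg k C₁ C₂ C₃ :=
  toConv ((emb₁₂ C₂ x).ofConv ∘ₗ
    TensorProduct.map LinearMap.id (TensorProduct.comm k C₂ C₃).toLinearMap)

variable (C₁) in
noncomputable def emb₂₃ (x : C₂ →ₗ[k] C₃ →ₗ[k] k) : ConvAlg k C₁ C₂ C₃ :=
  toConv (LinearMap.mul' k k ∘ₗ TensorProduct.map counit (TensorProduct.lift x))

@[simp]
theorem emb₁₂_tmul (x : C₁ →ₗ[k] C₂ →ₗ[k] k) (c : C₁) (d : C₂) (e : C₃) :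
    emb₁₂ C₃ x (c ⊗ₜ (d ⊗ₜ e)) = x c d * counit (R := k) e := by
  simp [emb₁₂]

@[simp]
theorem emb₁₃_tmul (x : C₁ →ₗ[k] C₃ →ₗ[k] k) (c : C₁) (d : C₂) (e : C₃) :
    emb₁₃ C₂ x (c ⊗ₜ (d ⊗ₜ e)) = x c e * counit (R := k) d := by
  simp [emb₁₃]

@[simp]
theorem emb₂₃_tmul (x : C₂ →ₗ[k] C₃ →ₗ[k] k) (c : C₁) (d : C₂) (e : C₃) :
    emb₂₃ C₁ x (c ⊗ₜ (d ⊗ₜ e)) = counit (R := k) c * x d e := by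
  simp [emb₂₃]

theorem convAlg_mul_tmul (X Y : ConvAlg k C₁ C₂ C₃) {c : C₁} {d : C₂} {e : C₃}
    (rc : Repr k c (C₁ × C₁)) (rd : Repr k d (C₂ × C₂)) (re : Repr k e (C₃ × C₃)) :
    (X * Y) (c ⊗ₜ (d ⊗ₜ e)) = ∑ i ∈ rc.index, ∑ j ∈ rd.index, ∑ l ∈ re.index,
      X (rc.left i ⊗ₜ (rd.left j ⊗ₜ re.left l)) *
        Y (rc.right i ⊗ₜ (rd.right j ⊗ₜ re.right l)) := by
  rw [LinearMap.convMul_apply, TensorProduct.comul_tmul, TensorProduct.comul_tmul, ← rc.eq,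
    ← rd.eq, ← re.eq]
  simp only [TensorProduct.sum_tmul, TensorProduct.tmul_sum, map_sum,
    TensorProduct.AlgebraTensorModule.tensorTensorTensorComm_tmul, TensorProduct.map_tmul,
    LinearMap.mul'_apply]
  rw [Finset.sum_congr rfl fun l _ => Finset.sum_comm, Finset.sum_comm]
  exact Finset.sum_congr rfl fun i _ => Finset.sum_comm

/-- The counit in the third leg absorbs the coproduct of `e`, which leaves the other factor
evaluated at `e` itself. -/
theorem emb₁₂_mul_tmul (x : C₁ →ₗ[k] C₂ →ₗ[k] k) (Y : ConvAlg k C₁ C₂ C₃) {c : C₁} {d : C₂}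
    (e : C₃) (rc : Repr k c (C₁ × C₁)) (rd : Repr k d (C₂ × C₂)) :
    (emb₁₂ C₃ x * Y) (c ⊗ₜ (d ⊗ₜ e)) = ∑ i ∈ rc.index, ∑ j ∈ rd.index,
      x (rc.left i) (rd.left j) * Y (rc.right i ⊗ₜ (rd.right j ⊗ₜ e)) := by
  rw [convAlg_mul_tmul _ _ rc rd (Repr.arbitrary k e)]
  refine Finset.sum_congr rfl fun i _ => Finset.sum_congr rfl fun j _ => ?_
  simp_rw [emb₁₂_tmul, mul_assoc, ← Finset.mul_sum]
  congr 1
  exact sum_counit_mul_apply _ (Y.ofConv ∘ₗ TensorProduct.mk k _ _ (rc.right i) ∘ₗ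
    TensorProduct.mk k _ _ (rd.right j))

theorem emb₁₃_mul_tmul (x : C₁ →ₗ[k] C₃ →ₗ[k] k) (Y : ConvAlg k C₁ C₂ C₃) {c : C₁} (d : C₂)
    {e : C₃} (rc : Repr k c (C₁ × C₁)) (re : Repr k e (C₃ × C₃)) :
    (emb₁₃ C₂ x * Y) (c ⊗ₜ (d ⊗ₜ e)) = ∑ i ∈ rc.index, ∑ l ∈ re.index,
      x (rc.left i) (re.left l) * Y (rc.right i ⊗ₜ (d ⊗ₜ re.right l)) := by
  rw [convAlg_mul_tmul _ _ rc (Repr.arbitrary k d) re]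
  refine Finset.sum_congr rfl fun i _ => ?_
  rw [Finset.sum_comm]
  refine Finset.sum_congr rfl fun l _ => ?_
  simp_rw [emb₁₃_tmul, mul_assoc, ← Finset.mul_sum]
  congr 1
  exact sum_counit_mul_apply _ (Y.ofConv ∘ₗ TensorProduct.mk k _ _ (rc.right i) ∘ₗ
    (TensorProduct.mk k _ _).flip (re.right l))

theorem emb₂₃_mul_tmul (x : C₂ →ₗ[k] C₃ →ₗ[k] k) (Y : ConvAlg k C₁ C₂ C₃) (c : C₁) {d : C₂}
    {e : C₃} (rd : Repr k d (C₂ × C₂)) (re : Repr k e (C₃ × C₃)) :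
    (emb₂₃ C₁ x * Y) (c ⊗ₜ (d ⊗ₜ e)) = ∑ j ∈ rd.index, ∑ l ∈ re.index,
      x (rd.left j) (re.left l) * Y (c ⊗ₜ (rd.right j ⊗ₜ re.right l)) := by
  rw [convAlg_mul_tmul _ _ (Repr.arbitrary k c) rd re, Finset.sum_comm]
  refine Finset.sum_congr rfl fun j _ => ?_
  rw [Finset.sum_comm]
  refine Finset.sum_congr rfl fun l _ => ?_
  simp_rw [emb₂₃_tmul, mul_comm (counit (R := k) _), mul_assoc, ← Finset.mul_sum]
  congr 1
  exact sum_counit_mul_apply _ (Y.ofConv ∘ₗ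
    (TensorProduct.mk k _ _).flip (rd.right j ⊗ₜ re.right l))

theorem convAlg_ext {X Y : ConvAlg k C₁ C₂ C₃}
    (h : ∀ c d e, X (c ⊗ₜ (d ⊗ₜ e)) = Y (c ⊗ₜ (d ⊗ₜ e))) : X = Y := by
  ext c d e
  exact h c d e

theorem ConvInverse.emb₁₂ {x y : C₁ →ₗ[k] C₂ →ₗ[k] k} (h : ConvInverse x y) :
    emb₁₂ C₃ x * emb₁₂ C₃ y = 1 := by
  refine convAlg_ext fun c d e => ?_
  rw [emb₁₂_mul_tmul _ _ _ (Repr.arbitrary k c) (Repr.arbitrary k d)]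
  simp_rw [emb₁₂_tmul, ← mul_assoc, ← Finset.sum_mul, h c d]
  simp [mul_comm, mul_assoc]

theorem ConvInverse.emb₁₃ {x y : C₁ →ₗ[k] C₃ →ₗ[k] k} (h : ConvInverse x y) :
    emb₁₃ C₂ x * emb₁₃ C₂ y = 1 := by
  refine convAlg_ext fun c d e => ?_
  rw [emb₁₃_mul_tmul _ _ _ (Repr.arbitrary k c) (Repr.arbitrary k e)]
  simp_rw [emb₁₃_tmul, ← mul_assoc, ← Finset.sum_mul, h c e]
  simp [mul_comm, mul_left_comm]

theorem ConvInverse.emb₂₃ {x y : C₂ →ₗ[k] C₃ →ₗ[k] k} (h : ConvInverse x y) :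
    emb₂₃ C₁ x * emb₂₃ C₁ y = 1 := by
  refine convAlg_ext fun c d e => ?_
  rw [emb₂₃_mul_tmul _ _ _ (Repr.arbitrary k d) (Repr.arbitrary k e)]
  simp_rw [emb₂₃_tmul, mul_left_comm _ (counit (R := k) c), ← Finset.mul_sum, h d e]
  simp [mul_comm]

section Products

variable (p : C₁ →ₗ[k] C₂ →ₗ[k] k) (q : C₁ →ₗ[k] C₃ →ₗ[k] k) (r : C₂ →ₗ[k] C₃ →ₗ[k] k)
  {c : C₁} {d : C₂} {e : C₃}
  (rc : Repr k c (C₁ × C₁)) (rd : Repr k d (C₂ × C₂)) (re : Repr k e (C₃ × C₃))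

/-- The products of two and of three embedded forms in Sweedler notation. All six orders of three
factors occur: two in the Yang–Baxter equation, and four after two of the factors have been
inverted. -/
theorem emb₁₂_mul_emb₁₃ :
    (emb₁₂ C₃ p * emb₁₃ C₂ q) (c ⊗ₜ (d ⊗ₜ e)) = ∑ i ∈ rc.index,
      p (rc.left i) d * q (rc.right i) e := by
  rw [emb₁₂_mul_tmul p _ _ rc (Repr.arbitrary k d)]
  refine Finset.sum_congr rfl fun i _ => ?_
  simp_rw [emb₁₃_tmul]
  refine Eq.trans ?_ (congrArg (· * _)
    (sum_apply_mul_counit (Repr.arbitrary k d) (p (rc.left i))))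
  rw [Finset.sum_mul]
  exact Finset.sum_congr rfl fun _ _ => by ring

theorem emb₁₂_mul_emb₂₃ :
    (emb₁₂ C₃ p * emb₂₃ C₁ r) (c ⊗ₜ (d ⊗ₜ e)) = ∑ j ∈ rd.index,
      p c (rd.left j) * r (rd.right j) e := by
  rw [emb₁₂_mul_tmul p _ _ (Repr.arbitrary k c) rd, Finset.sum_comm]
  refine Finset.sum_congr rfl fun j _ => ?_
  simp_rw [emb₂₃_tmul]
  refine Eq.trans ?_ (congrArg (· * _)
    (sum_apply_mul_counit (Repr.arbitrary k c) (p.flip (rd.left j))))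
  rw [Finset.sum_mul]
  exact Finset.sum_congr rfl fun _ _ => by rw [LinearMap.flip_apply]; ring

theorem emb₁₃_mul_emb₁₂ :
    (emb₁₃ C₂ q * emb₁₂ C₃ p) (c ⊗ₜ (d ⊗ₜ e)) = ∑ i ∈ rc.index,
      q (rc.left i) e * p (rc.right i) d := by
  rw [emb₁₃_mul_tmul q _ _ rc (Repr.arbitrary k e)]
  refine Finset.sum_congr rfl fun i _ => ?_
  simp_rw [emb₁₂_tmul]
  refine Eq.trans ?_ (congrArg (· * _)
    (sum_apply_mul_counit (Repr.arbitrary k e) (q (rc.left i))))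
  rw [Finset.sum_mul]
  exact Finset.sum_congr rfl fun _ _ => by ring

theorem emb₁₃_mul_emb₂₃ :
    (emb₁₃ C₂ q * emb₂₃ C₁ r) (c ⊗ₜ (d ⊗ₜ e)) = ∑ l ∈ re.index,
      q c (re.left l) * r d (re.right l) := by
  rw [emb₁₃_mul_tmul q _ _ (Repr.arbitrary k c) re, Finset.sum_comm]
  refine Finset.sum_congr rfl fun l _ => ?_
  simp_rw [emb₂₃_tmul]
  refine Eq.trans ?_ (congrArg (· * _)
    (sum_apply_mul_counit (Repr.arbitrary k c) (q.flip (re.left l))))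
  rw [Finset.sum_mul]
  exact Finset.sum_congr rfl fun _ _ => by rw [LinearMap.flip_apply]; ring

theorem emb₂₃_mul_emb₁₂ :
    (emb₂₃ C₁ r * emb₁₂ C₃ p) (c ⊗ₜ (d ⊗ₜ e)) = ∑ j ∈ rd.index,
      r (rd.left j) e * p c (rd.right j) := by
  rw [emb₂₃_mul_tmul r _ _ rd (Repr.arbitrary k e)]
  refine Finset.sum_congr rfl fun j _ => ?_
  simp_rw [emb₁₂_tmul]
  refine Eq.trans ?_ (congrArg (· * _)
    (sum_apply_mul_counit (Repr.arbitrary k e) (r (rd.left j))))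
  rw [Finset.sum_mul]
  exact Finset.sum_congr rfl fun _ _ => by ring

theorem emb₂₃_mul_emb₁₃ :
    (emb₂₃ C₁ r * emb₁₃ C₂ q) (c ⊗ₜ (d ⊗ₜ e)) = ∑ l ∈ re.index,
      r d (re.left l) * q c (re.right l) := by
  rw [emb₂₃_mul_tmul r _ _ (Repr.arbitrary k d) re, Finset.sum_comm]
  refine Finset.sum_congr rfl fun l _ => ?_
  simp_rw [emb₁₃_tmul]
  refine Eq.trans ?_ (congrArg (· * _)
    (sum_apply_mul_counit (Repr.arbitrary k d) (r.flip (re.left l))))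
  rw [Finset.sum_mul]
  exact Finset.sum_congr rfl fun _ _ => by rw [LinearMap.flip_apply]; ring

theorem emb₁₂_mul_emb₁₃_mul_emb₂₃ :
    (emb₁₂ C₃ p * (emb₁₃ C₂ q * emb₂₃ C₁ r)) (c ⊗ₜ (d ⊗ₜ e)) =
      ∑ i ∈ rc.index, ∑ j ∈ rd.index, ∑ l ∈ re.index,
        p (rc.left i) (rd.left j) * q (rc.right i) (re.left l) * r (rd.right j) (re.right l) := by
  rw [emb₁₂_mul_tmul p _ _ rc rd]
  refine Finset.sum_congr rfl fun i _ => Finset.sum_congr rfl fun j _ => ?_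
  simp_rw [emb₁₃_mul_emb₂₃ q r re, Finset.mul_sum, mul_assoc]

theorem emb₂₃_mul_emb₁₃_mul_emb₁₂ :
    (emb₂₃ C₁ r * (emb₁₃ C₂ q * emb₁₂ C₃ p)) (c ⊗ₜ (d ⊗ₜ e)) =
      ∑ i ∈ rc.index, ∑ j ∈ rd.index, ∑ l ∈ re.index,
        r (rd.left j) (re.left l) * q (rc.left i) (re.right l) * p (rc.right i) (rd.right j) := by
  rw [emb₂₃_mul_tmul r _ _ rd re, Finset.sum_comm (s := rc.index)]
  refine Finset.sum_congr rfl fun j _ => ?_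
  rw [Finset.sum_comm (s := rc.index)]
  refine Finset.sum_congr rfl fun l _ => ?_
  simp_rw [emb₁₃_mul_emb₁₂ p q rc, Finset.mul_sum, mul_assoc]

theorem emb₁₂_mul_emb₂₃_mul_emb₁₃ :
    (emb₁₂ C₃ p * (emb₂₃ C₁ r * emb₁₃ C₂ q)) (c ⊗ₜ (d ⊗ₜ e)) =
      ∑ i ∈ rc.index, ∑ j ∈ rd.index, ∑ l ∈ re.index,
        p (rc.left i) (rd.left j) * r (rd.right j) (re.left l) * q (rc.right i) (re.right l) := by
  rw [emb₁₂_mul_tmul p _ _ rc rd]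
  refine Finset.sum_congr rfl fun i _ => Finset.sum_congr rfl fun j _ => ?_
  simp_rw [emb₂₃_mul_emb₁₃ q r re, Finset.mul_sum, mul_assoc]

theorem emb₁₃_mul_emb₂₃_mul_emb₁₂ :
    (emb₁₃ C₂ q * (emb₂₃ C₁ r * emb₁₂ C₃ p)) (c ⊗ₜ (d ⊗ₜ e)) =
      ∑ i ∈ rc.index, ∑ j ∈ rd.index, ∑ l ∈ re.index,
        q (rc.left i) (re.left l) * r (rd.left j) (re.right l) * p (rc.right i) (rd.right j) := by
  rw [emb₁₃_mul_tmul q _ _ rc re]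
  refine Finset.sum_congr rfl fun i _ => ?_
  rw [Finset.sum_comm (s := rd.index)]
  refine Finset.sum_congr rfl fun l _ => ?_
  simp_rw [emb₂₃_mul_emb₁₂ p r rd, Finset.mul_sum, mul_assoc]

theorem emb₁₃_mul_emb₁₂_mul_emb₂₃ :
    (emb₁₃ C₂ q * (emb₁₂ C₃ p * emb₂₃ C₁ r)) (c ⊗ₜ (d ⊗ₜ e)) =
      ∑ i ∈ rc.index, ∑ j ∈ rd.index, ∑ l ∈ re.index,
        q (rc.left i) (re.left l) * p (rc.right i) (rd.left j) * r (rd.right j) (re.right l) := by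
  rw [emb₁₃_mul_tmul q _ _ rc re]
  refine Finset.sum_congr rfl fun i _ => ?_
  rw [Finset.sum_comm (s := rd.index)]
  refine Finset.sum_congr rfl fun l _ => ?_
  simp_rw [emb₁₂_mul_emb₂₃ p r rd, Finset.mul_sum, mul_assoc]

theorem emb₂₃_mul_emb₁₂_mul_emb₁₃ :
    (emb₂₃ C₁ r * (emb₁₂ C₃ p * emb₁₃ C₂ q)) (c ⊗ₜ (d ⊗ₜ e)) =
      ∑ i ∈ rc.index, ∑ j ∈ rd.index, ∑ l ∈ re.index,
        r (rd.left j) (re.left l) * p (rc.left i) (rd.right j) * q (rc.right i) (re.right l) := by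
  rw [emb₂₃_mul_tmul r _ _ rd re, Finset.sum_comm (s := rc.index)]
  refine Finset.sum_congr rfl fun j _ => ?_
  rw [Finset.sum_comm (s := rc.index)]
  refine Finset.sum_congr rfl fun l _ => ?_
  simp_rw [emb₁₂_mul_emb₁₃ p q rc, Finset.mul_sum, mul_assoc]

end Products

theorem yangBaxter_iff {p : C₁ →ₗ[k] C₂ →ₗ[k] k} {q : C₁ →ₗ[k] C₃ →ₗ[k] k}
    {r : C₂ →ₗ[k] C₃ →ₗ[k] k} : YangBaxter p q r ↔
      emb₁₂ C₃ p * (emb₁₃ C₂ q * emb₂₃ C₁ r) = emb₂₃ C₁ r * (emb₁₃ C₂ q * emb₁₂ C₃ p) := by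
  constructor
  · intro h
    refine convAlg_ext fun c d e => ?_
    rw [emb₁₂_mul_emb₁₃_mul_emb₂₃ p q r (Repr.arbitrary k c) (Repr.arbitrary k d)
      (Repr.arbitrary k e), emb₂₃_mul_emb₁₃_mul_emb₁₂ p q r (Repr.arbitrary k c)
      (Repr.arbitrary k d) (Repr.arbitrary k e)]
    exact h c d e _ _ _
  · intro h c d e rc rd re
    rw [← emb₁₂_mul_emb₁₃_mul_emb₂₃ p q r rc rd re, ← emb₂₃_mul_emb₁₃_mul_emb₁₂ p q r rc rd re, h]

/-- Taking inverses on both sides of `PQR = RQP` in the group of units only exchanges the two sides.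
-/
theorem YangBaxter.inverse {p p' : C₁ →ₗ[k] C₂ →ₗ[k] k} {q q' : C₁ →ₗ[k] C₃ →ₗ[k] k}
    {r r' : C₂ →ₗ[k] C₃ →ₗ[k] k} (h : YangBaxter p q r) (hp : ConvInverse p p')
    (hp' : ConvInverse p' p) (hq : ConvInverse q q') (hq' : ConvInverse q' q)
    (hr : ConvInverse r r') (hr' : ConvInverse r' r) : YangBaxter p' q' r' := by
  rw [yangBaxter_iff] at h ⊢
  -- The units are kept opaque while the group identities are used; substitution afterwards returns
  -- to the embedded forms.
  obtain ⟨P, hP⟩ : ∃ u : (ConvAlg k C₁ C₂ C₃)ˣ, u = ⟨_, _, hp.emb₁₂, hp'.emb₁₂⟩ := ⟨_, rfl⟩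
  obtain ⟨Q, hQ⟩ : ∃ u : (ConvAlg k C₁ C₂ C₃)ˣ, u = ⟨_, _, hq.emb₁₃, hq'.emb₁₃⟩ := ⟨_, rfl⟩
  obtain ⟨R, hR⟩ : ∃ u : (ConvAlg k C₁ C₂ C₃)ˣ, u = ⟨_, _, hr.emb₂₃, hr'.emb₂₃⟩ := ⟨_, rfl⟩
  have h' : P * (Q * R) = R * (Q * P) := by subst hP hQ hR; exact Units.ext h
  have : P⁻¹ * (Q⁻¹ * R⁻¹) = R⁻¹ * (Q⁻¹ * P⁻¹) := by
    rw [← mul_inv_rev, ← mul_inv_rev, ← mul_inv_rev, ← mul_inv_rev, mul_assoc, mul_assoc, h']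
  subst hP hQ hR
  exact congrArg Units.val this

/-- The co-opposite coalgebra. -/
def Coop (D : Type*) : Type _ := D

section Coop

variable {D : Type*} [AddCommGroup D] [Module k D] [Coalgebra k D]

instance : AddCommGroup (Coop D) := inferInstanceAs (AddCommGroup D)

instance : Module k (Coop D) := inferInstanceAs (Module k D)

variable (k D) in
/-- The opposite coproduct `c ↦ c₂ ⊗ c₁`. -/
noncomputable def coopComul : D →ₗ[k] D ⊗[k] D :=
  (TensorProduct.comm k D D).toLinearMap ∘ₗ CoalgebraStruct.comul

theorem coopComul_eq {c : D} {α : Type*} (rc : Repr k c α) :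
    coopComul k D c = ∑ i ∈ rc.index, rc.right i ⊗ₜ rc.left i := by
  simp [coopComul, ← rc.eq]

/-- Reversing the order of all three factors turns the one bracketing of the iterated coproduct into
the other. -/
theorem coopComul_coassoc :
    TensorProduct.assoc k D D D ∘ₗ (coopComul k D).rTensor D ∘ₗ coopComul k D =
      (coopComul k D).lTensor D ∘ₗ coopComul k D := by
  ext c
  have h := congrArg ((TensorProduct.assoc k D D D).toLinearMap ∘ₗ
    (TensorProduct.comm k D (D ⊗[k] D)).toLinearMap ∘ₗ
    (TensorProduct.comm k D D).toLinearMap.lTensor D)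
    (Coalgebra.sum_tmul_tmul_eq (Repr.arbitrary k c) (fun _ => Repr.arbitrary k _)
      (fun _ => Repr.arbitrary k _))
  simp only [map_sum, LinearMap.comp_apply, LinearMap.lTensor_tmul, LinearEquiv.coe_coe,
    TensorProduct.comm_tmul, TensorProduct.assoc_tmul] at h
  simp only [LinearMap.comp_apply, coopComul_eq (Repr.arbitrary k _), map_sum,
    LinearMap.rTensor_tmul, LinearMap.lTensor_tmul, TensorProduct.sum_tmul,
    TensorProduct.tmul_sum, LinearEquiv.coe_coe, TensorProduct.assoc_tmul]
  exact h.symm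

noncomputable instance : Coalgebra k (Coop D) where
  comul := coopComul k D
  counit := (CoalgebraStruct.counit : D →ₗ[k] k)
  coassoc := by
    have h := coopComul_coassoc (k := k) (D := D)
    exact h
  rTensor_counit_comp_comul := by
    refine LinearMap.ext fun (c : D) => ?_
    change (counit (R := k) (A := D)).rTensor D (coopComul k D c) = 1 ⊗ₜ c
    rw [coopComul_eq (Repr.arbitrary k c), map_sum]
    have h := congrArg (TensorProduct.comm k D k)
      (Coalgebra.sum_tmul_counit_eq (Repr.arbitrary k c))
    simpa only [map_sum, TensorProduct.comm_tmul, LinearMap.rTensor_tmul,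
      LinearMap.lTensor_tmul] using h
  lTensor_counit_comp_comul := by
    refine LinearMap.ext fun (c : D) => ?_
    change (counit (R := k) (A := D)).lTensor D (coopComul k D c) = c ⊗ₜ 1
    rw [coopComul_eq (Repr.arbitrary k c), map_sum]
    have h := congrArg (TensorProduct.comm k k D)
      (Coalgebra.sum_counit_tmul_eq (Repr.arbitrary k c))
    simpa only [map_sum, TensorProduct.comm_tmul, LinearMap.rTensor_tmul,
      LinearMap.lTensor_tmul] using h

/-- The representation of `Δ c` in the co-opposite coalgebra. -/
def Coalgebra.Repr.coop {c : D} (rc : Repr k c (D × D)) :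
    Repr k (A := Coop D) c (Coop D × Coop D) where
  index := rc.index
  left := rc.right
  right := rc.left
  eq := (coopComul_eq rc).symm

/-- A representation of `Δ c` from one in the co-opposite coalgebra. -/
def Coalgebra.Repr.uncoop {c : Coop D} (rc : Repr k c (Coop D × Coop D)) :
    Repr k (A := D) c (D × D) where
  index := rc.index
  left := rc.right
  right := rc.left
  eq := by
    have h : ∑ i ∈ rc.index, (rc.left i : D) ⊗ₜ[k] (rc.right i : D) =
      TensorProduct.comm k D D (CoalgebraStruct.comul (A := D) c) := rc.eq
    apply (TensorProduct.comm k D D).injective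
    refine Eq.trans ?_ h
    exact map_sum (TensorProduct.comm k D D) _ _

end Coop

/-- A form on `C₁` as a form on the co-opposite coalgebra of `C₁`. -/
def coopLeft (x : C₁ →ₗ[k] C₂ →ₗ[k] k) : Coop C₁ →ₗ[k] C₂ →ₗ[k] k := x

/-- A form on `C₂` as a form on the co-opposite coalgebra of `C₂`. -/
def coopRight (x : C₁ →ₗ[k] C₂ →ₗ[k] k) : C₁ →ₗ[k] Coop C₂ →ₗ[k] k := x

/-- Both sides express `x(c₁, d₂) y(c₂, d₁) = ε(c) ε(d)`: reversing the second coproduct is the same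
as reversing the first one and exchanging the two forms. -/
theorem ConvInverse.coopLeft {x y : C₁ →ₗ[k] C₂ →ₗ[k] k}
    (h : ConvInverse (coopRight x) (coopRight y)) : ConvInverse (coopLeft y) (coopLeft x) := by
  intro c d rc rd
  refine Eq.trans (Finset.sum_congr rfl fun i _ => Finset.sum_congr rfl fun j _ => ?_)
    (h c d (Repr.uncoop (D := C₁) rc) rd.coop)
  exact mul_comm _ _

/-- `P` intertwines `QR` with `RQ`, hence also their inverses: `P R⁻¹ Q⁻¹ = Q⁻¹ R⁻¹ P`. Compared
with the original equation, the factors of the third coalgebra now occur in the opposite order. -/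
theorem YangBaxter.coopRight {p : C₁ →ₗ[k] C₂ →ₗ[k] k} {q q' : C₁ →ₗ[k] C₃ →ₗ[k] k}
    {r r' : C₂ →ₗ[k] C₃ →ₗ[k] k} (h : YangBaxter p q r)
    (hq : ConvInverse q q') (hq' : ConvInverse q' q)
    (hr : ConvInverse r r') (hr' : ConvInverse r' r) :
    YangBaxter p (coopRight q') (coopRight r') := by
  rw [yangBaxter_iff] at h
  have key : emb₁₂ C₃ p * (emb₂₃ C₁ r' * emb₁₃ C₂ q') =
      emb₁₃ C₂ q' * (emb₂₃ C₁ r' * emb₁₂ C₃ p) := by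
    obtain ⟨Q, hQ⟩ : ∃ u : (ConvAlg k C₁ C₂ C₃)ˣ, u = ⟨_, _, hq.emb₁₃, hq'.emb₁₃⟩ := ⟨_, rfl⟩
    obtain ⟨R, hR⟩ : ∃ u : (ConvAlg k C₁ C₂ C₃)ˣ, u = ⟨_, _, hr.emb₂₃, hr'.emb₂₃⟩ := ⟨_, rfl⟩
    have h' : SemiconjBy (emb₁₂ C₃ p) (Q * R : (ConvAlg k C₁ C₂ C₃)ˣ)
        (R * Q : (ConvAlg k C₁ C₂ C₃)ˣ) := by
      subst hQ hR
      exact h.trans (mul_assoc _ _ _).symm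
    have := h'.units_inv_right
    rw [mul_inv_rev, mul_inv_rev] at this
    subst hQ hR
    exact this.trans (mul_assoc _ _ _)
  intro c d e rc rd re
  have h1 := emb₁₂_mul_emb₂₃_mul_emb₁₃ p q' r' rc rd (Repr.uncoop (D := C₃) re)
  have h2 := emb₁₃_mul_emb₂₃_mul_emb₁₂ p q' r' rc rd (Repr.uncoop (D := C₃) re)
  rw [key] at h1
  refine (Finset.sum_congr rfl fun i _ => Finset.sum_congr rfl fun j _ => Finset.sum_congr rfl
    fun l _ => ?_).trans ((h1.symm.trans h2).trans (Finset.sum_congr rfl fun i _ =>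
    Finset.sum_congr rfl fun j _ => Finset.sum_congr rfl fun l _ => ?_))
  · exact mul_right_comm _ _ _
  · exact congrArg (· * _) (mul_comm _ _)

/-- The mirror image: `R` intertwines `QP` with `PQ`, so that the inverses of `P` and `Q` satisfy
the equation with the first coalgebra reversed. -/
theorem YangBaxter.coopLeft {p p' : C₁ →ₗ[k] C₂ →ₗ[k] k} {q q' : C₁ →ₗ[k] C₃ →ₗ[k] k}
    {r : C₂ →ₗ[k] C₃ →ₗ[k] k} (h : YangBaxter p q r)
    (hp : ConvInverse p p') (hp' : ConvInverse p' p)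
    (hq : ConvInverse q q') (hq' : ConvInverse q' q) :
    YangBaxter (coopLeft p') (coopLeft q') r := by
  rw [yangBaxter_iff] at h
  have key : emb₁₃ C₂ q' * (emb₁₂ C₃ p' * emb₂₃ C₁ r) =
      emb₂₃ C₁ r * (emb₁₂ C₃ p' * emb₁₃ C₂ q') := by
    obtain ⟨P, hP⟩ : ∃ u : (ConvAlg k C₁ C₂ C₃)ˣ, u = ⟨_, _, hp.emb₁₂, hp'.emb₁₂⟩ := ⟨_, rfl⟩
    obtain ⟨Q, hQ⟩ : ∃ u : (ConvAlg k C₁ C₂ C₃)ˣ, u = ⟨_, _, hq.emb₁₃, hq'.emb₁₃⟩ := ⟨_, rfl⟩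
    have h' : SemiconjBy (emb₂₃ C₁ r) (Q * P : (ConvAlg k C₁ C₂ C₃)ˣ)
        (P * Q : (ConvAlg k C₁ C₂ C₃)ˣ) := by
      subst hP hQ
      exact (h.symm.trans (mul_assoc _ _ _).symm)
    have := h'.units_inv_right
    rw [mul_inv_rev, mul_inv_rev] at this
    subst hP hQ
    exact ((mul_assoc _ _ _).symm.trans this.symm)
  intro c d e rc rd re
  have h1 := emb₁₃_mul_emb₁₂_mul_emb₂₃ p' q' r (Repr.uncoop (D := C₁) rc) rd re
  have h2 := emb₂₃_mul_emb₁₂_mul_emb₁₃ p' q' r (Repr.uncoop (D := C₁) rc) rd re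
  rw [key] at h1
  refine (Finset.sum_congr rfl fun i _ => Finset.sum_congr rfl fun j _ => Finset.sum_congr rfl
    fun l _ => ?_).trans ((h1.symm.trans h2).trans (Finset.sum_congr rfl fun i _ =>
    Finset.sum_congr rfl fun j _ => Finset.sum_congr rfl fun l _ => ?_))
  · exact congrArg (· * _) (mul_comm _ _)
  · exact mul_right_comm _ _ _

end YangBaxter


/-! ### Twisted forms of an oriented quantum coalgebra. -/

namespace OrientedQuantumCoalgebra

open Coalgebra (counit Repr)

variable {k : Type*} [Field k] {C : Type*} [AddCommGroup C] [Module k C] [Coalgebra k C]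
  (Q : OrientedQuantumCoalgebra k C)

/-- The form `b` (for `true`) or `b⁻¹` (for `false`). -/
def form (s : Bool) : C →ₗ[k] C →ₗ[k] k := if s then Q.b else Q.binv

theorem form_mem (s : Bool) : Q.form s ∈ ({Q.b, Q.binv} : Set (C →ₗ[k] C →ₗ[k] k)) := by
  cases s <;> simp [form]

theorem convInverse_form (s : Bool) : ConvInverse (Q.form s) (Q.form (!s)) := by
  cases s
  · exact Q.isInverse.left_inv
  · exact Q.isInverse.right_inv

/-- With `k` as third coalgebra, evaluation at `1` recovers a bilinear form from its embedding, so
this is the agreement of left and right inverses in a monoid. -/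
theorem _root_.ConvInverse.unique {x y z : C →ₗ[k] C →ₗ[k] k} (h : ConvInverse y x)
    (h' : ConvInverse x z) : y = z := by
  have := left_inv_eq_right_inv (h.emb₁₂ (C₃ := k)) (h'.emb₁₂ (C₃ := k))
  ext c d
  have := congrArg (fun X : ConvAlg k C C k => X (c ⊗ₜ (d ⊗ₜ 1))) this
  simpa using this

/-- Compatibility with the coproduct makes `b⁻¹ ∘ (T × T)` a convolution inverse of `b`, and
inverses are unique. -/
theorem binv_apply_of_aut {T : C ≃ₗ[k] C} (hT : IsCoalgebraAutWrt {Q.b, Q.binv} T)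
    (hb : ∀ c d, Q.b (T c) (T d) = Q.b c d) (c d : C) : Q.binv (T c) (T d) = Q.binv c d := by
  have : ConvInverse (Q.binv.compl₁₂ (T : C →ₗ[k] C) (T : C →ₗ[k] C)) Q.b := by
    intro c d rc rd
    have h1 : ∀ j, _ := fun j => hT.apply_left _ (Q.form_mem false) _ (Q.form_mem true) c
      (T (rd.left j)) (T (rd.right j)) rc (Repr.arbitrary k _)
    have h2 : ∀ i, _ := fun i => hT.apply_right _ (Q.form_mem false) _ (Q.form_mem true) d
      ((Repr.arbitrary k (T c)).left i) ((Repr.arbitrary k (T c)).right i) rd (Repr.arbitrary k _)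
    have h3 := Q.isInverse.left_inv (T c) (T d) (Repr.arbitrary k _) (Repr.arbitrary k _)
    rw [hT.counit_apply, hT.counit_apply] at h3
    refine Eq.trans ?_ ((Finset.sum_congr rfl fun i _ => h2 i).trans h3)
    rw [Finset.sum_comm, Finset.sum_comm (s := (Repr.arbitrary k (T c)).index)]
    refine Finset.sum_congr rfl fun j _ => ?_
    refine Eq.trans (Finset.sum_congr rfl fun i _ => ?_) (h1 j)
    simp [form, hb]
  have := this.unique Q.isInverse.right_inv
  exact congrArg (fun f => f c d) this

/-- The automorphisms that preserve `b` and `b⁻¹` and are compatible with the coproduct. -/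
def autSubgroup : Subgroup (C ≃ₗ[k] C) where
  carrier := {T | IsCoalgebraAutWrt {Q.b, Q.binv} T ∧
    ∀ β ∈ ({Q.b, Q.binv} : Set (C →ₗ[k] C →ₗ[k] k)), ∀ c d, β (T c) (T d) = β c d}
  one_mem' := by
    refine ⟨⟨fun _ => rfl, fun β _ β' _ c d e rc rTc => ?_, fun β _ β' _ c d e rc rTc => ?_⟩,
      fun _ _ _ _ => rfl⟩
    · have h : ∀ r : Repr k c (C × C), ∑ i ∈ r.index, β (r.left i) d * β' (r.right i) e =
          TensorProduct.lift (LinearMap.mul k k) (TensorProduct.map (β.flip d) (β'.flip e)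
            (Coalgebra.comul c)) := fun r => by simp [← r.eq]
      exact (h rc).trans (h rTc).symm
    · have h : ∀ r : Repr k c (C × C), ∑ i ∈ r.index, β d (r.left i) * β' e (r.right i) =
          TensorProduct.lift (LinearMap.mul k k) (TensorProduct.map (β d) (β' e)
            (Coalgebra.comul c)) := fun r => by simp [← r.eq]
      exact (h rc).trans (h rTc).symm
  mul_mem' := by
    rintro S T ⟨hS, hS'⟩ ⟨hT, hT'⟩
    -- Compatibility with the coproduct is known only when tested against the forms, so it does not
    -- compose by itself. Invariance moves `S` to the other argument, where the identity for `T`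
    -- applies with `S⁻¹ d` and `S⁻¹ e`.
    have hl : ∀ β ∈ ({Q.b, Q.binv} : Set (C →ₗ[k] C →ₗ[k] k)), ∀ c d,
        β (S c) d = β c (S.symm d) := fun β hβ c d => by simpa using hS' β hβ c (S.symm d)
    have hr : ∀ β ∈ ({Q.b, Q.binv} : Set (C →ₗ[k] C →ₗ[k] k)), ∀ c d,
        β c (S d) = β (S.symm c) d := fun β hβ c d => by simpa using hS' β hβ (S.symm c) d
    refine ⟨⟨fun c => (hS.counit_apply _).trans (hT.counit_apply c),
      fun β hβ β' hβ' c d e rc rTc => ?_, fun β hβ β' hβ' c d e rc rTc => ?_⟩,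
      fun β hβ c d => (hS' β hβ _ _).trans (hT' β hβ c d)⟩
    · have h1 := hT.apply_left β hβ β' hβ' c (S.symm d) (S.symm e) rc (Repr.arbitrary k _)
      have h2 := hS.apply_left β hβ β' hβ' (T c) d e (Repr.arbitrary k _) rTc
      simp only [← hl β hβ, ← hl β' hβ'] at h1
      exact h1.trans h2
    · have h1 := hT.apply_right β hβ β' hβ' c (S.symm d) (S.symm e) rc (Repr.arbitrary k _)
      have h2 := hS.apply_right β hβ β' hβ' (T c) d e (Repr.arbitrary k _) rTc
      simp only [← hr β hβ, ← hr β' hβ'] at h1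
      exact h1.trans h2
  inv_mem' := by
    rintro T ⟨hT, hT'⟩
    have hl : ∀ β ∈ ({Q.b, Q.binv} : Set (C →ₗ[k] C →ₗ[k] k)), ∀ c d,
        β (T.symm c) d = β c (T d) := fun β hβ c d => by simpa using (hT' β hβ (T.symm c) d).symm
    have hr : ∀ β ∈ ({Q.b, Q.binv} : Set (C →ₗ[k] C →ₗ[k] k)), ∀ c d,
        β c (T.symm d) = β (T c) d := fun β hβ c d => by simpa using (hT' β hβ c (T.symm d)).symm
    refine ⟨⟨fun c => ?_, fun β hβ β' hβ' c d e rc rTc => ?_, fun β hβ β' hβ' c d e rc rTc => ?_⟩,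
      fun β hβ c d => ?_⟩
    · simpa using (hT.counit_apply (T.symm c)).symm
    · have h1 := hT.apply_left β hβ β' hβ' (T.symm c) (T d) (T e) rTc
        ⟨rc.index, rc.left, rc.right, by simpa using rc.eq⟩
      simp only [hT' β hβ, hT' β' hβ'] at h1
      refine Eq.trans (Finset.sum_congr rfl fun i _ => ?_) h1.symm
      exact congrArg₂ (· * ·) (hl β hβ _ _) (hl β' hβ' _ _)
    · have h1 := hT.apply_right β hβ β' hβ' (T.symm c) (T d) (T e) rTc
        ⟨rc.index, rc.left, rc.right, by simpa using rc.eq⟩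
      simp only [hT' β hβ, hT' β' hβ'] at h1
      refine Eq.trans (Finset.sum_congr rfl fun i _ => ?_) h1.symm
      exact congrArg₂ (· * ·) (hr β hβ _ _) (hr β' hβ' _ _)
    · change β (T.symm c) (T.symm d) = _
      simpa using (hT' β hβ (T.symm c) (T.symm d)).symm

theorem Td_mem : Q.Td ∈ Q.autSubgroup := by
  refine ⟨Q.autTd, ?_⟩
  rintro β (rfl | rfl)
  · exact Q.qc2_Td
  · exact Q.binv_apply_of_aut Q.autTd Q.qc2_Td

theorem Tu_mem : Q.Tu ∈ Q.autSubgroup := by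
  refine ⟨Q.autTu, ?_⟩
  rintro β (rfl | rfl)
  · exact Q.qc2_Tu
  · exact Q.binv_apply_of_aut Q.autTu Q.qc2_Tu

/-- `T_d ^ v.1 ∘ T_u ^ v.2` -/
noncomputable def tw (v : ℤ × ℤ) : C ≃ₗ[k] C := Q.Td ^ v.1 * Q.Tu ^ v.2

theorem tw_mem (v : ℤ × ℤ) : Q.tw v ∈ Q.autSubgroup :=
  mul_mem (zpow_mem Q.Td_mem _) (zpow_mem Q.Tu_mem _)

theorem tw_add (u v : ℤ × ℤ) : Q.tw (u + v) = Q.tw u * Q.tw v := by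
  have h : Commute Q.Td Q.Tu := LinearEquiv.ext Q.commute
  rw [tw, tw, tw, Prod.fst_add, Prod.snd_add, zpow_add, zpow_add, mul_assoc, mul_assoc,
    ← mul_assoc (Q.Td ^ v.1), (h.zpow_zpow v.1 u.2).eq, mul_assoc]

theorem tw_add_apply (u v : ℤ × ℤ) (c : C) : Q.tw (u + v) c = Q.tw u (Q.tw v c) := by
  rw [tw_add]; rfl

@[simp]
theorem tw_zero (c : C) : Q.tw 0 c = c := by simp [tw]

theorem form_tw (s : Bool) (v : ℤ × ℤ) (c d : C) :
    Q.form s (Q.tw v c) (Q.tw v d) = Q.form s c d :=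
  (Q.tw_mem v).2 _ (Q.form_mem s) c d

theorem counit_tw (v : ℤ × ℤ) (c : C) : counit (R := k) (Q.tw v c) = counit (R := k) c :=
  (Q.tw_mem v).1.counit_apply c

/-- The form `b` or `b⁻¹` with its first argument twisted. -/
noncomputable def twForm (s : Bool) (v : ℤ × ℤ) : C →ₗ[k] C →ₗ[k] k :=
  Q.form s ∘ₗ (Q.tw v : C →ₗ[k] C)

theorem twForm_apply (s : Bool) (v : ℤ × ℤ) (c d : C) :
    Q.twForm s v c d = Q.form s (Q.tw v c) d := rfl

/-- Invariance cancels the twist `v` of the second argument. This is why a crossing sees only the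
difference of the exponents of its lines. -/
theorem form_tw_tw (s : Bool) (u v : ℤ × ℤ) (c d : C) :
    Q.form s (Q.tw u c) (Q.tw v d) = Q.twForm s (u - v) c d := by
  rw [twForm_apply, ← Q.form_tw s v (Q.tw (u - v) c), ← tw_add_apply, add_sub_cancel]

theorem twForm_tw (s : Bool) (u v : ℤ × ℤ) (c d : C) :
    Q.twForm s u (Q.tw v c) d = Q.twForm s (u + v) c d := by
  rw [twForm_apply, twForm_apply, tw_add_apply]

/-- A twist common to both Sweedler factors can be moved into the element before the coproduct is
taken. -/
theorem sum_twForm_left (s s' : Bool) (u u' v : ℤ × ℤ) (c d e : C) (rc : Repr k c (C × C))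
    (rTc : Repr k (Q.tw v c) (C × C)) :
    ∑ i ∈ rc.index, Q.twForm s (u + v) (rc.left i) d * Q.twForm s' (u' + v) (rc.right i) e =
      ∑ i ∈ rTc.index, Q.twForm s u (rTc.left i) d * Q.twForm s' u' (rTc.right i) e := by
  have := (Q.tw_mem v).1.apply_left _ (Q.form_mem s) _ (Q.form_mem s') c (Q.tw (-u) d)
    (Q.tw (-u') e) rc rTc
  have h : ∀ s u c d, Q.form s c (Q.tw (-u) d) = Q.twForm s u c d := fun s u c d => by
    simpa using Q.form_tw_tw s 0 (-u) c d
  simpa only [h, twForm_tw] using this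

theorem sum_twForm_right (s s' : Bool) (u u' v : ℤ × ℤ) (c d e : C) (rc : Repr k c (C × C))
    (rTc : Repr k (Q.tw v c) (C × C)) :
    ∑ i ∈ rc.index, Q.twForm s (u - v) d (rc.left i) * Q.twForm s' (u' - v) e (rc.right i) =
      ∑ i ∈ rTc.index, Q.twForm s u d (rTc.left i) * Q.twForm s' u' e (rTc.right i) := by
  have := (Q.tw_mem v).1.apply_right _ (Q.form_mem s) _ (Q.form_mem s') c (Q.tw u d)
    (Q.tw u' e) rc rTc
  simp only [form_tw_tw] at this
  exact this

@[simp]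
theorem twForm_zero (s : Bool) : Q.twForm s 0 = Q.form s := by
  ext c d
  simp [twForm_apply]

theorem convInverse_twForm (s : Bool) (v : ℤ × ℤ) :
    ConvInverse (Q.twForm s v) (Q.twForm (!s) v) := by
  intro c d rc rd
  have h1 : ∀ j, _ := fun j => Q.sum_twForm_left s (!s) 0 0 v c (rd.left j) (rd.right j) rc
    (Repr.arbitrary k _)
  have h2 := Q.convInverse_form s (Q.tw v c) d (Repr.arbitrary k _) rd
  rw [counit_tw] at h2
  rw [← h2, Finset.sum_comm, Finset.sum_comm (s := (Repr.arbitrary k (Q.tw v c)).index)]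
  refine Finset.sum_congr rfl fun j _ => ?_
  simpa using h1 j

theorem convInverse_twForm' (s : Bool) (v : ℤ × ℤ) :
    ConvInverse (Q.twForm (!s) v) (Q.twForm s v) := by
  simpa using Q.convInverse_twForm (!s) v

theorem form_Tu_right (s : Bool) (c d : C) : Q.form s c (Q.Tu d) = Q.twForm s (0, -1) c d := by
  simpa [tw] using Q.form_tw_tw s 0 (0, 1) c d

theorem form_Td_left (s : Bool) (c d : C) : Q.form s (Q.Td c) d = Q.twForm s (1, 0) c d := by
  simp [twForm_apply, tw]

/-- This is axiom 1 at `tw (v + (0, 1)) c`. The factor `T_u` in the second argument counts as `(0,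
-1)` and `T_d` in the first as `(1, 0)`; they differ by `(1, 1)`, which is `1` in `ℤ × ℤ`. -/
theorem convInverse_coopRight_true_false (v : ℤ × ℤ) :
    ConvInverse (coopRight (Q.twForm true v)) (coopRight (Q.twForm false (v + 1))) := by
  intro c d rc rd
  have h1 : ∀ j, _ := fun j => Q.sum_twForm_left true false (0, -1) (1, 0) (v + (0, 1)) c
    (rd.left j) (rd.right j) rc (Repr.arbitrary k _)
  have h2 := Q.qc1_left (Q.tw (v + (0, 1)) c) d (Repr.arbitrary k _) (Repr.uncoop (D := C) rd)
  rw [counit_tw] at h2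
  refine Eq.trans ?_ h2
  rw [Finset.sum_comm, Finset.sum_comm (s := (Repr.arbitrary k (Q.tw _ c)).index)]
  refine Finset.sum_congr rfl fun j _ => ?_
  have e1 : ((0, -1) : ℤ × ℤ) + (v + (0, 1)) = v := by ext <;> simp
  have e2 : ((1, 0) : ℤ × ℤ) + (v + (0, 1)) = v + 1 := by ext <;> simp [add_comm]
  rw [e1, e2] at h1
  refine (h1 j).trans (Finset.sum_congr rfl fun i _ => ?_)
  exact congrArg₂ (· * ·) (Q.form_Tu_right true _ _).symm (Q.form_Td_left false _ _).symm

theorem convInverse_coopRight_false_true (v : ℤ × ℤ) :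
    ConvInverse (coopRight (Q.twForm false (v + 1))) (coopRight (Q.twForm true v)) := by
  intro c d rc rd
  have h1 : ∀ j, _ := fun j => Q.sum_twForm_left false true (1, 0) (0, -1) (v + (0, 1)) c
    (rd.left j) (rd.right j) rc (Repr.arbitrary k _)
  have h2 := Q.qc1_right (Q.tw (v + (0, 1)) c) d (Repr.arbitrary k _) (Repr.uncoop (D := C) rd)
  rw [counit_tw] at h2
  refine Eq.trans ?_ h2
  rw [Finset.sum_comm, Finset.sum_comm (s := (Repr.arbitrary k (Q.tw _ c)).index)]
  refine Finset.sum_congr rfl fun j _ => ?_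
  have e1 : ((0, -1) : ℤ × ℤ) + (v + (0, 1)) = v := by ext <;> simp
  have e2 : ((1, 0) : ℤ × ℤ) + (v + (0, 1)) = v + 1 := by ext <;> simp [add_comm]
  rw [e1, e2] at h1
  refine (h1 j).trans (Finset.sum_congr rfl fun i _ => ?_)
  exact congrArg₂ (· * ·) (Q.form_Td_left false _ _).symm (Q.form_Tu_right true _ _).symm

theorem yangBaxter_form : YangBaxter (Q.form true) (Q.form true) (Q.form true) := by
  intro c d e rc rd re
  refine (Q.qc3 c d e rc rd re).trans ?_
  refine Finset.sum_congr rfl fun i _ => Finset.sum_congr rfl fun j _ =>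
    Finset.sum_congr rfl fun l _ => ?_
  change Q.b _ _ * Q.b _ _ * Q.b _ _ = Q.b _ _ * Q.b _ _ * Q.b _ _
  ring

/-- The three vectors are the differences of exponents of three strands, so the middle one is the
sum of the others. Axiom 3 at `T^u c`, `d`, `T^(-v) e` then gives the claim. -/
theorem yangBaxter_twForm_true (u v : ℤ × ℤ) :
    YangBaxter (Q.twForm true u) (Q.twForm true (u + v)) (Q.twForm true v) := by
  intro c d e rc rd re
  obtain ⟨rc', -⟩ : ∃ r : Repr k (Q.tw u c) (C × C), True := ⟨Repr.arbitrary k _, trivial⟩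
  obtain ⟨re', -⟩ : ∃ r : Repr k (Q.tw (-v) e) (C × C), True := ⟨Repr.arbitrary k _, trivial⟩
  have hc : ∀ d e, ∑ i ∈ rc.index, Q.twForm true u (rc.left i) d *
      Q.twForm true (u + v) (rc.right i) e =
      ∑ i ∈ rc'.index, Q.form true (rc'.left i) d * Q.twForm true v (rc'.right i) e :=
    fun d e => by simpa [add_comm] using Q.sum_twForm_left true true 0 v u c d e rc rc'
  have hc' : ∀ d e, ∑ i ∈ rc.index, Q.twForm true (u + v) (rc.left i) e *
      Q.twForm true u (rc.right i) d =
      ∑ i ∈ rc'.index, Q.twForm true v (rc'.left i) e * Q.form true (rc'.right i) d :=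
    fun d e => by simpa [add_comm] using Q.sum_twForm_left true true v 0 u c e d rc rc'
  have he : ∀ c d, ∑ l ∈ re.index, Q.twForm true v c (re.left l) *
      Q.twForm true v d (re.right l) =
      ∑ l ∈ re'.index, Q.form true c (re'.left l) * Q.form true d (re'.right l) :=
    fun c d => by simpa using Q.sum_twForm_right true true 0 0 (-v) e c d re re'
  have h := Q.yangBaxter_form (Q.tw u c) d (Q.tw (-v) e) rc' rd re'
  calc
    _ = ∑ i ∈ rc'.index, ∑ j ∈ rd.index, ∑ l ∈ re.index,
        Q.form true (rc'.left i) (rd.left j) * Q.twForm true v (rc'.right i) (re.left l) *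
          Q.twForm true v (rd.right j) (re.right l) := by
      rw [Finset.sum_comm, Finset.sum_comm (s := rc'.index)]
      refine Finset.sum_congr rfl fun j _ => ?_
      rw [Finset.sum_comm, Finset.sum_comm (s := rc'.index)]
      refine Finset.sum_congr rfl fun l _ => ?_
      rw [← Finset.sum_mul, ← Finset.sum_mul, hc]
    _ = _ := by
      refine Finset.sum_congr rfl fun i _ => Finset.sum_congr rfl fun j _ => ?_
      simp_rw [mul_assoc, ← Finset.mul_sum]
      rw [he]
    _ = _ := h
    _ = ∑ i ∈ rc'.index, ∑ j ∈ rd.index, ∑ l ∈ re.index,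
        Q.twForm true v (rd.left j) (re.left l) * Q.twForm true v (rc'.left i) (re.right l) *
          Q.form true (rc'.right i) (rd.right j) := by
      refine Finset.sum_congr rfl fun i _ => Finset.sum_congr rfl fun j _ => ?_
      rw [← Finset.sum_mul, ← Finset.sum_mul, he]
    _ = _ := by
      rw [Finset.sum_comm, Finset.sum_comm (s := rc.index)]
      refine Finset.sum_congr rfl fun j _ => ?_
      rw [Finset.sum_comm, Finset.sum_comm (s := rc.index)]
      refine Finset.sum_congr rfl fun l _ => ?_
      simp_rw [mul_assoc, ← Finset.mul_sum]
      rw [hc']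

theorem yangBaxter_twForm (s : Bool) (u v : ℤ × ℤ) :
    YangBaxter (Q.twForm s u) (Q.twForm s (u + v)) (Q.twForm s v) := by
  cases s
  · exact (Q.yangBaxter_twForm_true u v).inverse (Q.convInverse_twForm true u)
      (Q.convInverse_twForm false u) (Q.convInverse_twForm true (u + v))
      (Q.convInverse_twForm false (u + v)) (Q.convInverse_twForm true v)
      (Q.convInverse_twForm false v)
  · exact Q.yangBaxter_twForm_true u v

theorem yangBaxter_coopLeft (s : Bool) (u v : ℤ × ℤ) :
    YangBaxter (coopLeft (Q.twForm (!s) u)) (coopLeft (Q.twForm (!s) (u + v))) (Q.twForm s v) :=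
  (Q.yangBaxter_twForm s u v).coopLeft (Q.convInverse_twForm s u) (Q.convInverse_twForm' s u)
    (Q.convInverse_twForm s (u + v)) (Q.convInverse_twForm' s (u + v))

theorem yangBaxter_coopRight (s : Bool) (u v : ℤ × ℤ) :
    YangBaxter (Q.twForm s u) (coopRight (Q.twForm (!s) (u + v)))
      (coopRight (Q.twForm (!s) v)) :=
  (Q.yangBaxter_twForm s u v).coopRight (Q.convInverse_twForm s (u + v))
    (Q.convInverse_twForm' s (u + v)) (Q.convInverse_twForm s v) (Q.convInverse_twForm' s v)

/-- After the first coalgebra is reversed, the form between the first and the third strand has the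
inverse given by axiom 1 rather than the ordinary one. This produces the shift by `1`. -/
theorem yangBaxter_coopLeft_coopRight_true (u v : ℤ × ℤ) :
    YangBaxter (coopLeft (Q.twForm true u)) (coopRight (coopLeft (Q.twForm false (u + v + 1))))
      (coopRight (Q.twForm true v)) :=
  (Q.yangBaxter_coopLeft false u v).coopRight
    (Q.convInverse_coopRight_false_true _).coopLeft (Q.convInverse_coopRight_true_false _).coopLeft
    (Q.convInverse_twForm false v) (Q.convInverse_twForm true v)

theorem yangBaxter_coopLeft_coopRight_false (u v : ℤ × ℤ) :
    YangBaxter (coopLeft (Q.twForm false u)) (coopRight (coopLeft (Q.twForm true (u + v - 1))))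
      (coopRight (Q.twForm false v)) := by
  have h1 := (Q.convInverse_coopRight_true_false (u + v - 1)).coopLeft
  have h2 := (Q.convInverse_coopRight_false_true (u + v - 1)).coopLeft
  rw [sub_add_cancel] at h1 h2
  exact (Q.yangBaxter_coopLeft true u v).coopRight h1 h2
    (Q.convInverse_twForm true v) (Q.convInverse_twForm false v)

/-- The form contributed by a crossing: `U` says whether the line from the lower left to the upper
right is the over line, `o` and `u` whether the over line and the under line are directed upwards,
and `v` is the difference of their twists. -/
noncomputable def crossForm (U o u : Bool) (v : ℤ × ℤ) : C →ₗ[k] C →ₗ[k] k :=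
  Q.twForm (U == (o == u))
    -- An extra twist of the over line counts positively and one of the under line negatively.
    (v + match U, o, u with
      | true, true, false => (0, 1)
      | true, false, true => (1, 0)
      | false, false, true => (0, -1)
      | false, true, false => (-1, 0)
      | _, _, _ => 0)

end OrientedQuantumCoalgebra

/-! ### The identities behind (M.2), (M.3) and (M.4), for all orientations. -/

namespace Coalgebra.Repr

variable {k : Type*} [Field k] {C : Type*} [AddCommGroup C] [Module k C] [Coalgebra k C]

/-- The first factor `c₁` for a strand traversed upwards, and `c₂` for a strand traversed
downwards. -/
def lower {c : C} (r : Coalgebra.Repr k c (C × C)) (up : Bool) (i : C × C) : C :=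
  if up then r.left i else r.right i

/-- The second factor `c₂` for a strand traversed upwards, and `c₁` for a strand traversed
downwards. -/
def upper {c : C} (r : Coalgebra.Repr k c (C × C)) (up : Bool) (i : C × C) : C :=
  if up then r.right i else r.left i

end Coalgebra.Repr

namespace OrientedQuantumCoalgebra

open Coalgebra (counit Repr)

variable {k : Type*} [Field k] {C : Type*} [AddCommGroup C] [Module k C] [Coalgebra k C]
  (Q : OrientedQuantumCoalgebra k C)

/-- Two strands that cross twice, with the factors sorted by height, as in (M.2). Parallel strands
need the inverse of a twisted form, antiparallel strands the inverse from axiom 1. -/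
theorem sum_crossForm_mul_crossForm (U o u : Bool) (v : ℤ × ℤ) (c d : C)
    (rc : Repr k c (C × C)) (rd : Repr k d (C × C)) :
    ∑ i ∈ rc.index, ∑ j ∈ rd.index,
      Q.crossForm U o u v (rc.lower o i) (rd.lower u j) *
        Q.crossForm (!U) o u v (rc.upper o i) (rd.upper u j) =
      counit (R := k) c * counit (R := k) d := by
  -- The extra exponents of the two mixed crossings differ by exactly the shift `(1, 1)` of axiom 1.
  have e1 : v + (-1, 0) + 1 = v + (0, 1) := by ext <;> simp
  have e2 : v + (0, -1) + 1 = v + (1, 0) := by ext <;> simp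
  have h1 := Q.convInverse_coopRight_true_false (v + (-1, 0)) c d rc rd.coop
  have h2 := Q.convInverse_coopRight_true_false (v + (0, -1)) c d rc rd.coop
  have h3 := Q.convInverse_coopRight_false_true (v + (-1, 0)) c d rc rd.coop
  have h4 := Q.convInverse_coopRight_false_true (v + (0, -1)) c d rc rd.coop
  rw [e1] at h1 h3
  rw [e2] at h2 h4
  have h5 := Q.convInverse_twForm U v c d rc rd
  have h6 := Q.convInverse_twForm' U v c d rc rd
  cases o <;> cases u
  · refine (Finset.sum_congr rfl fun i _ => Finset.sum_congr rfl fun j _ => ?_).trans h6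
    cases U <;> simp [crossForm, Repr.lower, Repr.upper, mul_comm]
  · cases U
    · exact (Finset.sum_congr rfl fun i _ => Finset.sum_congr rfl fun j _ => mul_comm _ _).trans h4
    · exact (Finset.sum_congr rfl fun i _ => Finset.sum_congr rfl fun j _ => mul_comm _ _).trans h2
  · cases U
    · exact h1
    · exact h3
  · refine (Finset.sum_congr rfl fun i _ => Finset.sum_congr rfl fun j _ => ?_).trans h5
    cases U <;> simp [crossForm, Repr.lower, Repr.upper]

/-- The identity behind (M.3) for strands over, between and under. Relative to the middle strand, an
antiparallel upper strand reverses the first coalgebra and an antiparallel lower strand the third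
one. -/
theorem sum_crossForm_yangBaxter (U o m u : Bool) (p q r : ℤ × ℤ) (c d e : C)
    (rc : Repr k c (C × C)) (rd : Repr k d (C × C)) (re : Repr k e (C × C)) :
    ∑ i ∈ rc.index, ∑ j ∈ rd.index, ∑ l ∈ re.index,
      Q.crossForm U o m (p - q) (rc.lower o i) (rd.lower m j) *
        Q.crossForm U o u (p - r) (rc.upper o i) (re.lower u l) *
        Q.crossForm U m u (q - r) (rd.upper m j) (re.upper u l) =
    ∑ i ∈ rc.index, ∑ j ∈ rd.index, ∑ l ∈ re.index,
      Q.crossForm U m u (q - r) (rd.lower m j) (re.lower u l) *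
        Q.crossForm U o u (p - r) (rc.lower o i) (re.upper u l) *
        Q.crossForm U o m (p - q) (rc.upper o i) (rd.upper m j) := by
  have h1 := fun u v => Q.yangBaxter_twForm U u v c d e rc rd re
  have h2 : ∀ u v, ∑ i ∈ rc.index, ∑ j ∈ rd.index, ∑ l ∈ re.index,
        Q.twForm (!U) u (rc.right i) (rd.left j) * Q.twForm (!U) (u + v) (rc.left i) (re.left l) *
          Q.twForm U v (rd.right j) (re.right l) =
      ∑ i ∈ rc.index, ∑ j ∈ rd.index, ∑ l ∈ re.index,
        Q.twForm U v (rd.left j) (re.left l) * Q.twForm (!U) (u + v) (rc.right i) (re.right l) *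
          Q.twForm (!U) u (rc.left i) (rd.right j) :=
    fun u v => Q.yangBaxter_coopLeft U u v c d e rc.coop rd re
  have h3 : ∀ u v, ∑ i ∈ rc.index, ∑ j ∈ rd.index, ∑ l ∈ re.index,
        Q.twForm U u (rc.left i) (rd.left j) * Q.twForm (!U) (u + v) (rc.right i) (re.right l) *
          Q.twForm (!U) v (rd.right j) (re.left l) =
      ∑ i ∈ rc.index, ∑ j ∈ rd.index, ∑ l ∈ re.index,
        Q.twForm (!U) v (rd.left j) (re.right l) * Q.twForm (!U) (u + v) (rc.left i) (re.left l) *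
          Q.twForm U u (rc.right i) (rd.right j) :=
    fun u v => Q.yangBaxter_coopRight U u v c d e rc rd re.coop
  have h4 : ∀ u v, ∑ i ∈ rc.index, ∑ j ∈ rd.index, ∑ l ∈ re.index,
        Q.twForm true u (rc.right i) (rd.left j) * Q.twForm false (u + v + 1) (rc.left i) (re.right l) *
          Q.twForm true v (rd.right j) (re.left l) =
      ∑ i ∈ rc.index, ∑ j ∈ rd.index, ∑ l ∈ re.index,
        Q.twForm true v (rd.left j) (re.right l) * Q.twForm false (u + v + 1) (rc.right i) (re.left l) *
          Q.twForm true u (rc.left i) (rd.right j) :=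
    fun u v => Q.yangBaxter_coopLeft_coopRight_true u v c d e rc.coop rd re.coop
  have h5 : ∀ u v, ∑ i ∈ rc.index, ∑ j ∈ rd.index, ∑ l ∈ re.index,
        Q.twForm false u (rc.right i) (rd.left j) * Q.twForm true (u + v - 1) (rc.left i) (re.right l) *
          Q.twForm false v (rd.right j) (re.left l) =
      ∑ i ∈ rc.index, ∑ j ∈ rd.index, ∑ l ∈ re.index,
        Q.twForm false v (rd.left j) (re.right l) * Q.twForm true (u + v - 1) (rc.right i) (re.left l) *
          Q.twForm false u (rc.left i) (rd.right j) :=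
    fun u v => Q.yangBaxter_coopLeft_coopRight_false u v c d e rc.coop rd re.coop
  have key : ∀ {X Y X' Y' : C × C → C × C → C × C → k},
      ∑ i ∈ rc.index, ∑ j ∈ rd.index, ∑ l ∈ re.index, X i j l =
        ∑ i ∈ rc.index, ∑ j ∈ rd.index, ∑ l ∈ re.index, Y i j l →
      (∀ i j l, X' i j l = X i j l) → (∀ i j l, Y' i j l = Y i j l) →
      ∑ i ∈ rc.index, ∑ j ∈ rd.index, ∑ l ∈ re.index, X' i j l =
        ∑ i ∈ rc.index, ∑ j ∈ rd.index, ∑ l ∈ re.index, Y' i j l := by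
    intro X Y X' Y' h hX hY
    simp only [hX, hY, h]
  -- Reversing all three directions exchanges `lower` and `upper`, hence the two sides. The cases
  -- with the middle strand directed downwards therefore use the symmetric identity.
  cases o <;> cases m <;> cases u
  · cases U
    · have e : p - q + (q - r) = p - r := by
        ring
      have h := h1 (p - q) (q - r)
      rw [e] at h
      refine key h.symm (fun i j l => ?_) (fun i j l => ?_) <;>
        simp [crossForm, Repr.lower, Repr.upper] <;> ring
    · have e : p - q + (q - r) = p - r := by
        ring
      have h := h1 (p - q) (q - r)
      rw [e] at h
      refine key h.symm (fun i j l => ?_) (fun i j l => ?_) <;>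
        simp [crossForm, Repr.lower, Repr.upper] <;> ring
  · cases U
    · have e : p - q + (q - r + (0, -1)) = p - r + (0, -1) := by
        ext <;> simp <;> ring
      have h := h3 (p - q) (q - r + (0, -1))
      rw [e] at h
      refine key h.symm (fun i j l => ?_) (fun i j l => ?_) <;>
        simp [crossForm, Repr.lower, Repr.upper] <;> ring
    · have e : p - q + (q - r + (1, 0)) = p - r + (1, 0) := by
        ext <;> simp <;> ring
      have h := h3 (p - q) (q - r + (1, 0))
      rw [e] at h
      refine key h.symm (fun i j l => ?_) (fun i j l => ?_) <;>
        simp [crossForm, Repr.lower, Repr.upper] <;> ring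
  · cases U
    · have e : p - q + (0, -1) + (q - r + (-1, 0)) + 1 = p - r := by
        ext <;> simp <;> ring
      have h := h4 (p - q + (0, -1)) (q - r + (-1, 0))
      rw [e] at h
      refine key h (fun i j l => ?_) (fun i j l => ?_) <;>
        simp [crossForm, Repr.lower, Repr.upper]
    · have e : p - q + (1, 0) + (q - r + (0, 1)) - 1 = p - r := by
        ext <;> simp <;> ring
      have h := h5 (p - q + (1, 0)) (q - r + (0, 1))
      rw [e] at h
      refine key h (fun i j l => ?_) (fun i j l => ?_) <;>
        simp [crossForm, Repr.lower, Repr.upper]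
  · cases U
    · have e : p - q + (0, -1) + (q - r) = p - r + (0, -1) := by
        ext <;> simp <;> ring
      have h := h2 (p - q + (0, -1)) (q - r)
      rw [e] at h
      refine key h (fun i j l => ?_) (fun i j l => ?_) <;>
        simp [crossForm, Repr.lower, Repr.upper]
    · have e : p - q + (1, 0) + (q - r) = p - r + (1, 0) := by
        ext <;> simp <;> ring
      have h := h2 (p - q + (1, 0)) (q - r)
      rw [e] at h
      refine key h (fun i j l => ?_) (fun i j l => ?_) <;>
        simp [crossForm, Repr.lower, Repr.upper]
  · cases U
    · have e : p - q + (-1, 0) + (q - r) = p - r + (-1, 0) := by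
        ext <;> simp <;> ring
      have h := h2 (p - q + (-1, 0)) (q - r)
      rw [e] at h
      refine key h.symm (fun i j l => ?_) (fun i j l => ?_) <;>
        simp [crossForm, Repr.lower, Repr.upper] <;> ring
    · have e : p - q + (0, 1) + (q - r) = p - r + (0, 1) := by
        ext <;> simp <;> ring
      have h := h2 (p - q + (0, 1)) (q - r)
      rw [e] at h
      refine key h.symm (fun i j l => ?_) (fun i j l => ?_) <;>
        simp [crossForm, Repr.lower, Repr.upper] <;> ring
  · cases U
    · have e : p - q + (-1, 0) + (q - r + (0, -1)) + 1 = p - r := by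
        ext <;> simp <;> ring
      have h := h4 (p - q + (-1, 0)) (q - r + (0, -1))
      rw [e] at h
      refine key h.symm (fun i j l => ?_) (fun i j l => ?_) <;>
        simp [crossForm, Repr.lower, Repr.upper] <;> ring
    · have e : p - q + (0, 1) + (q - r + (1, 0)) - 1 = p - r := by
        ext <;> simp <;> ring
      have h := h5 (p - q + (0, 1)) (q - r + (1, 0))
      rw [e] at h
      refine key h.symm (fun i j l => ?_) (fun i j l => ?_) <;>
        simp [crossForm, Repr.lower, Repr.upper] <;> ring
  · cases U
    · have e : p - q + (q - r + (-1, 0)) = p - r + (-1, 0) := by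
        ext <;> simp <;> ring
      have h := h3 (p - q) (q - r + (-1, 0))
      rw [e] at h
      refine key h (fun i j l => ?_) (fun i j l => ?_) <;>
        simp [crossForm, Repr.lower, Repr.upper]
    · have e : p - q + (q - r + (0, 1)) = p - r + (0, 1) := by
        ext <;> simp <;> ring
      have h := h3 (p - q) (q - r + (0, 1))
      rw [e] at h
      refine key h (fun i j l => ?_) (fun i j l => ?_) <;>
        simp [crossForm, Repr.lower, Repr.upper]
  · cases U
    · have e : p - q + (q - r) = p - r := by
        ring
      have h := h1 (p - q) (q - r)
      rw [e] at h
      refine key h (fun i j l => ?_) (fun i j l => ?_) <;>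
        simp [crossForm, Repr.lower, Repr.upper]
    · have e : p - q + (q - r) = p - r := by
        ring
      have h := h1 (p - q) (q - r)
      rw [e] at h
      refine key h (fun i j l => ?_) (fun i j l => ?_) <;>
        simp [crossForm, Repr.lower, Repr.upper]

/-- Sliding a crossing line across a maximum changes the type of the crossing and the direction of
the line, and moves the weight `(0, -1)` or `(1, 0)` of the maximum to the other side of the
crossing. The extra exponents of mixed crossings absorb exactly this change. Here `a` says that the
maximum is traversed from left to right. -/
theorem crossForm_max_over (a d : Bool) (v : ℤ × ℤ) :
    Q.crossForm true a d (v + if a then (0, -1) else 0) =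
      Q.crossForm false (!a) d (v + if a then 0 else (1, 0)) := by
  cases a <;> cases d <;> simp [crossForm, add_assoc, Prod.mk_zero_zero]

theorem crossForm_max_under (a d : Bool) (v : ℤ × ℤ) :
    Q.crossForm false d a (v - if a then (0, -1) else 0) =
      Q.crossForm true d (!a) (v - if a then 0 else (1, 0)) := by
  cases a <;> cases d <;> simp [crossForm, sub_eq_add_neg, add_assoc, Prod.mk_zero_zero]

/-- The same for a minimum, whose weight is `(0, 1)` from left to right and `(-1, 0)` from right to
left. -/
theorem crossForm_min_over (a d : Bool) (v : ℤ × ℤ) :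
    Q.crossForm false (!a) d (v + if a then (0, 1) else 0) =
      Q.crossForm true a d (v + if a then 0 else (-1, 0)) := by
  cases a <;> cases d <;> simp [crossForm, add_assoc, Prod.mk_zero_zero]

theorem crossForm_min_under (a d : Bool) (v : ℤ × ℤ) :
    Q.crossForm true d (!a) (v - if a then (0, 1) else 0) =
      Q.crossForm false d a (v - if a then 0 else (-1, 0)) := by
  cases a <;> cases d <;> simp [crossForm, sub_eq_add_neg, add_assoc, Prod.mk_zero_zero]

end OrientedQuantumCoalgebra


/-! ### Multilinear forms as functionals of products in a commutative algebra. -/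

section GenericAlgebra

universe u v

/-- Multilinear forms factor through products in a suitable commutative algebra. -/
theorem exists_algebra_of_multilinear {k : Type u} [Field k] {C : Type v} [AddCommGroup C]
    [Module k C] (L : Type) [Fintype L] [DecidableEq L] (F : MultilinearMap k (fun _ : L => C) k) :
    ∃ (R : Type (max u v)) (_ : CommRing R) (_ : Algebra k R) (ι : L → C →ₗ[k] R) (Ψ : R →ₗ[k] k),
      ∀ x : L → C, Ψ (∏ l, ι l (x l)) = F x := by
  -- The square-zero extension `k ⊕ C` is defined for bimodules; the right action is the left one.
  let _ : Module kᵐᵒᵖ C := Module.compHom _ ((RingHom.id k).fromOpposite mul_comm)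
  have _ : IsCentralScalar k C := ⟨fun _ _ => rfl⟩
  -- The algebra is a tensor product of copies of `k ⊕ C` with `C² = 0`, one for each index, and `ι
  -- l` embeds `C` in the copy with index `l`. The product of the `ι l (x l)` is the pure tensor of
  -- the `x l`, and `Ψ` applies `F` to the components in `C`.
  refine ⟨PiTensorProduct k fun _ : L => TrivSqZeroExt k C, inferInstance, inferInstance,
    fun l => (PiTensorProduct.singleAlgHom (R := k) (A := fun _ : L => TrivSqZeroExt k C)
      l).toLinearMap ∘ₗ TrivSqZeroExt.inrHom k C,
    PiTensorProduct.lift (F.compLinearMap fun _ => TrivSqZeroExt.sndHom k C), fun x => ?_⟩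
  have : ∏ l, (PiTensorProduct.singleAlgHom (R := k) (A := fun _ : L => TrivSqZeroExt k C) l)
      (TrivSqZeroExt.inr (x l)) = PiTensorProduct.tprod k fun l => TrivSqZeroExt.inr (x l) := by
    simp only [PiTensorProduct.singleAlgHom_apply]
    rw [← PiTensorProduct.tprod_prod]
    exact congrArg _ (Finset.univ_prod_mulSingle _)
  have h2 := congrArg (PiTensorProduct.lift
    (F.compLinearMap fun _ => TrivSqZeroExt.sndHom k C)) this
  refine h2.trans ?_
  simp

/-- A finite family of bilinear forms factors through products in a suitable commutative
algebra. -/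
theorem exists_algebra_of_forms {k : Type u} [Field k] {C : Type v} [AddCommGroup C]
    [Module k C] (I : Finset ℕ) (β : ℕ → C →ₗ[k] C →ₗ[k] k) :
    ∃ (R : Type (max u v)) (_ : CommRing R) (_ : Algebra k R) (ι : ℕ → Bool → C →ₗ[k] R)
      (Ψ : R →ₗ[k] k), ∀ x : ℕ → Bool → C,
        Ψ (∏ n ∈ I, ι n true (x n true) * ι n false (x n false)) =
          ∏ n ∈ I, β n (x n true) (x n false) := by
  obtain ⟨R, _, _, ι, Ψ, h⟩ := exists_algebra_of_multilinear (I × Bool)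
    (crossingProduct fun n : I => β n)
  refine ⟨R, _, _, fun n o => if hn : n ∈ I then ι (⟨n, hn⟩, o) else 0, Ψ, fun x => ?_⟩
  have := h fun l => x l.1 l.2
  rw [Fintype.prod_prod_type] at this
  simp only [Fintype.prod_bool] at this
  rw [← Finset.prod_coe_sort I, ← Finset.prod_coe_sort I]
  simpa [crossingProduct] using this

end GenericAlgebra

/-! ### Convolution products and the iterated coproduct. -/

section ConvolutionProducts

open WithConv

variable {k : Type*} [Field k] {C : Type*} [AddCommGroup C] [Module k C] [Coalgebra k C]

/-- Convolution products can be compared factor by factor. -/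
theorem prod_map_apply_eq_of_forall {α R R' : Type*} [CommRing R] [Algebra k R] [CommRing R']
    [Algebra k R'] (A : List α) (g : α → WithConv (C →ₗ[k] R)) (g' : α → WithConv (C →ₗ[k] R'))
    (Ψ : R →ₗ[k] k) (Ψ' : R' →ₗ[k] k)
    (h : ∀ B : List (α × C), B.map Prod.fst = A →
      Ψ (B.map fun p => g p.1 p.2).prod = Ψ' (B.map fun p => g' p.1 p.2).prod) (c : C) :
    Ψ ((A.map g).prod c) = Ψ' ((A.map g').prod c) := by
  induction A generalizing Ψ Ψ' c with
  | nil =>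
    have h1 : Ψ 1 = Ψ' 1 := by simpa using h [] rfl
    simp [Algebra.algebraMap_eq_smul_one, h1]
  | cons a A ih =>
    rw [List.map_cons, List.map_cons, List.prod_cons, List.prod_cons,
      (Coalgebra.Repr.arbitrary k c).convMul_apply, (Coalgebra.Repr.arbitrary k c).convMul_apply,
      map_sum, map_sum]
    refine Finset.sum_congr rfl fun i _ => ?_
    -- The value of the first factor is absorbed into the two functionals, for which the induction
    -- hypothesis is general.
    refine ih (Ψ ∘ₗ LinearMap.mulLeft k _) (Ψ' ∘ₗ LinearMap.mulLeft k _) (fun B hB => ?_) _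
    simpa using h ((a, (Coalgebra.Repr.arbitrary k c).left i) :: B) (by simp [hB])

/-- Multiplying the Sweedler factors after `C → R` is by definition convolution; the recursion of
the iterated coproduct follows that of a product over a list. -/
theorem lift_mkPiAlgebra_iteratedComul {R : Type*} [CommRing R] [Algebra k R] {m : ℕ}
    (ι : Fin m → C →ₗ[k] R) (c : C) :
    PiTensorProduct.lift ((MultilinearMap.mkPiAlgebra k (Fin m) R).compLinearMap ι)
      (iteratedComul k C m c) = (List.ofFn fun i => toConv (ι i)).prod c := by
  induction m generalizing c with
  | zero => simp [iteratedComul, Algebra.algebraMap_eq_smul_one]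
  | succ m ih =>
    rw [List.ofFn_succ, List.prod_cons, (Coalgebra.Repr.arbitrary k c).convMul_apply]
    simp only [← ih]
    have key : ∀ a, PiTensorProduct.lift
        ((MultilinearMap.mkPiAlgebra k (Fin (m + 1)) R).compLinearMap ι) ∘ₗ
        PiTensorProduct.lift ((PiTensorProduct.tprod k
          (s := fun _ : Fin (m + 1) => C)).curryLeft a) =
        LinearMap.mulLeft k (ι 0 a) ∘ₗ PiTensorProduct.lift
          ((MultilinearMap.mkPiAlgebra k (Fin m) R).compLinearMap fun i => ι i.succ) := by
      intro a
      ext x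
      simp [Fin.prod_univ_succ]
    rw [iteratedComul, LinearMap.comp_apply, LinearMap.comp_apply,
      ← (Coalgebra.Repr.arbitrary k c).eq]
    simp only [map_sum, LinearMap.lTensor_tmul, TensorProduct.lift.tmul]
    refine Finset.sum_congr rfl fun i _ => ?_
    exact LinearMap.congr_fun (key ((Coalgebra.Repr.arbitrary k c).left i))
      (iteratedComul k C m ((Coalgebra.Repr.arbitrary k c).right i))

end ConvolutionProducts

/-! ### Exponents and crossing lines along a path. -/

namespace Tangle

/-- The contribution of a passage to the exponents `(u_d, u_u)`. -/
def Passage.weight : Passage → ℤ × ℤ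
  | .line _ _ _ => 0
  | .extremum _ .dPlus => (1, 0)
  | .extremum _ .dMinus => (-1, 0)
  | .extremum _ .uPlus => (0, 1)
  | .extremum _ .uMinus => (0, -1)

/-- The exponents `(u_d, u_u)` of a path. -/
def net (path : List Passage) : ℤ × ℤ := (path.map Passage.weight).sum

@[simp]
theorem net_nil : net [] = 0 := rfl

@[simp]
theorem net_cons (s : Passage) (path : List Passage) :
    net (s :: path) = s.weight + net path := by simp [net]

@[simp]
theorem net_append (p q : List Passage) : net (p ++ q) = net p + net q := by simp [net]

/-- The crossing line of a passage as a pair of numbers. -/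
def Passage.key : Passage → Option (ℕ × Bool)
  | .line n o _ => some (n, o)
  | .extremum _ _ => none

/-- The indices of the layers of `w` that are crossings. -/
def crossings (w : List Layer) : Finset ℕ :=
  (Finset.range w.length).filter fun n => ∃ x, w[n]? = some x ∧ x.kind.isCrossing = true

theorem mem_crossings {w : List Layer} {n : ℕ} :
    n ∈ crossings w ↔ ∃ x, w[n]? = some x ∧ x.kind.isCrossing = true := by
  simp only [crossings, Finset.mem_filter, Finset.mem_range, and_iff_right_iff_imp]
  rintro ⟨x, hx, -⟩
  exact (List.getElem?_eq_some_iff.1 hx).1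

theorem prod_crossing {M : Type*} [CommMonoid M] (w : List Layer) (f : ℕ → M) :
    ∏ χ : Crossing w, f χ.1 = ∏ n ∈ crossings w, f n := by
  refine Finset.prod_bij (fun χ _ => χ.1) (fun χ _ => ?_) (fun χ _ χ' _ h => ?_) (fun n hn => ?_)
    (fun _ _ => rfl)
  · exact mem_crossings.2 ⟨w.get χ.1, by simp, χ.2⟩
  · exact Subtype.ext (Fin.ext h)
  · obtain ⟨x, hx, hx'⟩ := mem_crossings.1 hn
    obtain ⟨h, rfl⟩ := List.getElem?_eq_some_iff.1 hx
    exact ⟨⟨⟨n, h⟩, hx'⟩, Finset.mem_univ _, rfl⟩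

/-- Replaces the type `Line w`, which depends on the diagram, by pairs of numbers and booleans, so
that lines of two diagrams can be compared. -/
theorem Passage.line?_eq_some {w : List Layer} {s : Passage} {l : Line w} :
    s.line? w = some l ↔ s.key = some ((l.1.1 : ℕ), l.2) := by
  obtain ⟨⟨⟨n, hn⟩, hx⟩, o⟩ := l
  cases s with
  | extremum => simp [line?, key]
  | line m o' u =>
    simp only [line?, key]
    constructor
    · intro h
      split_ifs at h
      simp_all
    · intro h
      simp only [Option.some.injEq, Prod.mk.injEq] at h
      obtain ⟨rfl, rfl⟩ := h
      simp only [hn, dite_true]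
      exact dif_pos hx

theorem Layer.enterUp_key {n p q : ℕ} {x : Layer} {up : Bool} {met : List Passage}
    (h : x.enterUp n p = (q, up, met)) : ∀ s ∈ met, ∀ l, s.key = some l → l.1 = n ∧
      x.kind.isCrossing = true := by
  obtain ⟨x, i⟩ := x
  cases x <;> simp only [enterUp] at h <;> split_ifs at h <;> simp at h <;>
    obtain ⟨-, -, rfl⟩ := h <;> simp [Passage.key, Kind.isCrossing]

theorem Layer.enterDown_key {n p q : ℕ} {x : Layer} {up : Bool} {met : List Passage}
    (h : x.enterDown n p = (q, up, met)) : ∀ s ∈ met, ∀ l, s.key = some l → l.1 = n ∧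
      x.kind.isCrossing = true := by
  obtain ⟨x, i⟩ := x
  cases x <;> simp only [enterDown] at h <;> split_ifs at h <;> simp at h <;>
    obtain ⟨-, -, rfl⟩ := h <;> simp [Passage.key, Kind.isCrossing]

theorem Traverses.mem_crossings {w : List Layer} {n p : ℕ} {up : Bool} {path : List Passage}
    (h : Traverses w n p up path) : ∀ s ∈ path, ∀ l, s.key = some l → l.1 ∈ crossings w := by
  induction h with
  | exitTop => simp
  | exitBottom => simp
  | stepUp hx he _ ih =>
    intro s hs l hl
    rcases List.mem_append.1 hs with hs | hs
    · obtain ⟨h1, h2⟩ := Layer.enterUp_key he s hs l hl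
      exact Tangle.mem_crossings.2 ⟨_, h1 ▸ hx, h2⟩
    · exact ih s hs l hl
  | stepDown hx he _ ih =>
    intro s hs l hl
    rcases List.mem_append.1 hs with hs | hs
    · obtain ⟨h1, h2⟩ := Layer.enterDown_key he s hs l hl
      exact Tangle.mem_crossings.2 ⟨_, h1 ▸ hx, h2⟩
    · exact ih s hs l hl

namespace Diagram

variable (T : Diagram)

/-- Each line is met once. Hence any splitting of the path at a line determines its direction and
the remaining portion of the traversal. -/
theorem path_split_unique {l : Line T.layers} {P Q : List Passage} {s : Passage}
    (h : T.path = P ++ s :: Q) (hs : s.line? T.layers = some l) :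
    ∀ t ∈ P ++ Q, t.line? T.layers ≠ some l := by
  have := T.lines_nodup
  rw [h, linesOf, List.filterMap_append, List.filterMap_cons, hs] at this
  rw [List.nodup_middle, List.nodup_cons, ← List.filterMap_append] at this
  intro t ht ht'
  exact this.1 (List.mem_filterMap.2 ⟨t, ht, ht'⟩)

theorem pathFrom_eq {l : Line T.layers} {P Q : List Passage} {s : Passage}
    (h : T.path = P ++ s :: Q) (hs : s.line? T.layers = some l) : T.pathFrom l = s :: Q := by
  rw [pathFrom, h, List.dropWhile_append_of_pos, List.dropWhile_cons_of_neg]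
  · simpa using hs
  · intro t ht
    simpa using T.path_split_unique h hs t (List.mem_append_left _ ht)

theorem isUp_eq {l : Line T.layers} {P Q : List Passage} {u : Bool}
    (h : T.path = P ++ .line l.1.1 l.2 u :: Q) : T.isUp l = u := by
  have hl : ∀ u, (Passage.line l.1.1 l.2 u).line? T.layers = some l := fun u =>
    Passage.line?_eq_some.2 rfl
  cases u
  · have : Passage.line l.1.1 l.2 true ∉ T.path := by
      rw [h]
      intro hm
      exact T.path_split_unique h (hl _) _ (by simpa using hm) (hl _)
    simpa [isUp] using this
  · simp [isUp, h]

theorem extremaFrom_eq (t : ExtremumType) (l : Line T.layers) :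
    T.extremaFrom t l = (T.pathFrom l).countP fun s =>
      match s with
      | .line _ _ _ => false
      | .extremum _ t' => decide (t' = t) := rfl

theorem ud_uu_eq (l : Line T.layers) : (T.ud l, T.uu l) = net (T.pathFrom l) := by
  rw [ud, uu]
  simp only [extremaFrom_eq]
  induction T.pathFrom l with
  | nil => rfl
  | cons s path ih =>
    rw [net_cons, ← ih]
    rcases s with _ | ⟨_, _ | _ | _ | _⟩ <;> simp [Passage.weight] <;> ring

end Diagram

end Tangle

/-! ### The invariant as a word in a convolution algebra. -/

namespace OrientedQuantumCoalgebra

open Tangle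

variable {k : Type*} [Field k] {C : Type*} [AddCommGroup C] [Module k C] [Coalgebra k C]
  (Q : OrientedQuantumCoalgebra k C)

/-- Whether the layer number `n` of `w` is a crossing of type `U`. -/
def _root_.Tangle.isU (w : List Layer) (n : ℕ) : Bool :=
  decide (w[n]?.map Layer.kind = some Kind.underCrossing)

/-- The eight cases of the definition collapse to one form that depends on the difference of the
exponents. These may be read off just after the lines, since a line itself has weight `0`. -/
theorem contribution_eq (T : Diagram) (χ : Crossing T.layers) {P Q₁ P' Q₂ : List Passage}
    {o u : Bool} (ho : T.path = P ++ .line χ.1 true o :: Q₁)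
    (hu : T.path = P' ++ .line χ.1 false u :: Q₂) :
    Q.contribution T χ = Q.crossForm (isU T.layers χ.1) o u (net Q₁ - net Q₂) := by
  have h1 : T.isUp (χ, true) = o := T.isUp_eq ho
  have h2 : T.isUp (χ, false) = u := T.isUp_eq hu
  have h3 : (T.ud (χ, true), T.uu (χ, true)) = net Q₁ := by
    rw [T.ud_uu_eq, T.pathFrom_eq ho (Passage.line?_eq_some.2 rfl)]
    simp [Passage.weight]
  have h4 : (T.ud (χ, false), T.uu (χ, false)) = net Q₂ := by
    rw [T.ud_uu_eq, T.pathFrom_eq hu (Passage.line?_eq_some.2 rfl)]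
    simp [Passage.weight]
  have kb : ∀ a b m n, Q.b.compl₁₂ (Q.twist a b) (Q.twist m n) =
      Q.twForm true ((a, b) - (m, n)) := fun a b m n =>
    LinearMap.ext₂ fun c d => Q.form_tw_tw true (a, b) (m, n) c d
  have kb' : ∀ a b m n, Q.binv.compl₁₂ (Q.twist a b) (Q.twist m n) =
      Q.twForm false ((a, b) - (m, n)) := fun a b m n =>
    LinearMap.ext₂ fun c d => Q.form_tw_tw false (a, b) (m, n) c d
  have hU : isU T.layers χ.1 = decide ((T.layers.get χ.1).kind = .underCrossing) := by
    simp [isU]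
  have hχ := χ.2
  rw [← h3, ← h4, hU, contribution]
  simp only [h1, h2, kb, kb']
  generalize (T.layers.get χ.1).kind = κ at *
  generalize T.ud (χ, true) = a, T.uu (χ, true) = b, T.ud (χ, false) = c, T.uu (χ, false) = d
  cases κ <;> simp [Kind.isCrossing] at hχ <;> cases o <;> cases u <;> simp [crossForm] <;>
    congr 1 <;> ext <;> simp <;> ring

/-- The product of the letters `ι n o` along a path in the convolution algebra. -/
noncomputable def _root_.Tangle.Passage.letter {R : Type*} [CommRing R] [Algebra k R]
    (ι : ℕ → Bool → C →ₗ[k] R) : Passage → WithConv (C →ₗ[k] R)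
  | .line n o _ => WithConv.toConv (ι n o)
  | .extremum _ _ => 1

/-- Once the contributions factor through `R`, the labelling disappears: the order of the factors in
the convolution product is the order of the traversal, and extrema contribute the unit. -/
theorem inv_apply (T : Diagram) {R : Type*} [CommRing R] [Algebra k R]
    (ι : ℕ → Bool → C →ₗ[k] R) (Ψ : R →ₗ[k] k) (B : ℕ → C →ₗ[k] C →ₗ[k] k)
    (hB : ∀ χ : Crossing T.layers, Q.contribution T χ = B χ.1)
    (hΨ : ∀ x : ℕ → Bool → C, Ψ (∏ n ∈ crossings T.layers, ι n true (x n true) *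
      ι n false (x n false)) = ∏ n ∈ crossings T.layers, B n (x n true) (x n false)) (c : C) :
    Q.inv T c = Ψ ((T.path.map (Passage.letter ι)).prod c) := by
  have h1 : (T.path.map (Passage.letter ι)).prod =
      (List.ofFn fun i => WithConv.toConv (ι (T.lines.get i).1.1 (T.lines.get i).2)).prod := by
    have : (List.ofFn fun i => WithConv.toConv (ι (T.lines.get i).1.1 (T.lines.get i).2)) =
        T.lines.map fun l => WithConv.toConv (ι l.1.1 l.2) := by
      conv_rhs => rw [← List.ofFn_get T.lines, List.map_ofFn]
      rfl
    rw [this, Diagram.lines, linesOf]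
    have hv := T.traverses.mem_crossings
    generalize T.path = path at *
    induction path with
    | nil => rfl
    | cons s path ih =>
      have ih := ih fun t ht => hv t (List.mem_cons_of_mem _ ht)
      rw [List.map_cons, List.prod_cons, ih, List.filterMap_cons]
      cases s with
      | extremum => simp [Passage.letter, Passage.line?]
      | line n o u =>
        obtain ⟨x, hx, hx'⟩ := mem_crossings.1 (hv _ List.mem_cons_self (n, o) rfl)
        obtain ⟨hn, rfl⟩ := List.getElem?_eq_some_iff.1 hx
        have : (Passage.line n o u).line? T.layers = some (⟨⟨n, hn⟩, hx'⟩, o) :=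
          Passage.line?_eq_some.2 rfl
        rw [this]
        rfl
  rw [h1, ← lift_mkPiAlgebra_iteratedComul]
  rw [inv, LinearMap.comp_apply]
  have h2 : PiTensorProduct.lift ((crossingProduct (Q.contribution T)).domDomCongr T.label) =
      Ψ ∘ₗ PiTensorProduct.lift ((MultilinearMap.mkPiAlgebra k (Fin T.lines.length) R).compLinearMap
        fun i => ι (T.lines.get i).1.1 (T.lines.get i).2) := by
    ext v
    -- The hypothesis on `Ψ` concerns families indexed by layer numbers. The given family is
    -- extended by `0` to indices that are not crossing lines.
    let x : ℕ → Bool → C := fun n o =>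
      if h : ∃ l : Line T.layers, (l.1.1 : ℕ) = n ∧ l.2 = o then v (T.label h.choose) else 0
    have hx : ∀ l : Line T.layers, x l.1.1 l.2 = v (T.label l) := by
      intro l
      have h : ∃ l' : Line T.layers, (l'.1.1 : ℕ) = l.1.1 ∧ l'.2 = l.2 := ⟨l, rfl, rfl⟩
      have h' : h.choose = l :=
        Prod.ext (Subtype.ext (Fin.ext h.choose_spec.1)) h.choose_spec.2
      simp only [x]
      rw [dif_pos h, h']
    have := hΨ x
    rw [← prod_crossing, ← prod_crossing] at this
    have e : ∏ i, ι (T.lines.get i).1.1 (T.lines.get i).2 (v i) =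
        ∏ l : Line T.layers, ι l.1.1 l.2 (v (T.label l)) := by
      rw [← Equiv.prod_comp T.label]
      refine Finset.prod_congr rfl fun l _ => ?_
      have : T.lines.get (T.label l) = l := T.label.symm_apply_apply l
      rw [this]
    simp only [LinearMap.compMultilinearMap_apply, PiTensorProduct.lift.tprod, LinearMap.comp_apply,
      MultilinearMap.domDomCongr_apply, MultilinearMap.compLinearMap_apply,
      MultilinearMap.mkPiAlgebra_apply]
    rw [e, Fintype.prod_prod_type]
    simp only [Fintype.prod_bool, ← hx]
    rw [this]
    simp [crossingProduct, hB]
  rw [h2]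
  rfl

end OrientedQuantumCoalgebra


/-! ### Figures with strands, and the comparison of two diagrams letter by letter. -/

namespace Tangle

/-- A piece of the traversals of two diagrams that differ by a move: a crossing line outside of the
figures, a pair of paths without crossing lines, or the passage of the strand `k` of the figures in
the direction `d`. -/
inductive Letter (K : Type) : Type
  | line (n : ℕ) (o u : Bool)
  | ext (l l' : List Passage)
  | inn (k : K) (d : Bool)

namespace Letter

variable {K : Type}

/-- The passages of a letter in the first diagram (`b = true`) or the second (`b = false`). -/
def expand (b : Bool) (ρ : ℕ → ℕ) (S : K → Bool → List Passage) : Letter K → List Passage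
  | line n o u => [.line (ρ n) o u]
  | ext l l' => if b then l else l'
  | inn k d => S k d

def inner? : Letter K → Option (K × Bool)
  | inn k d => some (k, d)
  | _ => none

end Letter

/-- A figure whose strands are indexed by `K`: its crossings `J`, the passages `S k d` of the strand
`k` traversed in the direction `d`, and for each crossing line its strand, its direction, and the
exponents of the remainder of the strand. -/
structure Figure (K : Type) where
  J : Finset ℕ
  S : K → Bool → List Passage
  strand : ℕ → Bool → Option K
  up : ℕ → Bool → Bool → Bool
  tail : ℕ → Bool → Bool → ℤ × ℤ
  split : ∀ n ∈ J, ∀ o, ∃ k, strand n o = some k ∧ ∀ d, ∃ l₁ l₂,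
    S k d = l₁ ++ .line n o (up n o d) :: l₂ ∧ net l₂ = tail n o d
  mem : ∀ k d, ∀ s ∈ S k d, ∀ l, s.key = some l → l.1 ∈ J ∧ strand l.1 l.2 = some k

theorem Diagram.filterMap_key (T : Diagram) :
    T.path.filterMap Passage.key = T.lines.map fun l => ((l.1.1 : ℕ), l.2) := by
  rw [Diagram.lines, linesOf, List.map_filterMap]
  have hv := T.traverses.mem_crossings
  refine List.filterMap_congr fun s hs => ?_
  cases h : s.key with
  | none =>
    cases s with
    | extremum => rfl
    | line => simp [Passage.key] at h
  | some l =>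
    obtain ⟨x, hx, hx'⟩ := Tangle.mem_crossings.1 (hv s hs l h)
    obtain ⟨hn, rfl⟩ := List.getElem?_eq_some_iff.1 hx
    have : s.line? T.layers = some (⟨⟨l.1, hn⟩, hx'⟩, l.2) := Passage.line?_eq_some.2 h
    rw [this]
    rfl

theorem Diagram.nodup_keys (T : Diagram) : (T.path.filterMap Passage.key).Nodup := by
  rw [T.filterMap_key]
  refine T.lines_nodup.map fun l l' h => ?_
  simp only [Prod.mk.injEq] at h
  exact Prod.ext (Subtype.ext (Fin.ext h.1)) h.2

theorem Diagram.exists_line (T : Diagram) {n : ℕ} (hn : n ∈ crossings T.layers) (o : Bool) :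
    ∃ u, Passage.line n o u ∈ T.path := by
  obtain ⟨x, hx, hx'⟩ := Tangle.mem_crossings.1 hn
  obtain ⟨hn, rfl⟩ := List.getElem?_eq_some_iff.1 hx
  obtain ⟨s, hs, hs'⟩ := List.mem_filterMap.1 (T.mem_lines (⟨⟨n, hn⟩, hx'⟩, o))
  rw [Passage.line?_eq_some] at hs'
  cases s with
  | extremum => simp [Passage.key] at hs'
  | line m o' u =>
    simp only [Passage.key, Option.some.injEq, Prod.mk.injEq] at hs'
    obtain ⟨rfl, rfl⟩ := hs'
    exact ⟨u, hs⟩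

end Tangle

namespace OrientedQuantumCoalgebra

open Tangle WithConv

universe u v

variable {k : Type u} [Field k] {C : Type v} [AddCommGroup C] [Module k C] [Coalgebra k C]
  (Q : OrientedQuantumCoalgebra k C)

/-- The contribution of the crossing in the layer number `n`. -/
noncomputable def contrib (T : Diagram) (n : ℕ) : C →ₗ[k] C →ₗ[k] k :=
  open Classical in
  if h : ∃ χ : Crossing T.layers, (χ.1 : ℕ) = n then Q.contribution T h.choose else 0

theorem contrib_coe (T : Diagram) (χ : Crossing T.layers) :
    Q.contribution T χ = Q.contrib T χ.1 := by
  have h : ∃ χ' : Crossing T.layers, (χ'.1 : ℕ) = χ.1 := ⟨χ, rfl⟩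
  have h' : h.choose = χ := Subtype.ext (Fin.ext h.choose_spec)
  rw [contrib, dif_pos h, h']

theorem contrib_eq (T : Diagram) {n : ℕ} {P Q₁ P' Q₂ : List Passage} {o u : Bool}
    (ho : T.path = P ++ .line n true o :: Q₁) (hu : T.path = P' ++ .line n false u :: Q₂) :
    Q.contrib T n = Q.crossForm (isU T.layers n) o u (net Q₁ - net Q₂) := by
  have : n ∈ crossings T.layers :=
    T.traverses.mem_crossings (.line n true o) (by simp [ho]) (n, true) rfl
  obtain ⟨x, hx, hx'⟩ := mem_crossings.1 this
  obtain ⟨hn, rfl⟩ := List.getElem?_eq_some_iff.1 hx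
  let χ : Crossing T.layers := ⟨⟨n, hn⟩, hx'⟩
  exact (Q.contrib_coe T χ).symm.trans (Q.contribution_eq T χ ho hu)

/-- The product of the letters of a path in the convolution algebra. -/
noncomputable def word {R : Type*} [CommRing R] [Algebra k R] (ι : ℕ → Bool → C →ₗ[k] R)
    (path : List Passage) : WithConv (C →ₗ[k] R) :=
  (path.map (Passage.letter ι)).prod

theorem word_cons {R : Type*} [CommRing R] [Algebra k R] (ι : ℕ → Bool → C →ₗ[k] R)
    (s : Passage) (path : List Passage) : word ι (s :: path) = s.letter ι * word ι path := by
  simp [word]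

section Factors

variable {R : Type*} [CommRing R] [Algebra k R] (ι : ℕ → Bool → C →ₗ[k] R) {K : Type}

/-- The factor of a letter that comes from the outside of the figures. -/
noncomputable def outFactor : Letter K → C → R
  | .line n o _, x => ι n o x
  | .ext _ _, x => algebraMap k R (Coalgebra.counit x)
  | .inn _ _, _ => 1

/-- The factor of a letter that comes from the inside of the figures. -/
noncomputable def innFactor (S : K → Bool → List Passage) : Letter K → C → R
  | .inn k d, x => word ι (S k d) x
  | _, _ => 1

theorem word_comp {R' : Type*} [CommRing R'] [Algebra k R'] (f : R →ₐ[k] R')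
    (path : List Passage) (ι' : ℕ → Bool → C →ₗ[k] R')
    (h : ∀ s ∈ path, ∀ l, s.key = some l → ι' l.1 l.2 = f.toLinearMap ∘ₗ ι l.1 l.2) (x : C) :
    word ι' path x = f (word ι path x) := by
  induction path generalizing x with
  | nil => simp [word]
  | cons s path ih =>
    have ih := ih fun t ht => h t (List.mem_cons_of_mem _ ht)
    rw [word_cons, word_cons, (Coalgebra.Repr.arbitrary k x).convMul_apply,
      (Coalgebra.Repr.arbitrary k x).convMul_apply, map_sum]
    refine Finset.sum_congr rfl fun i _ => ?_
    rw [map_mul, ih]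
    congr 1
    cases s with
    | line n o u =>
      simp [Passage.letter, h (.line n o u) List.mem_cons_self (n, o) rfl]
    | extremum => simp [Passage.letter]

theorem word_of_key_eq_none {path : List Passage} (h : ∀ s ∈ path, s.key = none) :
    word ι path = 1 := by
  refine List.prod_eq_one fun f hf => ?_
  obtain ⟨s, hs, rfl⟩ := List.mem_map.1 hf
  cases s with
  | line => simpa [Passage.key] using h _ hs
  | extremum => rfl

end Factors

/-- Lines outside of the figure take values in `R` and lines of the figure in `R'`. In `R ⊗ R'` the
two kinds of factors commute past each other, and `Ψ ⊗ Ψ'` splits the result into an outer and an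
inner number. -/
theorem exists_factorization {K : Type} (T : Diagram) (b : Bool) (ρ : ℕ → ℕ) (O : Finset ℕ)
    (F : Figure K) (A : List (Letter K)) (hA : T.path = A.flatMap (Letter.expand b ρ F.S))
    (hI : crossings T.layers = O.image ρ ∪ F.J) (hd : Disjoint (O.image ρ) F.J)
    (hρ : Set.InjOn ρ O) (hline : ∀ n o u, .line n o u ∈ A → n ∈ O)
    (hext : ∀ l l', .ext l l' ∈ A → ∀ s ∈ if b then l else l', s.key = none)
    {R R' : Type (max u v)} [CommRing R] [Algebra k R] [CommRing R'] [Algebra k R']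
    (ι : ℕ → Bool → C →ₗ[k] R) (Ψ : R →ₗ[k] k) (ι' : ℕ → Bool → C →ₗ[k] R') (Ψ' : R' →ₗ[k] k)
    (hΨ : ∀ x : ℕ → Bool → C, Ψ (∏ n ∈ O, ι n true (x n true) * ι n false (x n false)) =
      ∏ n ∈ O, Q.contrib T (ρ n) (x n true) (x n false))
    (hΨ' : ∀ x : ℕ → Bool → C, Ψ' (∏ n ∈ F.J, ι' n true (x n true) * ι' n false (x n false)) =
      ∏ n ∈ F.J, Q.contrib T n (x n true) (x n false)) :
    ∃ (R₁ : Type (max u v)) (_ : CommRing R₁) (_ : Algebra k R₁)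
      (g : Letter K → WithConv (C →ₗ[k] R₁)) (Ψ₁ : R₁ →ₗ[k] k),
      (∀ c, Q.inv T c = Ψ₁ ((A.map g).prod c)) ∧
      ∀ B : List (Letter K × C), B.map Prod.fst = A → Ψ₁ (B.map fun p => g p.1 p.2).prod =
        Ψ (B.map fun p => outFactor ι p.1 p.2).prod *
          Ψ' (B.map fun p => innFactor ι' F.S p.1 p.2).prod := by
  classical
  let inl : R →ₐ[k] R ⊗[k] R' := Algebra.TensorProduct.includeLeft
  let inr : R' →ₐ[k] R ⊗[k] R' := Algebra.TensorProduct.includeRight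
  let Ψ₁ : R ⊗[k] R' →ₗ[k] k := LinearMap.mul' k k ∘ₗ TensorProduct.map Ψ Ψ'
  have hΨ₁ : ∀ r r', Ψ₁ (inl r * inr r') = Ψ r * Ψ' r' := fun r r' => by simp [Ψ₁, inl, inr]
  -- Outer lines are indexed by their numbers before renumbering, so that the same `ι` serves for
  -- both diagrams.
  let ι₁ : ℕ → Bool → C →ₗ[k] R ⊗[k] R' := fun n o =>
    if n ∈ O.image ρ then inl.toLinearMap ∘ₗ ι (Function.invFunOn ρ O n) o
    else inr.toLinearMap ∘ₗ ι' n o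
  have hO : ∀ n ∈ O, ∀ o, ι₁ (ρ n) o = inl.toLinearMap ∘ₗ ι n o := fun n hn o => by
    simp only [ι₁]
    rw [if_pos (Finset.mem_image_of_mem ρ hn), hρ.leftInvOn_invFunOn hn]
  have hJ : ∀ n ∈ F.J, ∀ o, ι₁ n o = inr.toLinearMap ∘ₗ ι' n o := fun n hn o =>
    if_neg fun h => Finset.disjoint_left.1 hd h hn
  refine ⟨R ⊗[k] R', inferInstance, inferInstance, fun a => word ι₁ (a.expand b ρ F.S), Ψ₁, ?_, ?_⟩
  · intro c
    have : (A.map fun a => word ι₁ (a.expand b ρ F.S)).prod =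
        (T.path.map (Passage.letter ι₁)).prod := by
      rw [hA, List.map_flatMap, List.flatMap_def, List.prod_flatten, List.map_map]
      rfl
    rw [this]
    refine Q.inv_apply T ι₁ Ψ₁ (Q.contrib T) (Q.contrib_coe T) (fun x => ?_) c
    rw [hI, Finset.prod_union hd, Finset.prod_union hd, Finset.prod_image hρ, Finset.prod_image hρ,
      ← hΨ fun n => x (ρ n), ← hΨ', ← hΨ₁, map_prod, map_prod]
    congr 2
    · exact Finset.prod_congr rfl fun n hn => by simp [hO n hn]
    · exact Finset.prod_congr rfl fun n hn => by simp [hJ n hn]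
  · rintro B rfl
    rw [← hΨ₁]
    congr 1
    rw [map_list_prod, map_list_prod, List.map_map, List.map_map, ← List.prod_map_mul]
    congr 1
    refine List.map_congr_left fun p hp => ?_
    obtain ⟨a, x⟩ := p
    have ha : a ∈ B.map Prod.fst := List.mem_map_of_mem hp
    cases a with
    | line n o u =>
      simp [Letter.expand, outFactor, innFactor, word, Passage.letter, hO n (hline n o u ha)]
    | ext l l' =>
      simp only [Letter.expand]
      rw [word_of_key_eq_none ι₁ (hext l l' ha)]
      simp [outFactor, innFactor]
    | inn k d =>
      simp only [Letter.expand, Function.comp_apply, outFactor, innFactor, map_one, one_mul]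
      exact word_comp ι' inr _ ι₁ (fun s hs l hl => hJ _ (F.mem k d s hs l hl).1 _) x

/-- The form contributed by the crossing `n` of a figure whose strand `k` is traversed in the
direction `d k` and has the exponents `P k` at its end. -/
noncomputable def figureForm {K : Type} (F : Figure K) (U : ℕ → Bool) (d : K → Bool)
    (P : K → ℤ × ℤ) (n : ℕ) : C →ₗ[k] C →ₗ[k] k :=
  -- The default values play no role for crossings of the figure, since `split` gives each of their
  -- lines a strand.
  let d' (o : Bool) : Bool := (F.strand n o).elim true d
  let P' (o : Bool) : ℤ × ℤ := (F.strand n o).elim 0 P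
  Q.crossForm (U n) (F.up n true (d' true)) (F.up n false (d' false))
    (F.tail n true (d' true) + P' true - (F.tail n false (d' false) + P' false))

/-- Two figures with the same strands give the same functional on `C ⊗ ⋯ ⊗ C`. -/
def FigureEq {K : Type} [Fintype K] (F F' : Figure K) (U U' : ℕ → Bool) : Prop :=
  ∀ (d : K → Bool) (P : K → ℤ × ℤ)
    (R R' : Type (max u v)) [CommRing R] [Algebra k R] [CommRing R'] [Algebra k R']
    (ι : ℕ → Bool → C →ₗ[k] R) (Ψ : R →ₗ[k] k) (ι' : ℕ → Bool → C →ₗ[k] R') (Ψ' : R' →ₗ[k] k),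
    (∀ x : ℕ → Bool → C, Ψ (∏ n ∈ F.J, ι n true (x n true) * ι n false (x n false)) =
      ∏ n ∈ F.J, Q.figureForm F U d P n (x n true) (x n false)) →
    (∀ x : ℕ → Bool → C, Ψ' (∏ n ∈ F'.J, ι' n true (x n true) * ι' n false (x n false)) =
      ∏ n ∈ F'.J, Q.figureForm F' U' d P n (x n true) (x n false)) →
    ∀ x : K → C, Ψ (∏ k, word ι (F.S k (d k)) (x k)) = Ψ' (∏ k, word ι' (F'.S k (d k)) (x k))

/-- After a crossing line of the figure the traversal first completes the strand, which gives
`tail`, and then runs from the end of the strand to the end of the diagram, which gives `P`. -/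
theorem contrib_eq_figureForm {K : Type} (T : Diagram) (b : Bool) (ρ : ℕ → ℕ) (F : Figure K)
    (A : List (Letter K)) (hA : T.path = A.flatMap (Letter.expand b ρ F.S)) (d : K → Bool)
    (P : K → ℤ × ℤ) (hP : ∀ k, ∃ A₁ A₂, A = A₁ ++ .inn k (d k) :: A₂ ∧
      net (A₂.flatMap (Letter.expand b ρ F.S)) = P k) (n : ℕ) (hn : n ∈ F.J) :
    Q.contrib T n = Q.figureForm F (isU T.layers) d P n := by
  have key : ∀ o, ∃ P₁ P₂, T.path = P₁ ++ .line n o (F.up n o ((F.strand n o).elim true d)) :: P₂ ∧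
      net P₂ = F.tail n o ((F.strand n o).elim true d) + (F.strand n o).elim 0 P := by
    intro o
    obtain ⟨k, hk, hs⟩ := F.split n hn o
    rw [hk, Option.elim_some, Option.elim_some]
    obtain ⟨A₁, A₂, h1, h2⟩ := hP k
    obtain ⟨l₁, l₂, h3, h4⟩ := hs (d k)
    refine ⟨A₁.flatMap (Letter.expand b ρ F.S) ++ l₁, l₂ ++ A₂.flatMap (Letter.expand b ρ F.S),
      ?_, by rw [net_append, h4, h2]⟩
    rw [hA, h1, List.flatMap_append, List.flatMap_cons]
    simp [Letter.expand, h3]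
  obtain ⟨P₁, P₂, h1, h2⟩ := key true
  obtain ⟨P₃, P₄, h3, h4⟩ := key false
  rw [Q.contrib_eq T h1 h3, h2, h4, figureForm]

/-- Every strand occurs once in the list of letters, so in a commutative algebra the inner factors
can be rearranged as a product over the strands. The elements `x` come from `B` alone and hence
serve both figures. -/
theorem exists_prod_innFactor {K : Type} [Fintype K] [DecidableEq K] (B : List (Letter K × C))
    (d : K → Bool) (hn : (((B.map Prod.fst).filterMap Letter.inner?).map Prod.fst).Nodup)
    (hd : ∀ k e, (k, e) ∈ (B.map Prod.fst).filterMap Letter.inner? ↔ e = d k) :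
    ∃ x : K → C, ∀ (R : Type (max u v)) [CommRing R] [Algebra k R] (ι : ℕ → Bool → C →ₗ[k] R)
      (S : K → Bool → List Passage), (B.map fun p => innFactor ι S p.1 p.2).prod =
        ∏ k, word ι (S k (d k)) (x k) := by
  classical
  obtain ⟨D, hD⟩ : ∃ D : List ((K × Bool) × C),
    D = B.filterMap fun p => p.1.inner?.map (·, p.2) := ⟨_, rfl⟩
  have hD1 : D.map Prod.fst = (B.map Prod.fst).filterMap Letter.inner? := by
    rw [hD, List.map_filterMap, List.filterMap_map]
    refine List.filterMap_congr fun p _ => ?_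
    cases h : p.1.inner? <;> simp [h]
  rw [← hD1] at hn hd
  have hx : ∀ k, ∃ x, ((k, d k), x) ∈ D := fun k => by simpa using (hd k (d k)).2 rfl
  choose x hx using hx
  refine ⟨x, fun R _ _ ι S => ?_⟩
  have h1 : (B.map fun p => innFactor ι S p.1 p.2).prod =
      (D.map fun q => (word ι (S q.1.1 q.1.2) q.2 : R)).prod := by
    rw [hD]
    clear hD hD1 hn hd hx
    induction B with
    | nil => rfl
    | cons p B ih =>
      rw [List.map_cons, List.prod_cons, ih]
      obtain ⟨a, y⟩ := p
      cases a <;> simp [innFactor, Letter.inner?]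
  have h2 : D.Perm (Finset.univ.toList.map fun k => ((k, d k), x k)) := by
    refine (List.perm_ext_iff_of_nodup (List.Nodup.of_map _ (List.Nodup.of_map _ hn))
      ((Finset.nodup_toList _).map fun k k' h => by simp at h; exact h.1.1)).2 fun q => ?_
    simp only [List.mem_map, Finset.mem_toList, Finset.mem_univ, true_and]
    constructor
    · intro hq
      have hq1 : q.1 = (q.1.1, d q.1.1) :=
        Prod.ext rfl ((hd q.1.1 q.1.2).1 (List.mem_map_of_mem hq))
      refine ⟨q.1.1, ?_⟩
      exact List.inj_on_of_nodup_map (List.Nodup.of_map _ hn) (hx _) hq hq1.symm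
    · rintro ⟨k, rfl⟩
      exact hx k
  rw [h1, (h2.map _).prod_eq, List.map_map, Finset.prod_map_toList]
  rfl

/-- A common list of letters gives equal outer contributions, because a letter has the same net
exponent in both diagrams. Factor by factor, the outer numbers then agree literally and the inner
numbers agree by `FigureEq`. -/
theorem inv_eq_of_letters {K : Type} [Fintype K] [DecidableEq K] (T T' : Diagram)
    (F F' : Figure K) (ρ : ℕ → ℕ) (O : Finset ℕ) (A : List (Letter K))
    (hA : T.path = A.flatMap (Letter.expand true id F.S))
    (hA' : T'.path = A.flatMap (Letter.expand false ρ F'.S))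
    (hI : crossings T.layers = O ∪ F.J) (hd : Disjoint O F.J)
    (hI' : crossings T'.layers = O.image ρ ∪ F'.J) (hd' : Disjoint (O.image ρ) F'.J)
    (hρ : Set.InjOn ρ O) (hU : ∀ n ∈ O, isU T.layers n = isU T'.layers (ρ n))
    (hline : ∀ n o u, .line n o u ∈ A → n ∈ O)
    (hext : ∀ l l', .ext l l' ∈ A → (∀ s ∈ l, s.key = none) ∧ (∀ s ∈ l', s.key = none) ∧
      net l = net l')
    (hnet : ∀ k d, net (F.S k d) = net (F'.S k d))
    (hstrand : ∀ k, ∃ n ∈ F.J, ∃ o, F.strand n o = some k)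
    (hF : Q.FigureEq F F' (isU T.layers) (isU T'.layers)) : Q.inv T = Q.inv T' := by
  classical
  -- each strand is traversed exactly once
  have hkeys := T.nodup_keys
  have hcons : ∀ k, ∃ e, (k, e) ∈ A.filterMap Letter.inner? := by
    intro k
    obtain ⟨n, hn, o, hk⟩ := hstrand k
    obtain ⟨u, hu⟩ := T.exists_line (hI ▸ Finset.mem_union_right _ hn) o
    rw [hA] at hu
    obtain ⟨a, ha, hs⟩ := List.mem_flatMap.1 hu
    cases a with
    | line n' o' u' =>
      simp only [Letter.expand, id, List.mem_singleton, Passage.line.injEq] at hs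
      exact absurd hn (Finset.disjoint_left.1 hd (hs.1 ▸ hline _ _ _ ha))
    | ext l l' =>
      have := (hext l l' ha).1 _ hs
      simp [Passage.key] at this
    | inn k d =>
      have := Option.some.inj ((F.mem k d _ hs (n, o) rfl).2.symm.trans hk)
      exact ⟨d, List.mem_filterMap.2 ⟨_, ha, by simp [Letter.inner?, this]⟩⟩
  -- Each strand carries a crossing line that it meets in both directions of traversal; a second
  -- occurrence of the strand would repeat this line.
  have hnodup : ((A.filterMap Letter.inner?).map Prod.fst).Nodup := by
    rw [hA, List.filterMap_flatMap, List.nodup_flatMap] at hkeys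
    rw [List.Nodup, List.pairwise_map, List.pairwise_filterMap]
    refine hkeys.2.imp fun {a a'} h p hp p' hp' hk => ?_
    cases a <;> simp only [Letter.inner?, reduceCtorEq] at hp
    cases a' <;> simp only [Letter.inner?, reduceCtorEq] at hp'
    rename_i k d k' d'
    obtain rfl := Option.some.inj hp
    obtain rfl := Option.some.inj hp'
    obtain rfl : k = k' := hk
    obtain ⟨n, hn, o, hk⟩ := hstrand k
    obtain ⟨k', hk', hs⟩ := F.split n hn o
    obtain rfl := Option.some.inj (hk.symm.trans hk')
    have key : ∀ d, (n, o) ∈ (F.S k d).filterMap Passage.key := fun d => by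
      obtain ⟨l₁, l₂, h, -⟩ := hs d
      exact List.mem_filterMap.2 ⟨.line n o (F.up n o d), by simp [h], rfl⟩
    exact h (key d) (key d')
  choose d hd1 using hcons
  have hd2 : ∀ k e, (k, e) ∈ A.filterMap Letter.inner? ↔ e = d k := fun k e =>
    ⟨fun h => congrArg Prod.snd (List.inj_on_of_nodup_map hnodup h (hd1 k) rfl),
      fun h => h ▸ hd1 k⟩
  have hinn : ∀ k, ∃ A₁ A₂, A = A₁ ++ .inn k (d k) :: A₂ := by
    intro k
    obtain ⟨a, ha, hk⟩ := List.mem_filterMap.1 (hd1 k)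
    cases a <;> simp [Letter.inner?] at hk
    obtain ⟨rfl, h⟩ := hk
    exact List.append_of_mem (h ▸ ha)
  -- the exponents agree
  have hnets : ∀ A₂ ⊆ A, net (A₂.flatMap (Letter.expand true id F.S)) =
      net (A₂.flatMap (Letter.expand false ρ F'.S)) := by
    intro A₂ h
    induction A₂ with
    | nil => rfl
    | cons a A₂ ih =>
      rw [List.cons_subset] at h
      rw [List.flatMap_cons, List.flatMap_cons, net_append, net_append, ih h.2]
      congr 1
      cases a with
      | line n o u => rfl
      | ext l l' => exact (hext l l' h.1).2.2
      | inn k d => exact hnet k d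
  choose A₁ A₂ hA12 using hinn
  have hsub : ∀ k, A₂ k ⊆ A := fun k a ha => by
    rw [hA12 k]
    exact List.mem_append_right _ (List.mem_cons_of_mem _ ha)
  obtain ⟨P, hP⟩ : ∃ P : K → ℤ × ℤ,
    P = fun k => net ((A₂ k).flatMap (Letter.expand true id F.S)) := ⟨_, rfl⟩
  have hJ : ∀ n ∈ F.J, _ := Q.contrib_eq_figureForm T true id F A hA d P
    fun k => ⟨A₁ k, A₂ k, hA12 k, by rw [hP]⟩
  have hJ' : ∀ n ∈ F'.J, _ := Q.contrib_eq_figureForm T' false ρ F' A hA' d P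
    fun k => ⟨A₁ k, A₂ k, hA12 k, (hnets _ (hsub k)).symm.trans (by rw [hP])⟩
  have hO : ∀ n ∈ O, Q.contrib T n = Q.contrib T' (ρ n) := by
    intro n hn
    have key : ∀ o, ∃ u P₁ P₂ P₃ P₄, T.path = P₁ ++ .line n o u :: P₂ ∧
        T'.path = P₃ ++ .line (ρ n) o u :: P₄ ∧ net P₂ = net P₄ := by
      intro o
      obtain ⟨u, hu⟩ := T.exists_line (hI ▸ Finset.mem_union_left _ hn) o
      rw [hA] at hu
      obtain ⟨a, ha, hs⟩ := List.mem_flatMap.1 hu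
      cases a with
      | line n' o' u' =>
        simp only [Letter.expand, id, List.mem_singleton, Passage.line.injEq] at hs
        obtain ⟨rfl, rfl, rfl⟩ := hs
        obtain ⟨A₃, A₄, h⟩ := List.append_of_mem ha
        refine ⟨u, A₃.flatMap (Letter.expand true id F.S), A₄.flatMap (Letter.expand true id F.S),
          A₃.flatMap (Letter.expand false ρ F'.S), A₄.flatMap (Letter.expand false ρ F'.S),
          ?_, ?_, hnets A₄ fun a ha => ?_⟩
        · rw [hA, h, List.flatMap_append, List.flatMap_cons]
          rfl
        · rw [hA', h, List.flatMap_append, List.flatMap_cons]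
          rfl
        · rw [h]
          exact List.mem_append_right _ (List.mem_cons_of_mem _ ha)
      | ext l l' =>
        have := (hext l l' ha).1 _ hs
        simp [Passage.key] at this
      | inn k d =>
        exact absurd (F.mem k d _ hs (n, o) rfl).1 (Finset.disjoint_left.1 hd hn)
    obtain ⟨o, P₁, P₂, P₃, P₄, h1, h2, h3⟩ := key true
    obtain ⟨u, P₅, P₆, P₇, P₈, h4, h5, h6⟩ := key false
    rw [Q.contrib_eq T h1 h4, Q.contrib_eq T' h2 h5, hU n hn, h3, h6]
  -- One algebra for the outer crossings of both diagrams, and a separate one for the crossings of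
  -- each figure.
  obtain ⟨R₀, _, _, ι₀, Ψ₀, h₀⟩ := exists_algebra_of_forms O (Q.contrib T)
  obtain ⟨R₁, _, _, ι₁, Ψ₁, h₁⟩ := exists_algebra_of_forms F.J (Q.contrib T)
  obtain ⟨R₂, _, _, ι₂, Ψ₂, h₂⟩ := exists_algebra_of_forms F'.J (Q.contrib T')
  obtain ⟨_, _, _, g, Φ, hg, hg'⟩ := Q.exists_factorization T true id O F A hA
    (by rw [Finset.image_id, hI]) (by rwa [Finset.image_id]) (Set.injOn_id _) hline
    (fun l l' h => (hext l l' h).1) ι₀ Ψ₀ ι₁ Ψ₁ h₀ h₁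
  obtain ⟨_, _, _, g', Φ', hg₂, hg₂'⟩ := Q.exists_factorization T' false ρ O F' A hA' hI' hd' hρ
    hline (fun l l' h => (hext l l' h).2.1) ι₀ Ψ₀ ι₂ Ψ₂
    (fun x => (h₀ x).trans (Finset.prod_congr rfl fun n hn => by rw [hO n hn])) h₂
  ext c
  rw [hg, hg₂]
  refine prod_map_apply_eq_of_forall A g g' Φ Φ' (fun B hB => ?_) c
  rw [hg' B hB, hg₂' B hB]
  congr 1
  obtain ⟨x, hx⟩ := exists_prod_innFactor (k := k) B d (by rwa [hB]) (by rwa [hB])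
  rw [hx R₁, hx R₂]
  refine hF d P R₁ R₂ ι₁ Ψ₁ ι₂ Ψ₂ (fun x => ?_) (fun x => ?_) x
  · exact (h₁ x).trans (Finset.prod_congr rfl fun n hn => by rw [hJ n hn])
  · exact (h₂ x).trans (Finset.prod_congr rfl fun n hn => by rw [hJ' n hn])

end OrientedQuantumCoalgebra


/-! ### Traversals through a replaced figure. -/

namespace Tangle

/-- `FigRun fig n p up path q up'`: a traversal of the figure `fig` that starts at position `p` below
its layer number `n` leaves the figure at position `q` in the direction `up'`. -/
inductive FigRun (fig : List Layer) : ℕ → ℕ → Bool → List Passage → ℕ → Bool → Prop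
  | exitTop {n : ℕ} (p : ℕ) : n = fig.length → FigRun fig n p true [] p true
  | exitBottom (p : ℕ) : FigRun fig 0 p false [] p false
  | stepUp {n p q r : ℕ} {x : Layer} {up up' : Bool} {met path : List Passage} :
      fig[n]? = some x → x.enterUp n p = (q, up, met) →
      FigRun fig (if up then n + 1 else n) q up path r up' →
      FigRun fig n p true (met ++ path) r up'
  | stepDown {n p q r : ℕ} {x : Layer} {up up' : Bool} {met path : List Passage} :
      fig[n]? = some x → x.enterDown n p = (q, up, met) →
      FigRun fig (if up then n + 1 else n) q up path r up' →
      FigRun fig (n + 1) p false (met ++ path) r up'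

/-- The passage with its layer renumbered. -/
def Passage.reindex (f : ℕ → ℕ) : Passage → Passage
  | .line n o u => .line (f n) o u
  | .extremum n t => .extremum (f n) t

theorem Layer.enterUp_reindex (f : ℕ → ℕ) (n : ℕ) (x : Layer) (p : ℕ) :
    x.enterUp (f n) p = ((x.enterUp n p).1, (x.enterUp n p).2.1,
      (x.enterUp n p).2.2.map (Passage.reindex f)) := by
  obtain ⟨x, i⟩ := x
  cases x <;> simp only [enterUp] <;> split_ifs <;> rfl

theorem Layer.enterDown_reindex (f : ℕ → ℕ) (n : ℕ) (x : Layer) (p : ℕ) :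
    x.enterDown (f n) p = ((x.enterDown n p).1, (x.enterDown n p).2.1,
      (x.enterDown n p).2.2.map (Passage.reindex f)) := by
  obtain ⟨x, i⟩ := x
  cases x <;> simp only [enterDown] <;> split_ifs <;> rfl

theorem Traverses.unique {w : List Layer} {n p : ℕ} {up : Bool} {path path' : List Passage}
    (h : Traverses w n p up path) (h' : Traverses w n p up path') : path = path' := by
  induction h generalizing path' with
  | exitTop p hn =>
    cases h' with
    | exitTop => rfl
    | stepUp hx => simp [hn] at hx
  | exitBottom =>
    cases h'
    rfl
  | stepUp hx he _ ih =>
    cases h' with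
    | exitTop _ hn => simp [hn] at hx
    | stepUp hx' he' h' =>
      obtain rfl := Option.some.inj (hx.symm.trans hx')
      have := he.symm.trans he'
      simp only [Prod.mk.injEq] at this
      obtain ⟨rfl, rfl, rfl⟩ := this
      rw [ih h']
  | stepDown hx he _ ih =>
    cases h' with
    | stepDown hx' he' h' =>
      obtain rfl := Option.some.inj (hx.symm.trans hx')
      have := he.symm.trans he'
      simp only [Prod.mk.injEq] at this
      obtain ⟨rfl, rfl, rfl⟩ := this
      rw [ih h']

theorem getElem?_figure {below fig above : List Layer} {n : ℕ} {x : Layer}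
    (h : fig[n]? = some x) : (below ++ fig ++ above)[below.length + n]? = some x := by
  have hn := (List.getElem?_eq_some_iff.1 h).1
  rw [List.append_assoc, List.getElem?_append_right (Nat.le_add_right _ _), Nat.add_sub_cancel_left,
    List.getElem?_append_left hn, h]

/-- A run through the figure, continued by a traversal from its exit, is a traversal of the diagram,
with layer numbers shifted by the layers below. -/
theorem FigRun.traverses {below fig above : List Layer} {n p q : ℕ} {up up' : Bool}
    {path rest : List Passage} (h : FigRun fig n p up path q up')
    (h' : Traverses (below ++ fig ++ above)
      (below.length + if up' then fig.length else 0) q up' rest) :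
    Traverses (below ++ fig ++ above) (below.length + n) p up
      (path.map (Passage.reindex (below.length + ·)) ++ rest) := by
  induction h with
  | exitTop p hn => simpa [hn] using h'
  | exitBottom => simpa using h'
  | stepUp hx he _ ih =>
    rw [List.map_append, List.append_assoc (List.map _ _)]
    refine .stepUp (getElem?_figure hx)
      ((Layer.enterUp_reindex (below.length + ·) _ _ _).trans (by rw [he])) ?_
    have := ih h'
    convert this using 1
    split_ifs <;> rfl
  | stepDown hx he _ ih =>
    rw [List.map_append, List.append_assoc (List.map _ _), ← add_assoc]
    refine .stepDown (getElem?_figure hx)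
      ((Layer.enterDown_reindex (below.length + ·) _ _ _).trans (by rw [he])) ?_
    have := ih h'
    convert this using 1
    split_ifs <;> rfl

/-- The conditions on the letters outside of the figures. -/
def Letter.Good {K : Type} (O : Finset ℕ) : Letter K → Prop
  | .line n _ _ => n ∈ O
  | .ext l l' => (∀ s ∈ l, s.key = none) ∧ (∀ s ∈ l', s.key = none) ∧ net l = net l'
  | .inn _ _ => True

/-- Outside of the figures the passages agree up to the number of the layer: crossing lines become
`line`, and extrema become `ext` with two passages of the same weight. -/
theorem exists_letters_of_met {K : Type} (ρ : ℕ → ℕ) (S S' : K → Bool → List Passage)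
    (O : Finset ℕ) (n' : ℕ) (met : List Passage)
    (h : ∀ s ∈ met, ∀ l, s.key = some l → l.1 ∈ O ∧ ρ l.1 = n') :
    ∃ B : List (Letter K), (∀ a ∈ B, a.Good O) ∧ met = B.flatMap (Letter.expand true id S) ∧
      met.map (Passage.reindex fun _ => n') = B.flatMap (Letter.expand false ρ S') := by
  induction met with
  | nil => exact ⟨[], by simp, rfl, rfl⟩
  | cons s met ih =>
    obtain ⟨B, h1, h2, h3⟩ := ih fun t ht => h t (List.mem_cons_of_mem _ ht)
    cases s with
    | line m o u =>
      obtain ⟨hm, hm'⟩ := h _ List.mem_cons_self (m, o) rfl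
      refine ⟨.line m o u :: B, ?_, ?_, ?_⟩
      · simpa [Letter.Good] using ⟨hm, h1⟩
      · rw [List.flatMap_cons, ← h2]
        rfl
      · rw [List.flatMap_cons, ← h3]
        simp [Letter.expand, Passage.reindex, hm']
    | extremum m t =>
      refine ⟨.ext [.extremum m t] [.extremum n' t] :: B, ?_, ?_, ?_⟩
      · have : net [.extremum m t] = net [.extremum n' t] := by cases t <;> rfl
        simpa [Letter.Good, Passage.key, this] using h1
      · rw [List.flatMap_cons, ← h2]
        rfl
      · rw [List.flatMap_cons, ← h3]
        rfl

/-- Compatible traversals of two figures from the same entry. -/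
def EntryMatch {K : Type} (N : ℕ) (ρ : ℕ → ℕ) (S S' : K → Bool → List Passage) (O : Finset ℕ)
    (fig fig' : List Layer) : Prop :=
  ∀ (p : ℕ) (up : Bool), ∃ (q : ℕ) (up' : Bool) (path path' : List Passage) (B : List (Letter K)),
    FigRun fig (if up then 0 else fig.length) p up path q up' ∧
    FigRun fig' (if up then 0 else fig'.length) p up path' q up' ∧
    (∀ a ∈ B, a.Good O) ∧
    path.map (Passage.reindex (N + ·)) = B.flatMap (Letter.expand true id S) ∧
    path'.map (Passage.reindex (N + ·)) = B.flatMap (Letter.expand false ρ S')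

section Matching

variable {K : Type} {ρ : ℕ → ℕ} {S S' : K → Bool → List Passage} {O : Finset ℕ}
  {below fig fig' above : List Layer}

/-- The number of a layer or a level outside of the figure after the replacement. -/
def level (N h h' n : ℕ) : ℕ := if n ≤ N then n else n - h + h'

/-- As the figure is not empty, its bottom level differs from its top level, so `level` can fix the
first and move the second. -/
theorem getElem?_level {n : ℕ} {x : Layer}
    (hx : (below ++ fig ++ above)[n]? = some x)
    (hn : n < below.length ∨ below.length + fig.length ≤ n) (hfig : 0 < fig.length) :
    (below ++ fig' ++ above)[level below.length fig.length fig'.length n]? = some x := by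
  rw [List.append_assoc] at hx ⊢
  rcases hn with hn | hn
  · rw [level, if_pos hn.le, List.getElem?_append_left hn]
    rwa [List.getElem?_append_left hn] at hx
  · rw [level, if_neg (by omega), List.getElem?_append_right (by omega),
      List.getElem?_append_right (by omega)]
    rw [List.getElem?_append_right (by omega), List.getElem?_append_right (by omega)] at hx
    rw [← hx]
    congr 1
    omega

/-- The induction advances by single layers whereas letters swallow whole passages through the
figure. States inside the figure therefore need a statement of their own, proved simultaneously. -/
theorem Traverses.exists_letters (hfig : 0 < fig.length)
    (hentry : EntryMatch below.length ρ S S' O fig fig')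
    (hO : ∀ n ∈ crossings (below ++ fig ++ above),
      n < below.length ∨ below.length + fig.length ≤ n →
        n ∈ O ∧ ρ n = level below.length fig.length fig'.length n)
    {n p : ℕ} {up : Bool} {path : List Passage}
    (h : Traverses (below ++ fig ++ above) n p up path)
    (hn : n ≤ below.length ∨ below.length + fig.length ≤ n) :
    ∃ A : List (Letter K), (∀ a ∈ A, a.Good O) ∧ path = A.flatMap (Letter.expand true id S) ∧
      Traverses (below ++ fig' ++ above) (level below.length fig.length fig'.length n) p up
        (A.flatMap (Letter.expand false ρ S')) := by
  let Out : ℕ → ℕ → Bool → List Passage → Prop := fun n p up path =>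
    ∃ A : List (Letter K), (∀ a ∈ A, a.Good O) ∧ path = A.flatMap (Letter.expand true id S) ∧
      Traverses (below ++ fig' ++ above) (level below.length fig.length fig'.length n) p up
        (A.flatMap (Letter.expand false ρ S'))
  -- For a state inside the figure: along any run to the exit, the remaining path consists of the
  -- passages of that run and a part that is already translated into letters.
  let In : ℕ → ℕ → Bool → List Passage → Prop := fun n p up path => ∀ m q up' path₀, n = below.length + m → FigRun fig m p up path₀ q up' →
      ∃ A : List (Letter K), (∀ a ∈ A, a.Good O) ∧
        path = path₀.map (Passage.reindex (below.length + ·)) ++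
          A.flatMap (Letter.expand true id S) ∧
        Traverses (below ++ fig' ++ above) (below.length + if up' then fig'.length else 0) q up'
          (A.flatMap (Letter.expand false ρ S'))
  have hl0 : level below.length fig.length fig'.length below.length = below.length := by
    simp [level]
  have hl1 : level below.length fig.length fig'.length (below.length + fig.length) =
      below.length + fig'.length := by
    rw [level, if_neg (by omega)]
    omega
  -- At an entry into the figure, `EntryMatch` supplies runs through both figures and their letters,
  -- so `Out` follows from `In`. A direct proof of `Out` is needed only at the other outer states.
  have combine : ∀ {n p up path},
      (¬ (n = below.length ∧ up = true) → ¬ (n = below.length + fig.length ∧ up = false) →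
        (n ≤ below.length ∨ below.length + fig.length ≤ n) → Out n p up path) →
      In n p up path → ((n ≤ below.length ∨ below.length + fig.length ≤ n) → Out n p up path) ∧
        In n p up path := by
    intro n p up path hout hin
    refine ⟨fun hn => ?_, hin⟩
    by_cases h : (n = below.length ∧ up = true) ∨ (n = below.length + fig.length ∧ up = false)
    · obtain ⟨q, up', path₀, path₁, B, h1, h2, h3, h4, h5⟩ := hentry p up
      have hn' : n = below.length + if up then 0 else fig.length := by
        rcases h with ⟨rfl, rfl⟩ | ⟨rfl, rfl⟩ <;> rfl
      obtain ⟨A, h6, h7, h8⟩ := hin _ q up' path₀ hn' h1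
      refine ⟨B ++ A, ?_, ?_, ?_⟩
      · intro a ha
        exact (List.mem_append.1 ha).elim (h3 a) (h6 a)
      · rw [h7, h4, List.flatMap_append]
      · have := h2.traverses h8
        rw [h5, ← List.flatMap_append] at this
        convert this using 1
        rcases h with ⟨rfl, rfl⟩ | ⟨rfl, rfl⟩
        · simp [hl0]
        · simp [hl1]
    · push Not at h
      exact hout (fun h' => by simp_all) (fun h' => by simp_all) hn
  refine (?_ : ((n ≤ below.length ∨ below.length + fig.length ≤ n) → Out n p up path) ∧
    In n p up path).1 hn
  clear hn
  induction h with
  | @exitTop n p hn =>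
    simp only [List.length_append] at hn
    have hout : Out n p true [] := ⟨[], by simp, rfl, .exitTop p (by
      rw [level, if_neg (by omega)]
      simp only [List.length_append]
      omega)⟩
    refine combine (fun _ _ _ => hout) ?_
    intro m q up' path₀ hm hrun
    cases hrun with
    | exitTop _ hm' =>
      obtain ⟨A, h1, h2, h3⟩ := hout
      rw [hm, hm', hl1] at h3
      exact ⟨A, h1, h2, h3⟩
    | stepUp hx =>
      have := (List.getElem?_eq_some_iff.1 hx).1
      omega
  | exitBottom p =>
    have hout : Out 0 p false [] := ⟨[], by simp, rfl, by
      rw [level, if_pos (Nat.zero_le _)]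
      exact .exitBottom p⟩
    refine combine (fun _ _ _ => hout) ?_
    intro m q up' path₀ hm hrun
    cases hrun with
    | exitBottom =>
      obtain ⟨A, h1, h2, h3⟩ := hout
      rw [hm, add_zero, hl0] at h3
      exact ⟨A, h1, h2, h3⟩
    | stepDown => omega
  | @stepUp n p q x up met path hx he _ ih =>
    have hout : ¬ (n = below.length ∧ true = true) →
        (n ≤ below.length ∨ below.length + fig.length ≤ n) → Out n p true (met ++ path) := by
      intro h1 h3
      have hn : n < below.length ∨ below.length + fig.length ≤ n := by
        simp only [and_true] at h1
        omega
      obtain ⟨A, h4, h5, h6⟩ := ih.1 (by split_ifs <;> omega)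
      obtain ⟨B, h7, h8, h9⟩ := exists_letters_of_met ρ S S' O
        (level below.length fig.length fig'.length n) met fun s hs l hl => by
          obtain ⟨e, hc⟩ := Layer.enterUp_key he s hs l hl
          rw [e]
          exact hO n (Tangle.mem_crossings.2 ⟨x, hx, hc⟩) hn
      refine ⟨B ++ A, fun a ha => (List.mem_append.1 ha).elim (h7 a) (h4 a), ?_, ?_⟩
      · rw [List.flatMap_append, ← h8, ← h5]
      · rw [List.flatMap_append, ← h9]
        refine .stepUp (getElem?_level hx hn hfig)
          ((Layer.enterUp_reindex (fun _ => level below.length fig.length fig'.length n) n x p).trans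
            (by rw [he])) ?_
        have e : level below.length fig.length fig'.length (n + 1) =
            level below.length fig.length fig'.length n + 1 := by
          simp only [level]
          split_ifs <;> omega
        convert h6 using 1
        cases up <;> simp [e]
    refine combine (fun h1 _ h3 => hout h1 h3) ?_
    intro m r up' path₀ hm hrun
    cases hrun with
    | exitTop _ hm' =>
      obtain ⟨A, h1, h2, h3⟩ := hout (by omega) (by omega)
      rw [hm, hm', hl1] at h3
      exact ⟨A, h1, h2, h3⟩
    | stepUp hx' he' hrun' =>
      have e := getElem?_figure (below := below) (above := above) hx'
      rw [← hm, hx] at e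
      obtain rfl := Option.some.inj e
      have e2 := Layer.enterUp_reindex (below.length + ·) m x p
      simp only [← hm, he, he', Prod.mk.injEq] at e2
      obtain ⟨rfl, rfl, rfl⟩ := e2
      obtain ⟨A, h1, h2, h3⟩ := ih.2 _ _ _ _ (by rw [hm]; split_ifs <;> rfl) hrun'
      exact ⟨A, h1, by rw [h2, List.map_append, List.append_assoc], h3⟩
  | @stepDown n p q x up met path hx he _ ih =>
    have hout : ¬ (n + 1 = below.length + fig.length ∧ false = false) →
        (n + 1 ≤ below.length ∨ below.length + fig.length ≤ n + 1) →
        Out (n + 1) p false (met ++ path) := by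
      intro h1 h3
      have hn : n < below.length ∨ below.length + fig.length ≤ n := by
        simp only [and_true] at h1
        omega
      obtain ⟨A, h4, h5, h6⟩ := ih.1 (by split_ifs <;> omega)
      obtain ⟨B, h7, h8, h9⟩ := exists_letters_of_met ρ S S' O
        (level below.length fig.length fig'.length n) met fun s hs l hl => by
          obtain ⟨e, hc⟩ := Layer.enterDown_key he s hs l hl
          rw [e]
          exact hO n (Tangle.mem_crossings.2 ⟨x, hx, hc⟩) hn
      refine ⟨B ++ A, fun a ha => (List.mem_append.1 ha).elim (h7 a) (h4 a), ?_, ?_⟩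
      · rw [List.flatMap_append, ← h8, ← h5]
      · rw [List.flatMap_append, ← h9]
        have e : level below.length fig.length fig'.length (n + 1) =
            level below.length fig.length fig'.length n + 1 := by
          simp only [level]
          split_ifs <;> omega
        rw [e]
        refine .stepDown (getElem?_level hx hn hfig)
          ((Layer.enterDown_reindex (fun _ => level below.length fig.length fig'.length n) n x
            p).trans (by rw [he])) ?_
        convert h6 using 1
        cases up <;> simp [e]
    refine combine (fun _ h2 h3 => hout h2 h3) ?_
    intro m r up' path₀ hm hrun
    cases hrun with
    | exitBottom =>
      obtain ⟨A, h1, h2, h3⟩ := hout (by omega) (by omega)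
      rw [hm, add_zero, hl0] at h3
      exact ⟨A, h1, h2, h3⟩
    | @stepDown m _ _ _ _ _ _ _ _ hx' he' hrun' =>
      have hm : n = below.length + m := by omega
      have e := getElem?_figure (below := below) (above := above) hx'
      rw [← hm, hx] at e
      obtain rfl := Option.some.inj e
      have e2 := Layer.enterDown_reindex (below.length + ·) m x p
      simp only [← hm, he, he', Prod.mk.injEq] at e2
      obtain ⟨rfl, rfl, rfl⟩ := e2
      obtain ⟨A, h1, h2, h3⟩ := ih.2 _ _ _ _ (by rw [hm]; split_ifs <;> rfl) hrun'
      exact ⟨A, h1, by rw [h2, List.map_append, List.append_assoc], h3⟩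

/-- The translated path is a traversal of the second diagram from its base point, hence it is the
path of that diagram by uniqueness. -/
theorem Diagram.exists_letters (T T' : Diagram) (hup : T.up = T'.up)
    (hT : T.layers = below ++ fig ++ above) (hT' : T'.layers = below ++ fig' ++ above)
    (hfig : 0 < fig.length) (hentry : EntryMatch below.length ρ S S' O fig fig')
    (hO : ∀ n ∈ crossings (below ++ fig ++ above),
      n < below.length ∨ below.length + fig.length ≤ n →
        n ∈ O ∧ ρ n = level below.length fig.length fig'.length n) :
    ∃ A : List (Letter K), (∀ a ∈ A, a.Good O) ∧ T.path = A.flatMap (Letter.expand true id S) ∧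
      T'.path = A.flatMap (Letter.expand false ρ S') := by
  have h := T.traverses
  have h' := T'.traverses
  rw [hT'] at h'
  rw [hT, hup] at h
  obtain ⟨A, h1, h2, h3⟩ := h.exists_letters hfig hentry hO (by
    simp only [List.length_append]
    split_ifs <;> omega)
  refine ⟨A, h1, h2, h'.unique ?_⟩
  convert h3 using 1
  simp only [List.length_append, level]
  split_ifs <;> omega

end Matching

end Tangle


/-! ### Computation of traversals, and the replacement of a figure. -/

namespace Tangle

/-- The traversal of a figure for at most `s` steps: its passages, the position and the direction at
its end, and whether it has left the figure. -/
def run (fig : List Layer) : ℕ → ℕ → ℕ → Bool → List Passage × ℕ × Bool × Bool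
  | 0, _, p, up => ([], p, up, false)
  | s + 1, n, p, true =>
    match fig[n]? with
    | none => ([], p, true, decide (n = fig.length))
    | some x =>
      ((x.enterUp n p).2.2 ++ (run fig s (if (x.enterUp n p).2.1 then n + 1 else n)
        (x.enterUp n p).1 (x.enterUp n p).2.1).1,
        (run fig s (if (x.enterUp n p).2.1 then n + 1 else n)
          (x.enterUp n p).1 (x.enterUp n p).2.1).2)
  | _ + 1, 0, p, false => ([], p, false, true)
  | s + 1, n + 1, p, false =>
    match fig[n]? with
    | none => ([], p, false, false)
    | some x =>
      ((x.enterDown n p).2.2 ++ (run fig s (if (x.enterDown n p).2.1 then n + 1 else n)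
        (x.enterDown n p).1 (x.enterDown n p).2.1).1,
        (run fig s (if (x.enterDown n p).2.1 then n + 1 else n)
          (x.enterDown n p).1 (x.enterDown n p).2.1).2)

theorem FigRun.of_run {fig : List Layer} {s n p : ℕ} {up : Bool}
    (h : (run fig s n p up).2.2.2 = true) :
    FigRun fig n p up (run fig s n p up).1 (run fig s n p up).2.1 (run fig s n p up).2.2.1 := by
  induction s generalizing n p up with
  | zero => cases up <;> simp [run] at h
  | succ s ih =>
    cases up with
    | true =>
      rw [run] at h ⊢
      cases hx : fig[n]? with
      | none =>
        rw [hx] at h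
        exact .exitTop p (by simpa using h)
      | some x =>
        rw [hx] at h
        exact .stepUp hx rfl (ih h)
    | false =>
      cases n with
      | zero => exact .exitBottom p
      | succ n =>
        rw [run] at h ⊢
        cases hx : fig[n]? with
        | none => simp [hx] at h
        | some x =>
          rw [hx] at h
          exact .stepDown hx rfl (ih h)

/-- Reduces the matching of two explicit figures to evaluation of `run`, with a number of steps `s`
that covers all layers met and the exit. -/
theorem EntryMatch.of_run {K : Type} {N : ℕ} {ρ : ℕ → ℕ} {S S' : K → Bool → List Passage}
    {O : Finset ℕ} {fig fig' : List Layer} (s : ℕ)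
    (h : ∀ (p : ℕ) (up : Bool), ∃ B : List (Letter K), (∀ a ∈ B, a.Good O) ∧
      (run fig s (if up then 0 else fig.length) p up).2 =
        ((run fig' s (if up then 0 else fig'.length) p up).2.1,
          (run fig' s (if up then 0 else fig'.length) p up).2.2.1, true) ∧
      (run fig' s (if up then 0 else fig'.length) p up).2.2.2 = true ∧
      (run fig s (if up then 0 else fig.length) p up).1.map (Passage.reindex (N + ·)) =
        B.flatMap (Letter.expand true id S) ∧
      (run fig' s (if up then 0 else fig'.length) p up).1.map (Passage.reindex (N + ·)) =
        B.flatMap (Letter.expand false ρ S')) :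
    EntryMatch N ρ S S' O fig fig' := by
  intro p up
  obtain ⟨B, h1, h2, h3, h4, h5⟩ := h p up
  refine ⟨_, _, _, _, B, .of_run ?_, ?_, h1, h4, h5⟩
  · rw [h2]
  · rw [h2]
    exact .of_run h3

theorem isU_figure {below fig above : List Layer} {m : ℕ} (hm : m < fig.length) :
    isU (below ++ fig ++ above) (below.length + m) = isU fig m := by
  rw [isU, getElem?_figure (List.getElem?_eq_getElem hm), isU, List.getElem?_eq_getElem hm]

theorem mem_crossings_figure {below fig above : List Layer} {m : ℕ} (hm : m < fig.length) :
    below.length + m ∈ crossings (below ++ fig ++ above) ↔ m ∈ crossings fig := by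
  rw [mem_crossings, mem_crossings, getElem?_figure (List.getElem?_eq_getElem hm),
    List.getElem?_eq_getElem hm]

theorem lt_of_mem_crossings {w : List Layer} {n : ℕ} (h : n ∈ crossings w) : n < w.length := by
  obtain ⟨x, hx, -⟩ := mem_crossings.1 h
  exact (List.getElem?_eq_some_iff.1 hx).1

/-- The crossings outside of a figure of `h` layers above the level `N`. -/
def outside (N h : ℕ) (w : List Layer) : Finset ℕ :=
  (crossings w).filter fun n => n < N ∨ N + h ≤ n

theorem image_level_outside {below fig fig' above : List Layer} (hfig : 0 < fig.length) :
    (outside below.length fig.length (below ++ fig ++ above)).image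
      (level below.length fig.length fig'.length) =
    outside below.length fig'.length (below ++ fig' ++ above) := by
  have hN : ∀ n, n < below.length → (below ++ fig ++ above)[n]? = (below ++ fig' ++ above)[n]? :=
    fun n hn => by
      rw [List.append_assoc, List.getElem?_append_left hn, List.append_assoc,
        List.getElem?_append_left hn]
  have hN' : ∀ n, (below ++ fig ++ above)[below.length + fig.length + n]? =
      (below ++ fig' ++ above)[below.length + fig'.length + n]? := fun n => by
    rw [List.getElem?_append_right (by simp), List.getElem?_append_right (by simp)]
    simp
  ext n
  simp only [outside, Finset.mem_image, Finset.mem_filter, mem_crossings]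
  constructor
  · rintro ⟨m, ⟨⟨x, hx, hc⟩, hm⟩, rfl⟩
    refine ⟨⟨x, getElem?_level hx hm hfig, hc⟩, ?_⟩
    simp only [level]
    split_ifs <;> omega
  · rintro ⟨⟨x, hx, hc⟩, hn | hn⟩
    · exact ⟨n, ⟨⟨x, (hN n hn).trans hx, hc⟩, .inl hn⟩, by rw [level, if_pos hn.le]⟩
    · obtain ⟨m, rfl⟩ := Nat.exists_eq_add_of_le hn
      refine ⟨below.length + fig.length + m, ⟨⟨x, (hN' m).trans hx, hc⟩, .inr (by omega)⟩, ?_⟩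
      rw [level, if_neg (by omega)]
      omega

end Tangle

namespace OrientedQuantumCoalgebra

open Tangle

universe u v

variable {k : Type u} [Field k] {C : Type v} [AddCommGroup C] [Module k C] [Coalgebra k C]
  (Q : OrientedQuantumCoalgebra k C)

/-- The replacement of a figure by another one preserves the invariant if the figures have matching
strands and give the same functional. The crossings in `D` belong to the figure, but to none of
the strands in `K`. -/
theorem inv_eq_of_figures {K : Type} [Fintype K] [DecidableEq K] (T T' : Diagram)
    (hup : T.up = T'.up) {below fig fig' above : List Layer}
    (hT : T.layers = below ++ fig ++ above) (hT' : T'.layers = below ++ fig' ++ above)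
    (hfig : 0 < fig.length) (F F' : Figure K) (D : Finset ℕ) (ρ : ℕ → ℕ)
    (hJ : ∀ n, n ∈ D ∪ F.J ↔ ∃ m ∈ crossings fig, n = below.length + m)
    (hJ' : ∀ n, n ∈ D.image ρ ∪ F'.J ↔ ∃ m ∈ crossings fig', n = below.length + m)
    (hd : Disjoint D F.J) (hd' : Disjoint (D.image ρ) F'.J) (hρD : Set.InjOn ρ D)
    (hρ : ∀ n, n < below.length ∨ below.length + fig.length ≤ n →
      ρ n = level below.length fig.length fig'.length n)
    (hU : ∀ n ∈ D, isU (below ++ fig ++ above) n = isU (below ++ fig' ++ above) (ρ n))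
    (hentry : ∀ O, D ⊆ O → EntryMatch below.length ρ F.S F'.S O fig fig')
    (hnet : ∀ k d, net (F.S k d) = net (F'.S k d))
    (hstrand : ∀ k, ∃ n ∈ F.J, ∃ o, F.strand n o = some k)
    (hF : Q.FigureEq F F' (isU (below ++ fig ++ above)) (isU (below ++ fig' ++ above))) :
    Q.inv T = Q.inv T' := by
  have split : ∀ g : List Layer, ∀ D' J : Finset ℕ,
      (∀ n, n ∈ D' ∪ J ↔ ∃ m ∈ crossings g, n = below.length + m) →
      crossings (below ++ g ++ above) =
        outside below.length g.length (below ++ g ++ above) ∪ D' ∪ J := by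
    intro g D' J h
    ext n
    rw [Finset.union_assoc, Finset.mem_union, h, outside, Finset.mem_filter]
    constructor
    · intro hn
      by_cases h' : n < below.length ∨ below.length + g.length ≤ n
      · exact .inl ⟨hn, h'⟩
      · obtain ⟨m, rfl⟩ := Nat.exists_eq_add_of_le (show below.length ≤ n by omega)
        exact .inr ⟨m, (mem_crossings_figure (by omega)).1 hn, rfl⟩
    · rintro (h' | ⟨m, hm, rfl⟩)
      · exact h'.1
      · exact (mem_crossings_figure (lt_of_mem_crossings hm)).2 hm
  have inside : ∀ g : List Layer, ∀ s : Finset ℕ,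
      (∀ n ∈ s, ∃ m ∈ crossings g, n = below.length + m) →
      ∀ n ∈ s, below.length ≤ n ∧ n < below.length + g.length := by
    intro g s h n hn
    obtain ⟨m, hm, rfl⟩ := h n hn
    have := lt_of_mem_crossings hm
    omega
  have hin := inside fig (D ∪ F.J) fun n hn => (hJ n).1 hn
  have hin' := inside fig' (D.image ρ ∪ F'.J) fun n hn => (hJ' n).1 hn
  have hout : ∀ g : List Layer, ∀ n ∈ outside below.length g.length (below ++ g ++ above),
      n < below.length ∨ below.length + g.length ≤ n := fun g n hn => (Finset.mem_filter.1 hn).2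
  have himage : (outside below.length fig.length (below ++ fig ++ above) ∪ D).image ρ =
      outside below.length fig'.length (below ++ fig' ++ above) ∪ D.image ρ := by
    rw [Finset.image_union, ← image_level_outside (fig := fig) (fig' := fig') hfig]
    congr 1
    exact Finset.image_congr fun n hn => hρ n (hout fig n hn)
  obtain ⟨A, h1, h2, h3⟩ := T.exists_letters T' hup hT hT' hfig
    (hentry (outside below.length fig.length (below ++ fig ++ above) ∪ D)
      Finset.subset_union_right) (fun n hn h =>
      ⟨Finset.mem_union_left _ (Finset.mem_filter.2 ⟨hn, h⟩), hρ n h⟩)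
  refine Q.inv_eq_of_letters T T' F F' ρ
    (outside below.length fig.length (below ++ fig ++ above) ∪ D) A h2 h3 ?_ ?_ ?_ ?_ ?_ ?_
    (fun n o u h => h1 _ h) (fun l l' h => h1 _ h) hnet hstrand (by rwa [hT, hT'])
  · rw [hT, split fig D F.J hJ]
  · refine Finset.disjoint_union_left.2 ⟨Finset.disjoint_left.2 fun n hn hn' => ?_, hd⟩
    have := hout fig n hn
    have := hin n (Finset.mem_union_right _ hn')
    omega
  · rw [hT', split fig' _ F'.J hJ', himage]
  · rw [himage]
    refine Finset.disjoint_union_left.2 ⟨Finset.disjoint_left.2 fun n hn hn' => ?_, hd'⟩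
    have := hout fig' n hn
    have := hin' n (Finset.mem_union_right _ hn')
    omega
  · have hlevel : ∀ n ∈ outside below.length fig.length (below ++ fig ++ above),
        ρ n < below.length ∨ below.length + fig'.length ≤ ρ n := fun n hn => by
      have := hout fig n hn
      rw [hρ n this, level]
      split_ifs <;> omega
    intro n hn m hm h
    rw [Finset.mem_coe, Finset.mem_union] at hn hm
    rcases hn with hn | hn <;> rcases hm with hm | hm
    · have hn := hout fig n hn
      have hm := hout fig m hm
      rw [hρ n hn, hρ m hm, level, level] at h
      split_ifs at h <;> omega
    · have := hlevel n hn
      have := hin' (ρ m) (Finset.mem_union_left _ (Finset.mem_image_of_mem ρ hm))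
      omega
    · have := hlevel m hm
      have := hin' (ρ n) (Finset.mem_union_left _ (Finset.mem_image_of_mem ρ hn))
      omega
    · exact hρD hn hm h
  · intro n hn
    rw [hT, hT']
    rcases Finset.mem_union.1 hn with hn | hn
    · obtain ⟨x, hx, -⟩ := mem_crossings.1 (Finset.mem_filter.1 hn).1
      rw [isU, hx, hρ n (hout fig n hn), isU, getElem?_level hx (hout fig n hn) hfig]
    · exact hU n hn

end OrientedQuantumCoalgebra


/-! ### The figures of (M.1) to (M.4). -/

namespace Tangle

/-- Positions relative to the strands of a figure. -/
theorem exists_eq_or_lt (p i : ℕ) :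
    (p < i ∧ p ≠ i ∧ p ≠ i + 1 ∧ p ≠ i + 2 ∧ p < i + 1) ∨ p = i ∨ p = i + 1 ∨ p = i + 2 ∨
      ∃ m, p = i + (m + 3) := by
  by_cases h : p < i
  · left; omega
  · obtain ⟨m, rfl⟩ := Nat.exists_eq_add_of_le (not_lt.1 h)
    rcases m with _ | _ | _ | m <;> simp

/-- The figure without crossings and strands. -/
def Figure.empty : Figure Empty where
  J := ∅
  S k := k.elim
  strand _ _ := none
  up _ _ _ := true
  tail _ _ _ := 0
  split n hn := by simp at hn
  mem k := k.elim

theorem entryMatch_m1 (N i : ℕ) (O : Finset ℕ) (ρ : ℕ → ℕ) (S S' : Empty → Bool → List Passage) :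
    EntryMatch N ρ S S' O [⟨.minimum, i + 1⟩, ⟨.maximum, i⟩] [] := by
  -- All passages through the zigzag form one letter without crossing lines. It is traversed in four
  -- steps and an exit; its two extrema have opposite weights.
  refine .of_run 5 fun p up => ⟨[.ext ((run [⟨.minimum, i + 1⟩, ⟨.maximum, i⟩] 5
    (if up then 0 else 2) p up).1.map (Passage.reindex (N + ·))) []], ?_⟩
  obtain h | rfl | rfl | rfl | ⟨m, rfl⟩ := exists_eq_or_lt p i <;> cases up <;>
    simp [run, Layer.enterUp, Layer.enterDown, Letter.expand, Letter.Good, Passage.reindex,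
      Passage.key, Passage.weight, add_assoc, *] <;> omega

theorem entryMatch_m1' (N i : ℕ) (O : Finset ℕ) (ρ : ℕ → ℕ) (S S' : Empty → Bool → List Passage) :
    EntryMatch N ρ S S' O [⟨.minimum, i⟩, ⟨.maximum, i + 1⟩] [] := by
  refine .of_run 5 fun p up => ⟨[.ext ((run [⟨.minimum, i⟩, ⟨.maximum, i + 1⟩] 5
    (if up then 0 else 2) p up).1.map (Passage.reindex (N + ·))) []], ?_⟩
  obtain h | rfl | rfl | rfl | ⟨m, rfl⟩ := exists_eq_or_lt p i <;> cases up <;>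
    simp [run, Layer.enterUp, Layer.enterDown, Letter.expand, Letter.Good, Passage.reindex,
      Passage.key, Passage.weight, add_assoc, *] <;> omega

/-- The passages of a strand that crosses in the layers `a` below and `b` above, without local
extrema. -/
def passes (a b : ℕ) (o o' d : Bool) : List Passage :=
  if d then [.line a o true, .line b o' true] else [.line b o' false, .line a o false]

theorem net_passes (a b : ℕ) (o o' d : Bool) : net (passes a b o o' d) = 0 := by
  cases d <;> simp [passes, Passage.weight]

theorem exists_passes_eq_left (a b : ℕ) (o o' d : Bool) : ∃ l₁ l₂,
    passes a b o o' d = l₁ ++ .line a o d :: l₂ ∧ net l₂ = 0 := by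
  cases d
  · exact ⟨[_], [], rfl, rfl⟩
  · exact ⟨[], [_], rfl, rfl⟩

theorem exists_passes_eq_right (a b : ℕ) (o o' d : Bool) : ∃ l₁ l₂,
    passes a b o o' d = l₁ ++ .line b o' d :: l₂ ∧ net l₂ = 0 := by
  cases d
  · exact ⟨[], [_], rfl, rfl⟩
  · exact ⟨[_], [], rfl, rfl⟩

theorem eq_or_eq_of_mem_passes {a b : ℕ} {o o' d : Bool} {s : Passage} {l : ℕ × Bool}
    (hs : s ∈ passes a b o o' d) (h : s.key = some l) : l = (a, o) ∨ l = (b, o') := by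
  cases d <;> simp only [passes, if_true, Bool.false_eq_true, if_false, List.mem_cons,
    List.not_mem_nil, or_false] at hs <;> rcases hs with rfl | rfl <;>
    simp_all [Passage.key, eq_comm]

/-- Two strands that cross twice; the strand `true` lies over the strand `false`. -/
def Figure.double (N : ℕ) : Figure Bool where
  J := {N, N + 1}
  S k d := passes N (N + 1) k k d
  strand _ o := some o
  up _ _ d := d
  tail _ _ _ := 0
  split n hn o := by
    refine ⟨o, rfl, fun d => ?_⟩
    rcases Finset.mem_insert.1 hn with rfl | hn
    · exact exists_passes_eq_left ..
    · rw [Finset.mem_singleton.1 hn]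
      exact exists_passes_eq_right ..
  mem k d s hs l hl := by
    rcases eq_or_eq_of_mem_passes hs hl with rfl | rfl <;> simp

/-- Two strands that do not cross. -/
def Figure.parallel : Figure Bool where
  J := ∅
  S _ _ := []
  strand _ o := some o
  up _ _ d := d
  tail _ _ _ := 0
  split n hn := by simp at hn
  mem k d s hs := by simp at hs

theorem entryMatch_m2 (N i : ℕ) (O : Finset ℕ) (ρ : ℕ → ℕ) :
    EntryMatch N ρ (Figure.double N).S Figure.parallel.S O
      [⟨.underCrossing, i⟩, ⟨.overCrossing, i⟩] [] := by
  -- The over strand has position `i` at both ends of the figure and the under strand has position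
  -- `i + 1`.
  refine .of_run 3 fun p up => ⟨if p = i then [.inn true up] else if p = i + 1 then
    [.inn false up] else [], ?_⟩
  obtain h | rfl | rfl | rfl | ⟨m, rfl⟩ := exists_eq_or_lt p i <;> cases up <;>
    simp [run, Layer.enterUp, Layer.enterDown, Letter.expand, Letter.Good, Passage.reindex,
      Figure.double, Figure.parallel, passes, *]

theorem entryMatch_m2rev (N i : ℕ) (O : Finset ℕ) (ρ : ℕ → ℕ) :
    EntryMatch N ρ (Figure.double N).S Figure.parallel.S O
      [⟨.overCrossing, i⟩, ⟨.underCrossing, i⟩] [] := by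
  refine .of_run 3 fun p up => ⟨if p = i then [.inn false up] else if p = i + 1 then
    [.inn true up] else [], ?_⟩
  obtain h | rfl | rfl | rfl | ⟨m, rfl⟩ := exists_eq_or_lt p i <;> cases up <;>
    simp [run, Layer.enterUp, Layer.enterDown, Letter.expand, Letter.Good, Passage.reindex,
      Figure.double, Figure.parallel, passes, *]

/-- Three strands such that the strand `0` lies over the strand `1`, which lies over the strand `2`;
the strands `0` and `1` cross below the strand `2`. -/
def Figure.tripleBelow (N : ℕ) : Figure (Fin 3) where
  J := {N, N + 1, N + 2}
  S k d := ![passes N (N + 1) true true d, passes N (N + 2) false true d,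
    passes (N + 1) (N + 2) false false d] k
  strand n o := some (if n = N then (if o then 0 else 1) else if n = N + 1 then
    (if o then 0 else 2) else (if o then 1 else 2))
  up _ _ d := d
  tail _ _ _ := 0
  split n hn o := by
    refine ⟨_, rfl, fun d => ?_⟩
    simp only [Finset.mem_insert, Finset.mem_singleton] at hn
    rcases hn with rfl | rfl | rfl <;> cases o <;> simp <;>
      first | exact exists_passes_eq_left .. | exact exists_passes_eq_right ..
  mem k d s hs l hl := by
    fin_cases k <;> rcases eq_or_eq_of_mem_passes hs hl with rfl | rfl <;> simp

/-- Three strands such that the strand `0` lies over the strand `1`, which lies over the strand `2`;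
the strands `0` and `1` cross above the strand `2`. -/
def Figure.tripleAbove (N : ℕ) : Figure (Fin 3) where
  J := {N, N + 1, N + 2}
  S k d := ![passes (N + 1) (N + 2) true true d, passes N (N + 2) true false d,
    passes N (N + 1) false false d] k
  strand n o := some (if n = N then (if o then 1 else 2) else if n = N + 1 then
    (if o then 0 else 2) else (if o then 0 else 1))
  up _ _ d := d
  tail _ _ _ := 0
  split n hn o := by
    refine ⟨_, rfl, fun d => ?_⟩
    simp only [Finset.mem_insert, Finset.mem_singleton] at hn
    rcases hn with rfl | rfl | rfl <;> cases o <;> simp <;>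
      first | exact exists_passes_eq_left .. | exact exists_passes_eq_right ..
  mem k d s hs l hl := by
    fin_cases k <;> rcases eq_or_eq_of_mem_passes hs hl with rfl | rfl <;> simp

theorem entryMatch_m3rev (N i : ℕ) (O : Finset ℕ) (ρ : ℕ → ℕ) :
    EntryMatch N ρ (Figure.tripleBelow N).S (Figure.tripleAbove N).S O
      [⟨.underCrossing, i⟩, ⟨.underCrossing, i + 1⟩, ⟨.underCrossing, i⟩]
      [⟨.underCrossing, i + 1⟩, ⟨.underCrossing, i⟩, ⟨.underCrossing, i + 1⟩] := by
  -- The top strand runs from the lower left to the upper right and the bottom strand from the lower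
  -- right to the upper left; position `i` thus means strand `0` from below and strand `2` from
  -- above.
  refine .of_run 4 fun p up => ⟨if p = i then [.inn (if up then 0 else 2) up] else
    if p = i + 1 then [.inn 1 up] else if p = i + 2 then [.inn (if up then 2 else 0) up] else [], ?_⟩
  obtain h | rfl | rfl | rfl | ⟨m, rfl⟩ := exists_eq_or_lt p i <;> cases up <;>
    simp [run, Layer.enterUp, Layer.enterDown, Letter.expand, Letter.Good, Passage.reindex,
      Figure.tripleBelow, Figure.tripleAbove, passes, add_assoc, *]

theorem entryMatch_m3 (N i : ℕ) (O : Finset ℕ) (ρ : ℕ → ℕ) :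
    EntryMatch N ρ (Figure.tripleAbove N).S (Figure.tripleBelow N).S O
      [⟨.overCrossing, i⟩, ⟨.overCrossing, i + 1⟩, ⟨.overCrossing, i⟩]
      [⟨.overCrossing, i + 1⟩, ⟨.overCrossing, i⟩, ⟨.overCrossing, i + 1⟩] := by
  refine .of_run 4 fun p up => ⟨if p = i then [.inn (if up then 2 else 0) up] else
    if p = i + 1 then [.inn 1 up] else if p = i + 2 then [.inn (if up then 0 else 2) up] else [], ?_⟩
  obtain h | rfl | rfl | rfl | ⟨m, rfl⟩ := exists_eq_or_lt p i <;> cases up <;>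
    simp [run, Layer.enterUp, Layer.enterDown, Letter.expand, Letter.Good, Passage.reindex,
      Figure.tripleBelow, Figure.tripleAbove, passes, add_assoc, *]

/-- A vertical strand that crosses an arc, whose passages are `l₁ d`, the crossing line, and `l₂ d`.
The arc is the over strand if `a = true` and the under strand otherwise. -/
def Figure.arc (M : ℕ) (a : Bool) (l₁ l₂ : Bool → List Passage) (up : Bool → Bool)
    (h₁ : ∀ d, ∀ s ∈ l₁ d, s.key = none) (h₂ : ∀ d, ∀ s ∈ l₂ d, s.key = none) : Figure Bool where
  J := {M}
  S k d := if k = a then l₁ d ++ .line M k (up d) :: l₂ d else [.line M k d]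
  strand _ o := some o
  up _ o d := if o = a then up d else d
  tail _ o d := if o = a then net (l₂ d) else 0
  split n hn o := by
    refine ⟨o, rfl, fun d => ?_⟩
    rw [Finset.mem_singleton.1 hn]
    by_cases h : o = a
    · simp only [h, if_true]
      exact ⟨_, _, rfl, rfl⟩
    · simp only [h, if_false]
      exact ⟨[], [], rfl, rfl⟩
  mem k d s hs l hl := by
    split_ifs at hs with h
    · rcases List.mem_append.1 hs with hs | hs
      · simp [h₁ d s hs] at hl
      · rcases List.mem_cons.1 hs with rfl | hs
        · obtain rfl := Option.some.inj hl
          simp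
        · simp [h₂ d s hs] at hl
    · obtain rfl := List.mem_singleton.1 hs
      obtain rfl := Option.some.inj hl
      simp

/-- The arc of a maximum whose left leg (`left = true`) or right leg is crossed in the layer `N`,
below the maximum. -/
def Figure.maxArc (N : ℕ) (a left : Bool) : Figure Bool :=
  .arc N a (fun d => if d = left then [] else [.extremum (N + 1) (if d then .uMinus else .dPlus)])
    (fun d => if d = left then [.extremum (N + 1) (if d then .uMinus else .dPlus)] else [])
    (fun d => d == left) (fun d s hs => by split_ifs at hs <;> simp_all [Passage.key])
    (fun d s hs => by split_ifs at hs <;> simp_all [Passage.key])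

/-- The arc of a minimum whose left leg (`left = true`) or right leg is crossed in the layer `N + 1`,
above the minimum. -/
def Figure.minArc (N : ℕ) (a left : Bool) : Figure Bool :=
  .arc (N + 1) a (fun d => if d = left then [] else [.extremum N (if d then .uPlus else .dMinus)])
    (fun d => if d = left then [.extremum N (if d then .uPlus else .dMinus)] else [])
    (fun d => d != left) (fun d s hs => by split_ifs at hs <;> simp_all [Passage.key])
    (fun d s hs => by split_ifs at hs <;> simp_all [Passage.key])

theorem entryMatch_m4 (N i : ℕ) (O : Finset ℕ) (ρ : ℕ → ℕ) :
    EntryMatch N ρ (Figure.maxArc N true true).S (Figure.maxArc N true false).S O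
      [⟨.underCrossing, i⟩, ⟨.maximum, i + 1⟩] [⟨.overCrossing, i + 1⟩, ⟨.maximum, i⟩] := by
  -- The arc has its ends at `i` and `i + 2` below, and direction `true` means from left to right.
  -- The other strand runs from `i + 1` below to `i` above.
  refine .of_run 5 fun p up => ⟨if up then (if p = i then [.inn true true] else
    if p = i + 1 then [.inn false true] else if p = i + 2 then [.inn true false] else []) else
    if p = i then [.inn false false] else [], ?_⟩
  obtain h | rfl | rfl | rfl | ⟨m, rfl⟩ := exists_eq_or_lt p i <;> cases up <;>
    simp [run, Layer.enterUp, Layer.enterDown, Letter.expand, Letter.Good, Passage.reindex,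
      Figure.maxArc, Figure.arc, add_assoc, *]

theorem entryMatch_m4rev (N i : ℕ) (O : Finset ℕ) (ρ : ℕ → ℕ) :
    EntryMatch N ρ (Figure.maxArc N false true).S (Figure.maxArc N false false).S O
      [⟨.overCrossing, i⟩, ⟨.maximum, i + 1⟩] [⟨.underCrossing, i + 1⟩, ⟨.maximum, i⟩] := by
  refine .of_run 5 fun p up => ⟨if up then (if p = i then [.inn false true] else
    if p = i + 1 then [.inn true true] else if p = i + 2 then [.inn false false] else []) else
    if p = i then [.inn true false] else [], ?_⟩
  obtain h | rfl | rfl | rfl | ⟨m, rfl⟩ := exists_eq_or_lt p i <;> cases up <;>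
    simp [run, Layer.enterUp, Layer.enterDown, Letter.expand, Letter.Good, Passage.reindex,
      Figure.maxArc, Figure.arc, add_assoc, *]

theorem entryMatch_m4' (N i : ℕ) (O : Finset ℕ) (ρ : ℕ → ℕ) :
    EntryMatch N ρ (Figure.minArc N true true).S (Figure.minArc N true false).S O
      [⟨.minimum, i + 1⟩, ⟨.overCrossing, i⟩] [⟨.minimum, i⟩, ⟨.underCrossing, i + 1⟩] := by
  refine .of_run 5 fun p up => ⟨if up then (if p = i then [.inn false true] else []) else
    if p = i then [.inn true true] else if p = i + 1 then [.inn false false] else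
    if p = i + 2 then [.inn true false] else [], ?_⟩
  obtain h | rfl | rfl | rfl | ⟨m, rfl⟩ := exists_eq_or_lt p i <;> cases up <;>
    simp [run, Layer.enterUp, Layer.enterDown, Letter.expand, Letter.Good, Passage.reindex,
      Figure.minArc, Figure.arc, add_assoc, *]

theorem entryMatch_m4'rev (N i : ℕ) (O : Finset ℕ) (ρ : ℕ → ℕ) :
    EntryMatch N ρ (Figure.minArc N false true).S (Figure.minArc N false false).S O
      [⟨.minimum, i + 1⟩, ⟨.underCrossing, i⟩] [⟨.minimum, i⟩, ⟨.overCrossing, i + 1⟩] := by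
  refine .of_run 5 fun p up => ⟨if up then (if p = i then [.inn true true] else []) else
    if p = i then [.inn false true] else if p = i + 1 then [.inn true false] else
    if p = i + 2 then [.inn false false] else [], ?_⟩
  obtain h | rfl | rfl | rfl | ⟨m, rfl⟩ := exists_eq_or_lt p i <;> cases up <;>
    simp [run, Layer.enterUp, Layer.enterDown, Letter.expand, Letter.Good, Passage.reindex,
      Figure.minArc, Figure.arc, add_assoc, *]

end Tangle


/-! ### Equality of the functionals of the figures. -/

namespace OrientedQuantumCoalgebra

open Tangle Coalgebra

universe u v

variable {k : Type u} [Field k] {C : Type v} [AddCommGroup C] [Module k C] [Coalgebra k C]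
  (Q : OrientedQuantumCoalgebra k C)

theorem figureEq_empty (U U' : ℕ → Bool) : Q.FigureEq Figure.empty Figure.empty U U' := by
  intro d P R R' _ _ _ _ ι Ψ ι' Ψ' h h' x
  simpa [Figure.empty] using (h fun _ _ => 0).trans (h' fun _ _ => 0).symm

section Words

variable {R : Type*} [CommRing R] [Algebra k R] (ι : ℕ → Bool → C →ₗ[k] R)

theorem word_append (l l' : List Passage) : word ι (l ++ l') = word ι l * word ι l' := by
  simp [word]

theorem word_singleton_apply (n : ℕ) (o u : Bool) (c : C) :
    word ι [.line n o u] c = ι n o c := by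
  simp [word, Passage.letter]

theorem word_passes_apply (a b : ℕ) (o o' d : Bool) (c : C) (r : Repr k c (C × C)) :
    word ι (passes a b o o' d) c =
      ∑ i ∈ r.index, ι a o (r.lower d i) * ι b o' (r.upper d i) := by
  cases d
  · simp only [passes, Bool.false_eq_true, if_false]
    rw [word_cons, r.convMul_apply]
    refine Finset.sum_congr rfl fun i _ => ?_
    rw [word_singleton_apply, mul_comm]
    rfl
  · simp only [passes, if_true]
    rw [word_cons, r.convMul_apply]
    refine Finset.sum_congr rfl fun i _ => ?_
    rw [word_singleton_apply]
    rfl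

end Words

/-- Expanding each strand by its coproduct gives the sum of `sum_crossForm_mul_crossForm`; the
parallel figure gives the counits. -/
theorem figureEq_double (N : ℕ) (U U' : ℕ → Bool) (s : Bool) (hU : U N = s)
    (hU₁ : U (N + 1) = !s) :
    Q.FigureEq (Figure.double N) Figure.parallel U U' := by
  subst hU
  intro d P R R' _ _ _ _ ι Ψ ι' Ψ' h h' x
  have h1 : Ψ' 1 = 1 := by simpa [Figure.parallel] using h' fun _ _ => 0
  -- The family of test elements has `a`, `b` at the lower crossing and `a'`, `b'` at the upper one.
  have h2 : ∀ a b a' b' : C, Ψ (ι N true a * ι N false b *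
      (ι (N + 1) true a' * ι (N + 1) false b')) =
      Q.crossForm (U N) (d true) (d false) (P true - P false) a b *
        Q.crossForm (!U N) (d true) (d false) (P true - P false) a' b' := fun a b a' b' => by
    simpa [Figure.double, figureForm, hU₁] using
      h fun n o => if n = N then (if o then a else b) else (if o then a' else b')
  let r := fun o => Repr.arbitrary k (x o)
  rw [Fintype.prod_bool, Fintype.prod_bool]
  simp only [Figure.double, Figure.parallel]
  rw [word_passes_apply ι _ _ _ _ _ _ (r true), word_passes_apply ι _ _ _ _ _ _ (r false),
    Finset.sum_mul_sum]
  simp only [map_sum]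
  have key := Q.sum_crossForm_mul_crossForm (U N) (d true) (d false) (P true - P false) (x true)
    (x false) (r true) (r false)
  simp only [← h2] at key
  refine (Finset.sum_congr rfl fun i _ => Finset.sum_congr rfl fun j _ => ?_).trans (key.trans ?_)
  · rw [mul_mul_mul_comm]
  · simp [word, Algebra.algebraMap_eq_smul_one, h1, mul_comm]

theorem map_sum_mul_sum_mul_sum {R α β γ : Type*} [CommRing R] [Algebra k R] (Ψ : R →ₗ[k] k)
    (s : Finset α) (t : Finset β) (u : Finset γ) (f : α → R) (g : β → R) (h : γ → R) :
    Ψ ((∑ i ∈ s, f i) * (∑ j ∈ t, g j) * ∑ l ∈ u, h l) =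
      ∑ i ∈ s, ∑ j ∈ t, ∑ l ∈ u, Ψ (f i * g j * h l) := by
  rw [Finset.sum_mul_sum, Finset.sum_mul, map_sum]
  refine Finset.sum_congr rfl fun i _ => ?_
  rw [Finset.sum_mul, map_sum]
  refine Finset.sum_congr rfl fun j _ => ?_
  rw [Finset.mul_sum, map_sum]

section Triple

variable (N : ℕ) (d : Fin 3 → Bool) (P : Fin 3 → ℤ × ℤ) {R : Type (max u v)} [CommRing R]
  [Algebra k R] (ι : ℕ → Bool → C →ₗ[k] R) (Ψ : R →ₗ[k] k) (x : Fin 3 → C)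
  (r : ∀ i, Repr k (x i) (C × C))

/-- Every strand meets two crossings, the lower with its factor `lower` and the upper with `upper`.
This yields one side of `sum_crossForm_yangBaxter`; the figure `tripleAbove` yields the other. -/
theorem apply_prod_word_tripleBelow (U : ℕ → Bool) (s : Bool) (hU : U N = s) (hU₁ : U (N + 1) = s)
    (hU₂ : U (N + 2) = s)
    (h : ∀ x : ℕ → Bool → C,
      Ψ (∏ n ∈ (Figure.tripleBelow N).J, ι n true (x n true) * ι n false (x n false)) =
        ∏ n ∈ (Figure.tripleBelow N).J,
          Q.figureForm (Figure.tripleBelow N) U d P n (x n true) (x n false)) :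
    Ψ (∏ i, word ι ((Figure.tripleBelow N).S i (d i)) (x i)) =
      ∑ i ∈ (r 0).index, ∑ j ∈ (r 1).index, ∑ l ∈ (r 2).index,
        Q.crossForm s (d 0) (d 1) (P 0 - P 1) ((r 0).lower (d 0) i) ((r 1).lower (d 1) j) *
        Q.crossForm s (d 0) (d 2) (P 0 - P 2) ((r 0).upper (d 0) i) ((r 2).lower (d 2) l) *
        Q.crossForm s (d 1) (d 2) (P 1 - P 2) ((r 1).upper (d 1) j) ((r 2).upper (d 2) l) := by
  rw [Fin.prod_univ_three]
  simp only [Figure.tripleBelow, Matrix.cons_val]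
  rw [word_passes_apply ι _ _ _ _ _ _ (r 0), word_passes_apply ι _ _ _ _ _ _ (r 1),
    word_passes_apply ι _ _ _ _ _ _ (r 2), map_sum_mul_sum_mul_sum]
  refine Finset.sum_congr rfl fun i _ => Finset.sum_congr rfl fun j _ =>
    Finset.sum_congr rfl fun l _ => ?_
  have := h fun n o => if n = N then
      (if o then (r 0).lower (d 0) i else (r 1).lower (d 1) j) else if n = N + 1 then
      (if o then (r 0).upper (d 0) i else (r 2).lower (d 2) l) else
      (if o then (r 1).upper (d 1) j else (r 2).upper (d 2) l)
  simp [Figure.tripleBelow, figureForm, hU, hU₁, hU₂, ← mul_assoc] at this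
  rw [← this]
  congr 1
  ring

theorem apply_prod_word_tripleAbove (U : ℕ → Bool) (s : Bool) (hU : U N = s) (hU₁ : U (N + 1) = s)
    (hU₂ : U (N + 2) = s)
    (h : ∀ x : ℕ → Bool → C,
      Ψ (∏ n ∈ (Figure.tripleAbove N).J, ι n true (x n true) * ι n false (x n false)) =
        ∏ n ∈ (Figure.tripleAbove N).J,
          Q.figureForm (Figure.tripleAbove N) U d P n (x n true) (x n false)) :
    Ψ (∏ i, word ι ((Figure.tripleAbove N).S i (d i)) (x i)) =
      ∑ i ∈ (r 0).index, ∑ j ∈ (r 1).index, ∑ l ∈ (r 2).index,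
        Q.crossForm s (d 1) (d 2) (P 1 - P 2) ((r 1).lower (d 1) j) ((r 2).lower (d 2) l) *
        Q.crossForm s (d 0) (d 2) (P 0 - P 2) ((r 0).lower (d 0) i) ((r 2).upper (d 2) l) *
        Q.crossForm s (d 0) (d 1) (P 0 - P 1) ((r 0).upper (d 0) i) ((r 1).upper (d 1) j) := by
  rw [Fin.prod_univ_three]
  simp only [Figure.tripleAbove, Matrix.cons_val]
  rw [word_passes_apply ι _ _ _ _ _ _ (r 0), word_passes_apply ι _ _ _ _ _ _ (r 1),
    word_passes_apply ι _ _ _ _ _ _ (r 2), map_sum_mul_sum_mul_sum]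
  refine Finset.sum_congr rfl fun i _ => Finset.sum_congr rfl fun j _ =>
    Finset.sum_congr rfl fun l _ => ?_
  have := h fun n o => if n = N then
      (if o then (r 1).lower (d 1) j else (r 2).lower (d 2) l) else if n = N + 1 then
      (if o then (r 0).lower (d 0) i else (r 2).upper (d 2) l) else
      (if o then (r 0).upper (d 0) i else (r 1).upper (d 1) j)
  simp [Figure.tripleAbove, figureForm, hU, hU₁, hU₂, ← mul_assoc] at this
  rw [← this]
  congr 1
  ring

end Triple

theorem figureEq_triple (N : ℕ) (U U' : ℕ → Bool) (s : Bool) (hU : U N = s)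
    (hU₁ : U (N + 1) = s) (hU₂ : U (N + 2) = s) (hU' : U' N = s) (hU₁' : U' (N + 1) = s)
    (hU₂' : U' (N + 2) = s) :
    Q.FigureEq (Figure.tripleBelow N) (Figure.tripleAbove N) U U' := by
  intro d P R R' _ _ _ _ ι Ψ ι' Ψ' h h' x
  have r := fun i => Repr.arbitrary k (x i)
  rw [Q.apply_prod_word_tripleBelow N d P ι Ψ x r U s hU hU₁ hU₂ h,
    Q.apply_prod_word_tripleAbove N d P ι' Ψ' x r U' s hU' hU₁' hU₂' h']
  exact Q.sum_crossForm_yangBaxter s (d 0) (d 1) (d 2) (P 0) (P 1) (P 2) (x 0) (x 1) (x 2)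
    (r 0) (r 1) (r 2)

theorem FigureEq.symm {K : Type} [Fintype K] {F F' : Figure K} {U U' : ℕ → Bool}
    (h : Q.FigureEq F F' U U') : Q.FigureEq F' F U' U :=
  fun d P R R' _ _ _ _ ι Ψ ι' Ψ' h1 h2 x => (h d P R' R ι' Ψ' ι Ψ h2 h1 x).symm

theorem word_arc {R : Type*} [CommRing R] [Algebra k R] (ι : ℕ → Bool → C →ₗ[k] R) (M : ℕ)
    (a : Bool) (l₁ l₂ : Bool → List Passage) (up : Bool → Bool)
    (h₁ : ∀ d, ∀ s ∈ l₁ d, s.key = none) (h₂ : ∀ d, ∀ s ∈ l₂ d, s.key = none) (o d : Bool)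
    (c : C) : word ι ((Figure.arc M a l₁ l₂ up h₁ h₂).S o d) c = ι M o c := by
  simp only [Figure.arc]
  split_ifs
  · rw [word_append, word_cons, word_of_key_eq_none ι (h₁ d), word_of_key_eq_none ι (h₂ d)]
    simp [Passage.letter]
  · rw [word_singleton_apply]

/-- With a single crossing no strand is split by a coproduct, so both functionals are just the form
of that crossing. -/
theorem figureEq_arc (U U' : ℕ → Bool) (M : ℕ)
    (a : Bool) (l₁ l₂ l₁' l₂' : Bool → List Passage) (up up' : Bool → Bool)
    (h₁ : ∀ d, ∀ s ∈ l₁ d, s.key = none) (h₂ : ∀ d, ∀ s ∈ l₂ d, s.key = none)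
    (h₁' : ∀ d, ∀ s ∈ l₁' d, s.key = none) (h₂' : ∀ d, ∀ s ∈ l₂' d, s.key = none)
    (h : ∀ d P, Q.figureForm (.arc M a l₁ l₂ up h₁ h₂) U d P M =
      Q.figureForm (.arc M a l₁' l₂' up' h₁' h₂') U' d P M) :
    Q.FigureEq (.arc M a l₁ l₂ up h₁ h₂) (.arc M a l₁' l₂' up' h₁' h₂') U U' := by
  intro d P R R' _ _ _ _ ι Ψ ι' Ψ' hΨ hΨ' x
  simp only [word_arc, Fintype.prod_bool]
  have e := hΨ fun _ => x
  have e' := hΨ' fun _ => x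
  rw [show (Figure.arc M a l₁ l₂ up h₁ h₂).J = {M} from rfl, Finset.prod_singleton,
    Finset.prod_singleton] at e
  rw [show (Figure.arc M a l₁' l₂' up' h₁' h₂').J = {M} from rfl, Finset.prod_singleton,
    Finset.prod_singleton] at e'
  rw [e, e', h]

theorem figureEq_maxArc (N : ℕ) (U U' : ℕ → Bool) (a : Bool) (hU : U N = a) (hU' : U' N = !a) :
    Q.FigureEq (Figure.maxArc N a true) (Figure.maxArc N a false) U U' := by
  refine Q.figureEq_arc _ _ _ _ _ _ _ _ _ _ _ _ _ _ fun d P => ?_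
  simp only [figureForm, Figure.arc, Option.elim_some]
  cases a
  · have := Q.crossForm_max_under (d false) (d true) (P true - P false)
    rw [hU, hU']
    cases h : d false <;> rw [h] at this <;> simpa [Passage.weight, sub_sub, add_comm] using this
  · have := Q.crossForm_max_over (d true) (d false) (P true - P false)
    rw [hU, hU']
    cases h : d true <;> rw [h] at this <;> simpa [Passage.weight, add_sub_right_comm, add_comm] using this

theorem figureEq_minArc (N : ℕ) (U U' : ℕ → Bool) (a : Bool) (hU : U (N + 1) = !a)
    (hU' : U' (N + 1) = a) :
    Q.FigureEq (Figure.minArc N a true) (Figure.minArc N a false) U U' := by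
  refine Q.figureEq_arc _ _ _ _ _ _ _ _ _ _ _ _ _ _ fun d P => ?_
  simp only [figureForm, Figure.arc, Option.elim_some]
  cases a
  · have := Q.crossForm_min_under (d false) (d true) (P true - P false)
    rw [hU, hU']
    cases h : d false <;> rw [h] at this <;> simpa [Passage.weight, sub_sub, add_comm] using this
  · have := Q.crossForm_min_over (d true) (d false) (P true - P false)
    rw [hU, hU']
    cases h : d true <;> rw [h] at this <;> simpa [Passage.weight, add_sub_right_comm, add_comm] using this

end OrientedQuantumCoalgebra


/-! ### Exchange of the heights of two components side by side. -/

namespace Tangle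

section Exchange

variable {n p q : ℕ} {x : Layer}

theorem Layer.enterUp_of_lt (h : p < x.pos) : x.enterUp n p = (p, true, []) := by
  obtain ⟨x, i⟩ := x
  simp only at h
  cases x <;> simp only [enterUp] <;> split_ifs <;> first | rfl | omega

theorem Layer.enterUp_of_le (h : x.pos + x.kind.inputs ≤ p)
    (hq : q + x.kind.inputs = p + x.kind.outputs) : x.enterUp n p = (q, true, []) := by
  obtain ⟨x, i⟩ := x
  cases x <;> simp only [enterUp, Kind.inputs, Kind.outputs] at h hq ⊢ <;> split_ifs <;>
    simp <;> omega

theorem Layer.enterDown_of_lt (h : p < x.pos) : x.enterDown n p = (p, false, []) := by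
  obtain ⟨x, i⟩ := x
  simp only at h
  cases x <;> simp only [enterDown] <;> split_ifs <;> first | rfl | omega

theorem Layer.enterDown_of_le (h : x.pos + x.kind.outputs ≤ p)
    (hq : q + x.kind.outputs = p + x.kind.inputs) : x.enterDown n p = (q, false, []) := by
  obtain ⟨x, i⟩ := x
  cases x <;> simp only [enterDown, Kind.inputs, Kind.outputs] at h hq ⊢ <;> split_ifs <;>
    simp <;> omega

/-- A strand that enters a component from below leaves it in the same way at every position and
height. -/
theorem Kind.exists_enterUp (x : Kind) {r : ℕ} (hr : r < x.inputs) :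
    ∃ (q : ℕ) (up : Bool) (met : ℕ → List Passage),
      (∀ n i, Layer.enterUp n ⟨x, i⟩ (i + r) = (i + q, up, met n)) ∧
      (up = true → q < x.outputs) ∧ (up = false → q < x.inputs) := by
  refine ⟨(Layer.enterUp 0 ⟨x, 0⟩ r).1, (Layer.enterUp 0 ⟨x, 0⟩ r).2.1,
    fun n => (Layer.enterUp n ⟨x, 0⟩ r).2.2, ?_⟩
  cases x <;> simp only [inputs, outputs] at hr ⊢ <;> try omega
  all_goals
    obtain rfl | rfl : r = 0 ∨ r = 1 := by omega
    all_goals simp [Layer.enterUp]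

theorem Kind.exists_enterDown (x : Kind) {r : ℕ} (hr : r < x.outputs) :
    ∃ (q : ℕ) (up : Bool) (met : ℕ → List Passage),
      (∀ n i, Layer.enterDown n ⟨x, i⟩ (i + r) = (i + q, up, met n)) ∧
      (up = true → q < x.outputs) ∧ (up = false → q < x.inputs) := by
  refine ⟨(Layer.enterDown 0 ⟨x, 0⟩ r).1, (Layer.enterDown 0 ⟨x, 0⟩ r).2.1,
    fun n => (Layer.enterDown n ⟨x, 0⟩ r).2.2, ?_⟩
  cases x <;> simp only [inputs, outputs] at hr ⊢ <;> try omega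
  all_goals
    obtain rfl | rfl : r = 0 ∨ r = 1 := by omega
    all_goals simp [Layer.enterDown]

variable {K : Type} {ρ : ℕ → ℕ} {S S' : K → Bool → List Passage} {O : Finset ℕ}

/-- The letters of a strand that meets one component, whose layer gets another number. -/
theorem exists_letters_of_layer {x : Kind} {N a b : ℕ} {met : ℕ → List Passage}
    (hO : x.isCrossing = true → N + a ∈ O ∧ ρ (N + a) = N + b)
    (hkey : ∀ n, ∀ s ∈ met n, ∀ l, s.key = some l → l.1 = n ∧ x.isCrossing = true)
    (hmet : ∀ f : ℕ → ℕ, ∀ n, (met n).map (Passage.reindex f) = met (f n)) :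
    ∃ B : List (Letter K), (∀ c ∈ B, c.Good O) ∧
      (met a).map (Passage.reindex (N + ·)) = B.flatMap (Letter.expand true id S) ∧
      (met b).map (Passage.reindex (N + ·)) = B.flatMap (Letter.expand false ρ S') := by
  obtain ⟨B, h1, h2, h3⟩ := exists_letters_of_met ρ S S' O (N + b) (met (N + a))
    fun s hs l hl => by
      obtain ⟨e, hc⟩ := hkey _ s hs l hl
      rw [e]
      exact hO hc
  refine ⟨B, h1, ?_, ?_⟩
  · rw [hmet, h2]
  · rw [hmet, ← h3, hmet]

theorem exists_letters_of_enterUp {x : Kind} {N a b r q : ℕ} {up : Bool} {met : ℕ → List Passage}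
    (hO : x.isCrossing = true → N + a ∈ O ∧ ρ (N + a) = N + b)
    (h : ∀ n i, Layer.enterUp n ⟨x, i⟩ (i + r) = (i + q, up, met n)) :
    ∃ B : List (Letter K), (∀ c ∈ B, c.Good O) ∧
      (met a).map (Passage.reindex (N + ·)) = B.flatMap (Letter.expand true id S) ∧
      (met b).map (Passage.reindex (N + ·)) = B.flatMap (Letter.expand false ρ S') := by
  refine exists_letters_of_layer hO (fun n => Layer.enterUp_key (h n 0)) fun f n => ?_
  have := Layer.enterUp_reindex f n ⟨x, 0⟩ (0 + r)
  rw [h, h] at this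
  simp only [Prod.mk.injEq, true_and] at this
  exact this.symm

theorem exists_letters_of_enterDown {x : Kind} {N a b r q : ℕ} {up : Bool}
    {met : ℕ → List Passage} (hO : x.isCrossing = true → N + a ∈ O ∧ ρ (N + a) = N + b)
    (h : ∀ n i, Layer.enterDown n ⟨x, i⟩ (i + r) = (i + q, up, met n)) :
    ∃ B : List (Letter K), (∀ c ∈ B, c.Good O) ∧
      (met a).map (Passage.reindex (N + ·)) = B.flatMap (Letter.expand true id S) ∧
      (met b).map (Passage.reindex (N + ·)) = B.flatMap (Letter.expand false ρ S') := by
  refine exists_letters_of_layer hO (fun n => Layer.enterDown_key (h n 0)) fun f n => ?_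
  have := Layer.enterDown_reindex f n ⟨x, 0⟩ (0 + r)
  rw [h, h] at this
  simp only [Prod.mk.injEq, true_and] at this
  exact this.symm

/-- A strand that enters the figure lies left of `x`, at `x`, in the gap, at `y`, or right of `y`,
so it meets at most one component. It meets it in the other layer after the exchange, which `ρ`
records; extrema go into `ext` letters. -/
theorem entryMatch_exchange (x y : Kind) (i g : ℕ) {N : ℕ}
    (hx : x.isCrossing = true → N + 0 ∈ O ∧ ρ (N + 0) = N + 1)
    (hy : y.isCrossing = true → N + 1 ∈ O ∧ ρ (N + 1) = N + 0) :
    EntryMatch N ρ S S' O [⟨x, i⟩, ⟨y, i + x.outputs + g⟩]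
      [⟨y, i + x.inputs + g⟩, ⟨x, i⟩] := by
  intro p up
  cases up
  · by_cases h1 : p < i
    · refine ⟨p, false, [] ++ ([] ++ []), [] ++ ([] ++ []), [], ?_, ?_, by simp, rfl, rfl⟩
      · exact .stepDown rfl (Layer.enterDown_of_lt (by simp only; omega))
          (.stepDown rfl (Layer.enterDown_of_lt h1) (.exitBottom _))
      · exact .stepDown rfl (Layer.enterDown_of_lt h1)
          (.stepDown rfl (Layer.enterDown_of_lt (by simp only; omega)) (.exitBottom _))
    obtain ⟨r, rfl⟩ := Nat.exists_eq_add_of_le (not_lt.1 h1)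
    by_cases h2 : r < x.outputs
    · obtain ⟨q, up, met, hmet, hq, hq'⟩ := x.exists_enterDown h2
      obtain ⟨B, h3, h4, h5⟩ := exists_letters_of_enterDown (S := S) (S' := S') hx hmet
      cases up
      · have hq' := hq' rfl
        refine ⟨i + q, false, [] ++ (met 0 ++ []), met 1 ++ ([] ++ []), B, ?_, ?_, h3, by simpa,
          by simpa⟩
        · exact .stepDown rfl (Layer.enterDown_of_lt (by simp only; omega))
            (.stepDown rfl (hmet 0 i) (.exitBottom _))
        · exact .stepDown rfl (hmet 1 i)
            (.stepDown rfl (Layer.enterDown_of_lt (by simp only; omega)) (.exitBottom _))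
      · have hq := hq rfl
        refine ⟨i + q, true, [] ++ (met 0 ++ ([] ++ [])), met 1 ++ [], B, ?_, ?_, h3, by simpa,
          by simpa⟩
        · exact .stepDown rfl (Layer.enterDown_of_lt (by simp only; omega))
            (.stepDown rfl (hmet 0 i) (.stepUp rfl (Layer.enterUp_of_lt (by simp only; omega))
              (.exitTop _ rfl)))
        · exact .stepDown rfl (hmet 1 i) (.exitTop _ rfl)
    by_cases h3 : r < x.outputs + g
    · refine ⟨i + r - x.outputs + x.inputs, false, [] ++ ([] ++ []), [] ++ ([] ++ []), [], ?_, ?_,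
        by simp, rfl, rfl⟩
      · exact .stepDown rfl (Layer.enterDown_of_lt (by simp only; omega))
          (.stepDown rfl (Layer.enterDown_of_le (by simp only; omega) (by simp only; omega))
            (.exitBottom _))
      · exact .stepDown rfl (Layer.enterDown_of_le (by simp only; omega) (by simp only; omega))
          (.stepDown rfl (Layer.enterDown_of_lt (by simp only; omega)) (.exitBottom _))
    obtain ⟨r, rfl⟩ := Nat.exists_eq_add_of_le (not_lt.1 h3)
    rw [← add_assoc, ← add_assoc]
    by_cases h4 : r < y.outputs
    · obtain ⟨q, up, met, hmet, hq, hq'⟩ := y.exists_enterDown h4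
      obtain ⟨B, h5, h6, h7⟩ := exists_letters_of_enterDown (S := S) (S' := S') hy hmet
      cases up
      · refine ⟨i + x.inputs + g + q, false, met 1 ++ ([] ++ []), [] ++ (met 0 ++ []), B, ?_, ?_,
          h5, by simpa, by simpa⟩
        · exact .stepDown rfl (hmet 1 _) (.stepDown rfl
            (Layer.enterDown_of_le (by simp only; omega) (by simp only; omega)) (.exitBottom _))
        · exact .stepDown rfl (Layer.enterDown_of_le (by simp only; omega) (by simp only; omega))
            (.stepDown rfl (hmet 0 _) (.exitBottom _))
      · refine ⟨i + x.outputs + g + q, true, met 1 ++ [], [] ++ (met 0 ++ ([] ++ [])), B, ?_, ?_,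
          h5, by simpa, by simpa⟩
        · exact .stepDown rfl (hmet 1 _) (.exitTop _ rfl)
        · exact .stepDown rfl (Layer.enterDown_of_le (by simp only; omega) (by simp only; omega))
            (.stepDown rfl (hmet 0 _) (.stepUp rfl (Layer.enterUp_of_le (by simp only; omega)
              (by simp only; omega)) (.exitTop _ rfl)))
    · refine ⟨i + x.inputs + g + r - y.outputs + y.inputs, false, [] ++ ([] ++ []),
        [] ++ ([] ++ []), [], ?_, ?_, by simp, rfl, rfl⟩
      · exact .stepDown (q := i + x.outputs + g + r - y.outputs + y.inputs) rfl
          (Layer.enterDown_of_le (by simp only; omega) (by simp only; omega))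
          (.stepDown rfl (Layer.enterDown_of_le (by simp only; omega) (by simp only; omega))
            (.exitBottom _))
      · exact .stepDown (q := i + x.inputs + g + r) rfl
          (Layer.enterDown_of_le (by simp only; omega) (by simp only; omega))
          (.stepDown rfl (Layer.enterDown_of_le (by simp only; omega) (by simp only; omega))
            (.exitBottom _))
  · by_cases h1 : p < i
    · refine ⟨p, true, [] ++ ([] ++ []), [] ++ ([] ++ []), [], ?_, ?_, by simp, rfl, rfl⟩
      · exact .stepUp rfl (Layer.enterUp_of_lt h1)
          (.stepUp rfl (Layer.enterUp_of_lt (by simp only; omega)) (.exitTop _ rfl))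
      · exact .stepUp rfl (Layer.enterUp_of_lt (by simp only; omega))
          (.stepUp rfl (Layer.enterUp_of_lt h1) (.exitTop _ rfl))
    obtain ⟨r, rfl⟩ := Nat.exists_eq_add_of_le (not_lt.1 h1)
    by_cases h2 : r < x.inputs
    · obtain ⟨q, up, met, hmet, hq, hq'⟩ := x.exists_enterUp h2
      obtain ⟨B, h3, h4, h5⟩ := exists_letters_of_enterUp (S := S) (S' := S') hx hmet
      cases up
      · have hq' := hq' rfl
        refine ⟨i + q, false, met 0 ++ [], [] ++ (met 1 ++ ([] ++ [])), B, ?_, ?_, h3, by simpa,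
          by simpa⟩
        · exact .stepUp rfl (hmet 0 i) (.exitBottom _)
        · exact .stepUp rfl (Layer.enterUp_of_lt (by simp only; omega)) (.stepUp rfl (hmet 1 i)
            (.stepDown rfl (Layer.enterDown_of_lt (by simp only; omega)) (.exitBottom _)))
      · have hq := hq rfl
        refine ⟨i + q, true, met 0 ++ ([] ++ []), [] ++ (met 1 ++ []), B, ?_, ?_, h3, by simpa,
          by simpa⟩
        · exact .stepUp rfl (hmet 0 i)
            (.stepUp rfl (Layer.enterUp_of_lt (by simp only; omega)) (.exitTop _ rfl))
        · exact .stepUp rfl (Layer.enterUp_of_lt (by simp only; omega))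
            (.stepUp rfl (hmet 1 i) (.exitTop _ rfl))
    by_cases h3 : r < x.inputs + g
    · refine ⟨i + r - x.inputs + x.outputs, true, [] ++ ([] ++ []), [] ++ ([] ++ []), [], ?_, ?_,
        by simp, rfl, rfl⟩
      · exact .stepUp rfl (Layer.enterUp_of_le (by simp only; omega) (by simp only; omega))
          (.stepUp rfl (Layer.enterUp_of_lt (by simp only; omega)) (.exitTop _ rfl))
      · exact .stepUp rfl (Layer.enterUp_of_lt (by simp only; omega))
          (.stepUp rfl (Layer.enterUp_of_le (by simp only; omega) (by simp only; omega))
            (.exitTop _ rfl))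
    obtain ⟨r, rfl⟩ := Nat.exists_eq_add_of_le (not_lt.1 h3)
    rw [← add_assoc, ← add_assoc]
    by_cases h4 : r < y.inputs
    · obtain ⟨q, up, met, hmet, hq, hq'⟩ := y.exists_enterUp h4
      obtain ⟨B, h5, h6, h7⟩ := exists_letters_of_enterUp (S := S) (S' := S') hy hmet
      cases up
      · refine ⟨i + x.inputs + g + q, false, [] ++ (met 1 ++ ([] ++ [])), met 0 ++ [], B, ?_, ?_,
          h5, by simpa, by simpa⟩
        · exact .stepUp rfl (Layer.enterUp_of_le (by simp only; omega) (by simp only; omega))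
            (.stepUp rfl (hmet 1 _) (.stepDown rfl (Layer.enterDown_of_le (by simp only; omega)
              (by simp only; omega)) (.exitBottom _)))
        · exact .stepUp rfl (hmet 0 _) (.exitBottom _)
      · refine ⟨i + x.outputs + g + q, true, [] ++ (met 1 ++ []), met 0 ++ ([] ++ []), B, ?_, ?_,
          h5, by simpa, by simpa⟩
        · exact .stepUp rfl (Layer.enterUp_of_le (by simp only; omega) (by simp only; omega))
            (.stepUp rfl (hmet 1 _) (.exitTop _ rfl))
        · exact .stepUp rfl (hmet 0 _) (.stepUp rfl
            (Layer.enterUp_of_le (by simp only; omega) (by simp only; omega)) (.exitTop _ rfl))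
    · refine ⟨i + x.outputs + g + r - y.inputs + y.outputs, true, [] ++ ([] ++ []),
        [] ++ ([] ++ []), [], ?_, ?_, by simp, rfl, rfl⟩
      · exact .stepUp (q := i + x.outputs + g + r) rfl
          (Layer.enterUp_of_le (by simp only; omega) (by simp only; omega))
          (.stepUp rfl (Layer.enterUp_of_le (by simp only; omega) (by simp only; omega))
            (.exitTop _ rfl))
      · exact .stepUp (q := i + x.inputs + g + r - y.inputs + y.outputs) rfl
          (Layer.enterUp_of_le (by simp only; omega) (by simp only; omega))
          (.stepUp rfl (Layer.enterUp_of_le (by simp only; omega) (by simp only; omega))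
            (.exitTop _ rfl))

end Exchange

end Tangle


/-! ### Invariance under a single replacement. -/

namespace Tangle

theorem exists_mem_crossings_cons {x : Layer} {w : List Layer} {p : ℕ → Prop} :
    (∃ m ∈ crossings (x :: w), p m) ↔
      (x.kind.isCrossing = true ∧ p 0) ∨ ∃ m ∈ crossings w, p (m + 1) := by
  simp only [mem_crossings]
  constructor
  · rintro ⟨_ | m, ⟨y, hy, hc⟩, hm⟩
    · obtain rfl := Option.some.inj hy
      exact .inl ⟨hc, hm⟩
    · exact .inr ⟨m, ⟨y, hy, hc⟩, hm⟩
  · rintro (⟨hc, hm⟩ | ⟨m, ⟨y, hy, hc⟩, hm⟩)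
    · exact ⟨0, ⟨x, rfl, hc⟩, hm⟩
    · exact ⟨m + 1, ⟨y, hy, hc⟩, hm⟩

theorem exists_mem_crossings_nil {p : ℕ → Prop} : (∃ m ∈ crossings [], p m) ↔ False := by
  simp [mem_crossings]

/-- The total weight of the arc does not depend on where along it the crossing lies. -/
theorem net_arc {M M' : ℕ} {a : Bool} {l₁ l₂ l₁' l₂' : Bool → List Passage} {up up' : Bool → Bool}
    {h₁ : ∀ d, ∀ s ∈ l₁ d, s.key = none} {h₂ : ∀ d, ∀ s ∈ l₂ d, s.key = none}
    {h₁' : ∀ d, ∀ s ∈ l₁' d, s.key = none} {h₂' : ∀ d, ∀ s ∈ l₂' d, s.key = none}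
    (h : ∀ d, net (l₁ d) + net (l₂ d) = net (l₁' d) + net (l₂' d)) (o d : Bool) :
    net ((Figure.arc M a l₁ l₂ up h₁ h₂).S o d) =
      net ((Figure.arc M' a l₁' l₂' up' h₁' h₂').S o d) := by
  have := h d
  simp only [Figure.arc]
  split_ifs
  · simpa [Passage.weight] using this
  · rfl

end Tangle

namespace OrientedQuantumCoalgebra

open Tangle

universe u v

variable {k : Type u} [Field k] {C : Type v} [AddCommGroup C] [Module k C] [Coalgebra k C]
  (Q : OrientedQuantumCoalgebra k C)

/-- The case in which all crossings of the figure lie on its strands, so that only crossings outside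
are renumbered. -/
theorem inv_eq_of_strands {K : Type} [Fintype K] [DecidableEq K] (T T' : Diagram)
    (hup : T.up = T'.up) {below fig fig' above : List Layer}
    (hT : T.layers = below ++ fig ++ above) (hT' : T'.layers = below ++ fig' ++ above)
    (hfig : 0 < fig.length) (F F' : Figure K)
    (hJ : ∀ n, n ∈ F.J ↔ ∃ m ∈ crossings fig, n = below.length + m)
    (hJ' : ∀ n, n ∈ F'.J ↔ ∃ m ∈ crossings fig', n = below.length + m)
    (hentry : ∀ O ρ, EntryMatch below.length ρ F.S F'.S O fig fig')
    (hnet : ∀ k d, net (F.S k d) = net (F'.S k d))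
    (hstrand : ∀ k, ∃ n ∈ F.J, ∃ o, F.strand n o = some k)
    (hF : Q.FigureEq F F' (isU (below ++ fig ++ above)) (isU (below ++ fig' ++ above))) :
    Q.inv T = Q.inv T' :=
  Q.inv_eq_of_figures T T' hup hT hT' hfig F F' ∅ (level below.length fig.length fig'.length)
    (by simpa using hJ) (by simpa using hJ') (by simp) (by simp) (by simp) (fun _ _ => rfl)
    (by simp) (fun O _ => hentry O _) hnet hstrand hF

/-- The exchange needs no identity of forms: the crossings of the figure count as outer ones, and
there are no strands to compare. -/
theorem inv_eq_of_exchange (T T' : Diagram) (hup : T.up = T'.up) {below above : List Layer}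
    (x y : Kind) (i g : ℕ)
    (hT : T.layers = below ++ [⟨x, i⟩, ⟨y, i + x.outputs + g⟩] ++ above)
    (hT' : T'.layers = below ++ [⟨y, i + x.inputs + g⟩, ⟨x, i⟩] ++ above) :
    Q.inv T = Q.inv T' := by
  classical
  obtain ⟨N, hN⟩ : ∃ N, N = below.length := ⟨_, rfl⟩
  -- Both figures have two layers, so `level` is the identity outside of them and agrees there with
  -- the transposition.
  let ρ : ℕ → ℕ := Equiv.swap N (N + 1)
  have h0 : ρ N = N + 1 := Equiv.swap_apply_left _ _
  have h1 : ρ (N + 1) = N := Equiv.swap_apply_right _ _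
  let D : Finset ℕ := (if x.isCrossing then {N} else ∅) ∪ if y.isCrossing then {N + 1} else ∅
  have hD : ∀ n ∈ D, n = N ∨ n = N + 1 := by
    intro n hn
    simp only [D] at hn
    split_ifs at hn <;> simp at hn <;> tauto
  refine Q.inv_eq_of_figures T T' hup hT hT' (by simp) .empty .empty D ρ ?_ ?_ (by simp [Figure.empty])
    (by simp [Figure.empty]) (Equiv.injective _).injOn ?_ ?_ ?_ (fun k => k.elim) (fun k => k.elim)
    (Q.figureEq_empty _ _)
  · intro n
    rw [exists_mem_crossings_cons, exists_mem_crossings_cons, exists_mem_crossings_nil, ← hN]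
    simp only [Figure.empty, D]
    split_ifs with hx hy hy <;> simp [hx, hy]
  · intro n
    rw [exists_mem_crossings_cons, exists_mem_crossings_cons, exists_mem_crossings_nil, ← hN]
    simp only [Figure.empty, D]
    split_ifs with hx hy hy <;> simp [hx, hy, h0, h1, or_comm]
  · intro n hn
    rw [← hN] at hn ⊢
    simp only [List.length_cons, List.length_nil] at hn ⊢
    refine (Equiv.swap_apply_of_ne_of_ne (by omega) (by omega)).trans ?_
    rw [level]
    split_ifs <;> omega
  · have e : ∀ x' y' : Layer, isU (below ++ [x', y'] ++ above) N = isU [x'] 0 ∧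
        isU (below ++ [x', y'] ++ above) (N + 1) = isU [y'] 0 := fun x' y' =>
      hN ▸ ⟨isU_figure (fig := [x', y']) (m := 0) (by simp),
        isU_figure (fig := [x', y']) (m := 1) (by simp)⟩
    intro n hn
    rcases hD n hn with h | h
    · rw [h, h0, (e _ _).1, (e _ _).2]
    · rw [h, h1, (e _ _).1, (e _ _).2]
      rfl
  · intro O hO
    rw [← hN]
    refine entryMatch_exchange x y i g (fun h => ⟨hO ?_, h0⟩) (fun h => ⟨hO ?_, h1⟩)
    · simp [D, h]
    · simp [D, h]

theorem inv_eq_of_step {T T' : Diagram} (h : T.Step T') : Q.inv T = Q.inv T' := by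
  obtain ⟨hup, below, fig, fig', above, hm, hT, hT'⟩ := h
  have hU : ∀ {fig : List Layer} {m : ℕ} (_ : m < fig.length),
    isU (below ++ fig ++ above) (below.length + m) = isU fig m := isU_figure
  cases hm with
  | m1 i =>
    refine Q.inv_eq_of_strands T T' hup hT hT' (by simp) .empty .empty ?_ ?_
      (fun O ρ => entryMatch_m1 _ _ _ _ _ _) (fun k => k.elim) (fun k => k.elim) (Q.figureEq_empty _ _) <;>
      simp [Figure.empty, exists_mem_crossings_cons, exists_mem_crossings_nil, Kind.isCrossing]
  | m1' i =>
    refine Q.inv_eq_of_strands T T' hup hT hT' (by simp) .empty .empty ?_ ?_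
      (fun O ρ => entryMatch_m1' _ _ _ _ _ _) (fun k => k.elim) (fun k => k.elim) (Q.figureEq_empty _ _) <;>
      simp [Figure.empty, exists_mem_crossings_cons, exists_mem_crossings_nil, Kind.isCrossing]
  | m2 i =>
    refine Q.inv_eq_of_strands T T' hup hT hT' (by simp) (.double below.length) .parallel ?_ ?_
      (fun O ρ => entryMatch_m2 _ _ _ _) (fun k d => net_passes ..)
      (fun k => ⟨below.length, by simp [Figure.double], k, rfl⟩)
      (Q.figureEq_double _ _ _ true (hU (m := 0) (by simp)) (hU (m := 1) (by simp))) <;>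
      simp [Figure.double, Figure.parallel, exists_mem_crossings_cons, exists_mem_crossings_nil,
        Kind.isCrossing]
  | m2rev i =>
    refine Q.inv_eq_of_strands T T' hup hT hT' (by simp) (.double below.length) .parallel ?_ ?_
      (fun O ρ => entryMatch_m2rev _ _ _ _) (fun k d => net_passes ..)
      (fun k => ⟨below.length, by simp [Figure.double], k, rfl⟩)
      (Q.figureEq_double _ _ _ false (hU (m := 0) (by simp)) (hU (m := 1) (by simp))) <;>
      simp [Figure.double, Figure.parallel, exists_mem_crossings_cons, exists_mem_crossings_nil,
        Kind.isCrossing]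
  | m3 i =>
    refine Q.inv_eq_of_strands T T' hup hT hT' (by simp) (.tripleAbove below.length)
      (.tripleBelow below.length) ?_ ?_ (fun O ρ => entryMatch_m3 _ _ _ _) ?_ ?_
      ((Q.figureEq_triple _ _ _ false (hU (m := 0) (by simp)) (hU (m := 1) (by simp))
        (hU (m := 2) (by simp)) (hU (m := 0) (by simp)) (hU (m := 1) (by simp))
        (hU (m := 2) (by simp))).symm)
    · simp [Figure.tripleAbove, exists_mem_crossings_cons, exists_mem_crossings_nil,
        Kind.isCrossing]
    · simp [Figure.tripleBelow, exists_mem_crossings_cons, exists_mem_crossings_nil,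
        Kind.isCrossing]
    · intro k d
      fin_cases k <;> simp [Figure.tripleAbove, Figure.tripleBelow, net_passes]
    · intro k
      fin_cases k <;> simp [Figure.tripleAbove]
  | m3rev i =>
    refine Q.inv_eq_of_strands T T' hup hT hT' (by simp) (.tripleBelow below.length)
      (.tripleAbove below.length) ?_ ?_ (fun O ρ => entryMatch_m3rev _ _ _ _) ?_ ?_
      (Q.figureEq_triple _ _ _ true (hU (m := 0) (by simp)) (hU (m := 1) (by simp))
        (hU (m := 2) (by simp)) (hU (m := 0) (by simp)) (hU (m := 1) (by simp))
        (hU (m := 2) (by simp)))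
    · simp [Figure.tripleBelow, exists_mem_crossings_cons, exists_mem_crossings_nil,
        Kind.isCrossing]
    · simp [Figure.tripleAbove, exists_mem_crossings_cons, exists_mem_crossings_nil,
        Kind.isCrossing]
    · intro k d
      fin_cases k <;> simp [Figure.tripleAbove, Figure.tripleBelow, net_passes]
    · intro k
      fin_cases k <;> simp [Figure.tripleBelow]
  | m4 i =>
    refine Q.inv_eq_of_strands T T' hup hT hT' (by simp) (.maxArc below.length true true)
      (.maxArc below.length true false) ?_ ?_ (fun O ρ => entryMatch_m4 _ _ _ _)
      (net_arc fun d => by cases d <;> rfl)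
      (fun k => ⟨below.length, Finset.mem_singleton_self _, k, rfl⟩)
      (Q.figureEq_maxArc _ _ _ true (hU (m := 0) (by simp)) (hU (m := 0) (by simp))) <;>
      simp [Figure.maxArc, Figure.arc, exists_mem_crossings_cons, exists_mem_crossings_nil,
        Kind.isCrossing]
  | m4rev i =>
    refine Q.inv_eq_of_strands T T' hup hT hT' (by simp) (.maxArc below.length false true)
      (.maxArc below.length false false) ?_ ?_ (fun O ρ => entryMatch_m4rev _ _ _ _)
      (net_arc fun d => by cases d <;> rfl)
      (fun k => ⟨below.length, Finset.mem_singleton_self _, k, rfl⟩)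
      (Q.figureEq_maxArc _ _ _ false (hU (m := 0) (by simp)) (hU (m := 0) (by simp))) <;>
      simp [Figure.maxArc, Figure.arc, exists_mem_crossings_cons, exists_mem_crossings_nil,
        Kind.isCrossing]
  | m4' i =>
    refine Q.inv_eq_of_strands T T' hup hT hT' (by simp) (.minArc below.length true true)
      (.minArc below.length true false) ?_ ?_ (fun O ρ => entryMatch_m4' _ _ _ _)
      (net_arc fun d => by cases d <;> rfl)
      (fun k => ⟨below.length + 1, Finset.mem_singleton_self _, k, rfl⟩)
      (Q.figureEq_minArc _ _ _ true (hU (m := 1) (by simp)) (hU (m := 1) (by simp))) <;>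
      simp [Figure.minArc, Figure.arc, exists_mem_crossings_cons, exists_mem_crossings_nil,
        Kind.isCrossing]
  | m4'rev i =>
    refine Q.inv_eq_of_strands T T' hup hT hT' (by simp) (.minArc below.length false true)
      (.minArc below.length false false) ?_ ?_ (fun O ρ => entryMatch_m4'rev _ _ _ _)
      (net_arc fun d => by cases d <;> rfl)
      (fun k => ⟨below.length + 1, Finset.mem_singleton_self _, k, rfl⟩)
      (Q.figureEq_minArc _ _ _ false (hU (m := 1) (by simp)) (hU (m := 1) (by simp))) <;>
      simp [Figure.minArc, Figure.arc, exists_mem_crossings_cons, exists_mem_crossings_nil,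
        Kind.isCrossing]
  | exchange x y i g => exact Q.inv_eq_of_exchange T T' hup x y i g hT hT'

end OrientedQuantumCoalgebra

theorem mainTheorem2 {k : Type*} [Field k] {C : Type*} [AddCommGroup C] [Module k C]
    [Coalgebra k C] (Q : OrientedQuantumCoalgebra k C) (T T' : Tangle.Diagram)
    (h : T.RegularlyIsotopic T') : Q.inv T = Q.inv T' := by
  induction h with
  | rel T T' h => exact Q.inv_eq_of_step h
  | refl => rfl
  | symm _ _ _ ih => exact ih.symm
  | trans _ _ _ _ _ ih ih' => exact ih.trans ih'
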